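/- Fix integers $m\ge 0$ and $n\ge 1$. All trees are finite, have no vertex of valence $2$, and are considered up to isomorphism; a vertex of valence $\ge 3$ is called internal. An orientation of a tree is an ordering of its edges up to even permutations. An unrooted tree has all univalent vertices (leaves) labeled by elements of $\{1,\dots,m\}$; a rooted tree has exactly one unlabeled univalent vertex, the root, and its other univalent vertices (leaves) are labeled. The degree of a tree is $\sum_v(|v|-3)$, the sum over its internal vertices $v$ of valence $|v|$. Let $\mathbb T_{d,k}$ (resp. $\mathbb L_{d,k}$) be the abelian group generated by oriented unrooted (resp. rooted) labeled trees of degree $d$ with $k$ leaves, modulo $(T,-\mathrm{or})=-(T,\mathrm{or})$. The boundary $\partial$ of a tree is the sum of all its expansions, over all internal vertices $v$ and all unordered partitions of the half-edges at $v$ into two sets with at least two elements each; the expansion replaces $v$ by a new edge, which is numbered first, and distributes the half-edges to its two ends. Let $\overline{\mathbb L}_{\bullet,k}$ be the quotient complex of $\mathbb L_{\bullet,k}$ by the subcomplex spanned by the trees $(i,J)$, that is, the trees whose root edge ends at a trivalent vertex adjacent to a leaf. Define $\boldsymbol\eta_\bullet\colon\mathbb T_{\bullet,n+2}\to\overline{\mathbb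 L}_{\bullet+1,n+2}$ by $$\boldsymbol\eta(t)=(-1)^{\deg t}\sum_{v}\alpha_v(t),$$ where $v$ runs over the internal vertices of $t$ and $\alpha_v(t)$ is $t$ with a root edge, numbered first, attached to $v$. Let $\mathcal T_n$ be the abelian group generated by unrooted labeled unitrivalent trees with $n$ trivalent vertices and a cyclic ordering of the edges at each trivalent vertex, modulo antisymmetry (reversing the cyclic ordering at one vertex changes the sign) and the IHX relations $I=H-X$. Cyclic orderings at the vertices of such a tree determine an orientation: number some edge first, and then list, for one trivalent vertex after the other, the two edges pointing away from that first edge, in their cyclic order; this does not depend on the choices. Then $\boldsymbol\eta_\bullet$ is a chain map; taking a vertex-oriented unitrivalent tree to the same tree with the orientation it determines induces an isomorphism $\mathcal T_n\cong H_0(\mathbb T_{\bullet,n+2})$; and, through this identification, $\boldsymbol\eta_\bullet$ induces an isomorphism $$\bar\eta\colon\mathcal T_n\overset{\cong}{\longrightarrow}H_1(\overline{\mathbb L}_{\bullet,n+2}).$$ -/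

import Mathlib

namespace TreeHomology

/-! ### Trees with ordered edges -/

/-- Combinatorial data of a finite graph whose edges are numbered `0, …, e - 1`. A vertex is
recorded by its star, the set of edges incident to it. (In a tree with at least two edges different
vertices have different stars.) The label of a univalent vertex is carried by the unique edge
ending there; all other edges carry `none`, and so does the edge of an unlabeled univalent vertex.
The orientation is the one given by the numbering of the edges. -/
@[ext]
structure Sys (m e : ℕ) where
  stars : Finset (Finset (Fin e))
  label : Fin e → Option (Fin m)

variable {m e : ℕ}

namespace Sys

/-- Renumbering the edges: the edge with number `i` gets the number `σ i`. -/
def relabel (σ : Equiv.Perm (Fin e)) (t : Sys m e) : Sys m e where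
  stars := t.stars.image (fun v => v.image σ)
  label := t.label ∘ σ.symm

/-- The simple graph on the vertices; two vertices are adjacent if they share an edge. -/
def graph (t : Sys m e) : SimpleGraph t.stars where
  Adj u w := u ≠ w ∧ ¬ Disjoint u.1 w.1
  symm := ⟨fun _ _ h => ⟨h.1.symm, fun h' => h.2 h'.symm⟩⟩
  loopless := ⟨fun _ h => h.1 rfl⟩

/-- The data describe a tree without vertices of valence two: each edge has exactly two
end points, two different vertices are joined by at most one edge, the graph is a tree, and
each vertex is univalent or has valence at least three. -/
structure IsTree (t : Sys m e) : Prop where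
  two_ends : ∀ i, (t.stars.filter (fun v => i ∈ v)).card = 2
  no_parallel : ∀ u ∈ t.stars, ∀ w ∈ t.stars, u ≠ w → (u ∩ w).card ≤ 1
  isTree : t.graph.IsTree
  valence : ∀ v ∈ t.stars, v.card = 1 ∨ 3 ≤ v.card

/-- The internal vertices. -/
def internal (t : Sys m e) : Finset (Finset (Fin e)) := t.stars.filter (fun v => 3 ≤ v.card)

/-- The univalent vertices. -/
def univalent (t : Sys m e) : Finset (Finset (Fin e)) := t.stars.filter (fun v => v.card = 1)

/-- The homological degree `∑ (|v| - 3)`, over the internal vertices `v`. -/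
def degree (t : Sys m e) : ℕ := ∑ v ∈ t.internal, (v.card - 3)

/-- An unrooted labeled tree: exactly the univalent vertices carry labels. -/
structure IsUnrooted (t : Sys m e) : Prop extends t.IsTree where
  labeled : ∀ i, t.label i ≠ none ↔ {i} ∈ t.stars

/-- A rooted labeled tree: only univalent vertices carry labels, and all univalent vertices are
labeled except for a single one, the root. -/
structure IsRooted (t : Sys m e) : Prop extends t.IsTree where
  labeled : ∀ i, t.label i ≠ none → {i} ∈ t.stars
  root : ∃! r, {r} ∈ t.stars ∧ t.label r = none

/-- The tree has the form `(i, J)`: the root edge `r` ends at a trivalent vertex, at which a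
labeled univalent edge `a` ends as well. -/
def IsLeafBracket (t : Sys m e) : Prop :=
  ∃ r a b, r ≠ a ∧ r ≠ b ∧ a ≠ b ∧ {r, a, b} ∈ t.stars ∧
    {r} ∈ t.stars ∧ t.label r = none ∧ {a} ∈ t.stars ∧ t.label a ≠ none

end Sys

/-- Increase the number of each edge of a set of edges by one. -/
def up (v : Finset (Fin e)) : Finset (Fin (e + 1)) := v.image Fin.succ

/-- The unordered partitions of `v` into two sets having at least two elements each. They exist
only if `v` has at least four elements. -/
def partitions (v : Finset (Fin e)) : Finset (Finset (Finset (Fin e))) :=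
  (v.powerset.filter (fun A => 2 ≤ A.card ∧ 2 ≤ (v \ A).card)).image (fun A => {A, v \ A})

namespace Sys

/-- The expansion of `t` at the vertex `v` along the partition `P`: the new edge gets the number
`0`, and its two end points take the two parts of `P`. -/
def expand (t : Sys m e) (v : Finset (Fin e)) (P : Finset (Finset (Fin e))) : Sys m (e + 1) where
  stars := (t.stars.erase v).image up ∪ P.image (fun A => insert 0 (up A))
  label := Fin.cons none t.label

/-- Attach a root edge, with the number `0`, to the vertex `v`. -/
def attach (t : Sys m e) (v : Finset (Fin e)) : Sys m (e + 1) where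
  stars := (t.stars.erase v).image up ∪ {insert 0 (up v), {0}}
  label := Fin.cons none t.label

end Sys

/-! ### The chain groups -/

/-- The relations `(t, σ · or) = sign σ (t, or)`. They identify isomorphic oriented trees and
contain `(t, -or) = -(t, or)`. -/
def orientRel (m : ℕ) : AddSubgroup (FreeAbelianGroup (Σ e, Sys m e)) :=
  AddSubgroup.closure {x | ∃ (e : ℕ) (t : Sys m e) (σ : Equiv.Perm (Fin e)),
    x = FreeAbelianGroup.of ⟨e, t.relabel σ⟩
      - (Equiv.Perm.sign σ : ℤ) • FreeAbelianGroup.of ⟨e, t⟩}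

/-- The ambient group in which all chain groups of trees live. It is the direct sum of cyclic
groups, one for each isomorphism class of data `Sys`, so the subgroup spanned by a class of trees
is the group presented by these trees and the orientation relations. -/
abbrev Chains (m : ℕ) := FreeAbelianGroup (Σ e, Sys m e) ⧸ orientRel m

/-- The class of an oriented tree. -/
def cls (t : Sys m e) : Chains m := QuotientAddGroup.mk (FreeAbelianGroup.of ⟨e, t⟩)

theorem cls_relabel (t : Sys m e) (σ : Equiv.Perm (Fin e)) :
    cls (t.relabel σ) = (Equiv.Perm.sign σ : ℤ) • cls t := by
  have h : FreeAbelianGroup.of ⟨e, t.relabel σ⟩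
      - (Equiv.Perm.sign σ : ℤ) • FreeAbelianGroup.of (⟨e, t⟩ : Σ e, Sys m e) ∈ orientRel m :=
    AddSubgroup.subset_closure ⟨e, t, σ, rfl⟩
  have h2 := (QuotientAddGroup.eq_zero_iff _).2 h
  rw [QuotientAddGroup.mk_sub, QuotientAddGroup.mk_zsmul, sub_eq_zero] at h2
  exact h2

/-- A homomorphism on `Chains m` from its values on oriented trees. -/
def liftChains {A : Type*} [AddCommGroup A] (f : ∀ e, Sys m e → A)
    (hf : ∀ e (t : Sys m e) (σ : Equiv.Perm (Fin e)),
      f e (t.relabel σ) = (Equiv.Perm.sign σ : ℤ) • f e t) : Chains m →+ A :=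
  QuotientAddGroup.lift (orientRel m) (FreeAbelianGroup.lift (fun t => f t.1 t.2)) (by
    unfold orientRel
    rw [AddSubgroup.closure_le]
    rintro x ⟨e, t, σ, rfl⟩
    simp [hf])

theorem liftChains_cls {A : Type*} [AddCommGroup A] (f : ∀ e, Sys m e → A) (hf) (t : Sys m e) :
    liftChains f hf (cls t) = f e t := by
  simp [liftChains, cls]

/-! ### Compatibility of expansions and root edges with renumbering -/

/-- The permutation that fixes `0` and acts as `σ` on the other numbers. -/
def upPerm (σ : Equiv.Perm (Fin e)) : Equiv.Perm (Fin (e + 1)) :=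
  Equiv.Perm.decomposeFin.symm (0, σ)

theorem sign_upPerm (σ : Equiv.Perm (Fin e)) :
    Equiv.Perm.sign (upPerm σ) = Equiv.Perm.sign σ := by
  simp [upPerm]

theorem upPerm_zero (σ : Equiv.Perm (Fin e)) : upPerm σ 0 = 0 := by
  simp [upPerm]

theorem upPerm_succ (σ : Equiv.Perm (Fin e)) (i : Fin e) : upPerm σ i.succ = (σ i).succ := by
  simp [upPerm]

theorem up_image (σ : Equiv.Perm (Fin e)) (v : Finset (Fin e)) :
    up (v.image σ) = (up v).image (upPerm σ) := by
  simp only [up, Finset.image_image]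
  exact Finset.image_congr fun i _ => by simp [upPerm_succ]

theorem image_insert_up (σ : Equiv.Perm (Fin e)) (v : Finset (Fin e)) :
    (insert 0 (up v)).image (upPerm σ) = insert 0 (up (v.image σ)) := by
  rw [Finset.image_insert, upPerm_zero, up_image]

theorem image_inj (σ : Equiv.Perm (Fin e)) :
    Function.Injective (fun v : Finset (Fin e) => v.image σ) :=
  Finset.image_injective σ.injective

theorem cons_label (l : Fin e → Option (Fin m)) (σ : Equiv.Perm (Fin e)) :
    (Fin.cons none (l ∘ σ.symm) : Fin (e + 1) → Option (Fin m))
      = (Fin.cons none l : Fin (e + 1) → Option (Fin m)) ∘ (upPerm σ).symm := by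
  rw [Equiv.eq_comp_symm]
  funext i
  refine Fin.cases ?_ (fun j => ?_) i
  · simp [upPerm_zero]
  · simp [upPerm_succ]

theorem erase_image_up (t : Sys m e) (σ : Equiv.Perm (Fin e)) (v : Finset (Fin e)) :
    ((t.relabel σ).stars.erase (v.image σ)).image up
      = ((t.stars.erase v).image up).image (fun w => w.image (upPerm σ)) := by
  have h : (t.relabel σ).stars.erase (v.image σ)
      = (t.stars.erase v).image (fun w => w.image σ) := by
    rw [Finset.image_erase (image_inj σ)]
    rfl
  rw [h, Finset.image_image, Finset.image_image]
  congr 1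
  funext w
  simp [up_image]

theorem expand_relabel (t : Sys m e) (σ : Equiv.Perm (Fin e)) (v : Finset (Fin e))
    (P : Finset (Finset (Fin e))) :
    (t.relabel σ).expand (v.image σ) (P.image (fun A => A.image σ))
      = (t.expand v P).relabel (upPerm σ) := by
  ext1
  · simp only [Sys.expand]
    rw [erase_image_up]
    simp only [Sys.relabel, Finset.image_union]
    congr 1
    rw [Finset.image_image, Finset.image_image]
    congr 1
    funext A
    exact (image_insert_up σ A).symm
  · exact cons_label _ _

theorem attach_relabel (t : Sys m e) (σ : Equiv.Perm (Fin e)) (v : Finset (Fin e)) :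
    (t.relabel σ).attach (v.image σ) = (t.attach v).relabel (upPerm σ) := by
  ext1
  · simp only [Sys.attach]
    rw [erase_image_up]
    simp only [Sys.relabel, Finset.image_union]
    congr 1
    rw [Finset.image_insert, image_insert_up, Finset.image_singleton, Finset.image_singleton,
      upPerm_zero]
  · exact cons_label _ _

theorem partitions_image (σ : Equiv.Perm (Fin e)) (v : Finset (Fin e)) :
    partitions (v.image σ) = (partitions v).image (fun P => P.image (fun A => A.image σ)) := by
  unfold partitions
  rw [Finset.image_image]
  ext P
  simp only [Finset.mem_image, Finset.mem_filter, Finset.mem_powerset, Function.comp]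
  constructor
  · rintro ⟨A, ⟨hA, h1, h2⟩, rfl⟩
    obtain ⟨B, hB, rfl⟩ := Finset.subset_image_iff.1 hA
    rw [← Finset.image_sdiff _ _ σ.injective, Finset.card_image_of_injective _ σ.injective] at h2
    rw [Finset.card_image_of_injective _ σ.injective] at h1
    exact ⟨B, ⟨by exact_mod_cast hB, h1, h2⟩, by
      rw [Finset.image_insert, Finset.image_singleton, Finset.image_sdiff _ _ σ.injective]⟩
  · rintro ⟨B, ⟨hB, h1, h2⟩, rfl⟩
    refine ⟨B.image σ, ⟨Finset.image_subset_image hB, ?_, ?_⟩, ?_⟩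
    · rwa [Finset.card_image_of_injective _ σ.injective]
    · rwa [← Finset.image_sdiff _ _ σ.injective, Finset.card_image_of_injective _ σ.injective]
    · rw [Finset.image_insert, Finset.image_singleton, Finset.image_sdiff _ _ σ.injective]

theorem internal_relabel (t : Sys m e) (σ : Equiv.Perm (Fin e)) :
    (t.relabel σ).internal = t.internal.image (fun v => v.image σ) := by
  simp only [Sys.internal, Sys.relabel, Finset.filter_image,
    Finset.card_image_of_injective _ σ.injective]

theorem degree_relabel (t : Sys m e) (σ : Equiv.Perm (Fin e)) :
    (t.relabel σ).degree = t.degree := by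
  unfold Sys.degree
  rw [internal_relabel, Finset.sum_image (fun _ _ _ _ h => image_inj σ h)]
  simp only [Finset.card_image_of_injective _ σ.injective]

/-! ### The complexes -/

/-- The boundary operator: the sum of all expansions. -/
def boundary (m : ℕ) : Chains m →+ Chains m :=
  liftChains (fun _ t => ∑ v ∈ t.stars, ∑ P ∈ partitions v, cls (t.expand v P)) (by
    intro e t σ
    have h : (t.relabel σ).stars = t.stars.image (fun v => v.image σ) := rfl
    rw [h, Finset.sum_image (fun _ _ _ _ h => image_inj σ h), Finset.smul_sum]
    refine Finset.sum_congr rfl fun v _ => ?_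
    rw [partitions_image,
      Finset.sum_image (fun _ _ _ _ h => Finset.image_injective (image_inj σ) h),
      Finset.smul_sum]
    refine Finset.sum_congr rfl fun P _ => ?_
    rw [expand_relabel, cls_relabel, sign_upPerm])

/-- The chain group `𝕋_{d,k}`, spanned by the oriented labeled unrooted trees of homological
degree `d` with `k` leaves. -/
def unrootedChains (m k d : ℕ) : AddSubgroup (Chains m) :=
  AddSubgroup.closure {x | ∃ (e : ℕ) (t : Sys m e),
    t.IsUnrooted ∧ t.univalent.card = k ∧ t.degree = d ∧ x = cls t}

/-- The chain group `𝕃_{d,k}`, spanned by the oriented labeled rooted trees of homological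
degree `d` with `k` leaves (and so with `k + 1` univalent vertices). -/
def rootedChains (m k d : ℕ) : AddSubgroup (Chains m) :=
  AddSubgroup.closure {x | ∃ (e : ℕ) (t : Sys m e),
    t.IsRooted ∧ t.univalent.card = k + 1 ∧ t.degree = d ∧ x = cls t}

/-- The span of the trees of the form `(i, J)`. -/
def leafBrackets (m : ℕ) : AddSubgroup (Chains m) :=
  AddSubgroup.closure {x | ∃ (e : ℕ) (t : Sys m e), t.IsLeafBracket ∧ x = cls t}

theorem card_of_mem_partitions {v : Finset (Fin e)} {P : Finset (Finset (Fin e))}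
    (hP : P ∈ partitions v) : 4 ≤ v.card := by
  simp only [partitions, Finset.mem_image, Finset.mem_filter, Finset.mem_powerset] at hP
  obtain ⟨A, ⟨hA, h1, h2⟩, -⟩ := hP
  have := Finset.card_sdiff_add_card_eq_card hA
  omega

theorem isLeafBracket_expand {t : Sys m e} (ht : t.IsLeafBracket) {v : Finset (Fin e)}
    {P : Finset (Finset (Fin e))} (hP : P ∈ partitions v) : (t.expand v P).IsLeafBracket := by
  have hv := card_of_mem_partitions hP
  obtain ⟨r, a, b, hra, hrb, hab, h3, hr, hrl, ha, hal⟩ := ht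
  have key : ∀ w ∈ t.stars, w.card ≤ 3 → up w ∈ (t.expand v P).stars := by
    intro w hw hc
    refine Finset.mem_union_left _ (Finset.mem_image_of_mem _ (Finset.mem_erase.2 ⟨?_, hw⟩))
    rintro rfl
    omega
  refine ⟨r.succ, a.succ, b.succ, by simpa using hra, by simpa using hrb, by simpa using hab,
    ?_, ?_, ?_, ?_, ?_⟩
  · simpa [up] using key _ h3 Finset.card_le_three
  · simpa [up] using key _ hr (by simp)
  · simpa [Sys.expand] using hrl
  · simpa [up] using key _ ha (by simp)
  · simpa [Sys.expand] using hal

theorem leafBrackets_le_comap (m : ℕ) :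
    leafBrackets m ≤ (leafBrackets m).comap (boundary m) := by
  conv_lhs => unfold leafBrackets
  rw [AddSubgroup.closure_le]
  rintro x ⟨e, t, ht, rfl⟩
  change boundary m (cls t) ∈ leafBrackets m
  rw [boundary, liftChains_cls]
  exact AddSubgroup.sum_mem _ fun v _ => AddSubgroup.sum_mem _ fun P hP =>
    AddSubgroup.subset_closure ⟨_, _, isLeafBracket_expand ht hP, rfl⟩

/-- The quotient of the ambient group by the trees of the form `(i, J)`. -/
abbrev ChainsBar (m : ℕ) := Chains m ⧸ leafBrackets m

/-- The boundary operator on the quotient. -/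
def boundaryBar (m : ℕ) : ChainsBar m →+ ChainsBar m :=
  QuotientAddGroup.map _ _ (boundary m) (leafBrackets_le_comap m)

/-- The quotient chain group of `𝕃_{d,k}` by the trees of the form `(i, J)`. -/
def rootedChainsBar (m k d : ℕ) : AddSubgroup (ChainsBar m) :=
  (rootedChains m k d).map (QuotientAddGroup.mk' (leafBrackets m))

/-- The map that sends an unrooted tree `t` to the sum over attaching a root edge, numbered first,
to each internal vertex of `t`, multiplied by the sign `(-1) ^ deg t`. -/
def attachRoot (m : ℕ) : Chains m →+ ChainsBar m :=
  (QuotientAddGroup.mk' (leafBrackets m)).comp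
    (liftChains (fun _ t => ((-1 : ℤ) ^ t.degree) • ∑ v ∈ t.internal, cls (t.attach v)) (by
      intro e t σ
      rw [degree_relabel, internal_relabel, Finset.sum_image (fun _ _ _ _ h => image_inj σ h),
        smul_comm, Finset.smul_sum (r := (Equiv.Perm.sign σ : ℤ))]
      refine congrArg _ (Finset.sum_congr rfl fun v _ => ?_)
      rw [attach_relabel, cls_relabel, sign_upPerm]))

/-! ### Homology -/

/-- The cycles of degree `d` of the complex with chain groups `G d` and differential `δ`. -/
def cycles {A : Type*} [AddCommGroup A] (δ : A →+ A) (G : ℕ → AddSubgroup A) (d : ℕ) :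
    AddSubgroup A := G d ⊓ δ.ker

/-- The homology in degree `d`: cycles modulo boundaries. -/
abbrev Homology {A : Type*} [AddCommGroup A] (δ : A →+ A) (G : ℕ → AddSubgroup A) (d : ℕ) :=
  cycles δ G d ⧸ ((G (d + 1)).map δ).addSubgroupOf (cycles δ G d)

/-- The homology class of a cycle. -/
def homologyClass {A : Type*} [AddCommGroup A] (δ : A →+ A) (G : ℕ → AddSubgroup A) (d : ℕ)
    (x : A) (hx : x ∈ cycles δ G d) : Homology δ G d :=
  QuotientAddGroup.mk (⟨x, hx⟩ : cycles δ G d)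

/-! ### Vertex-oriented unitrivalent trees -/

/-- As `Sys`, but each vertex is recorded by a cyclic ordering of the edges incident to it. The
numbering of the edges serves only to name them. -/
@[ext]
structure CycSys (m e : ℕ) where
  verts : Finset (Cycle (Fin e))
  label : Fin e → Option (Fin m)

namespace CycSys

/-- Renumbering the edges. -/
def relabel (σ : Equiv.Perm (Fin e)) (t : CycSys m e) : CycSys m e where
  verts := t.verts.image (Cycle.map σ)
  label := t.label ∘ σ.symm

/-- Forget the cyclic orderings. -/
def toSys (t : CycSys m e) : Sys m e where
  stars := t.verts.image Cycle.toFinset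
  label := t.label

/-- A labeled unrooted unitrivalent tree with `n` trivalent vertices and with a cyclic ordering
of the edges at each vertex. -/
structure IsUnitrivalent (n : ℕ) (t : CycSys m e) : Prop where
  nodup : ∀ c ∈ t.verts, c.Nodup
  injOn : Set.InjOn Cycle.toFinset (t.verts : Set (Cycle (Fin e)))
  isUnrooted : t.toSys.IsUnrooted
  valence : ∀ c ∈ t.verts, c.length = 1 ∨ c.length = 3
  card_internal : (t.verts.filter (fun c => c.length = 3)).card = n

end CycSys

/-- The oriented unitrivalent trees with `n` internal vertices; such a tree has `2 n + 1` edges. -/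
abbrev UTree (m n : ℕ) := {t : CycSys m (2 * n + 1) // t.IsUnitrivalent n}

open FreeAbelianGroup (of) in
/-- Isomorphic trees are identified. -/
def isoRel (m n : ℕ) : Set (FreeAbelianGroup (UTree m n)) :=
  {x | ∃ t t' : UTree m n, (∃ σ, t'.1 = t.1.relabel σ) ∧ x = of t' - of t}

open FreeAbelianGroup (of) in
/-- Antisymmetry: reversing the cyclic ordering at one trivalent vertex changes the sign. -/
def asRel (m n : ℕ) : Set (FreeAbelianGroup (UTree m n)) :=
  {x | ∃ t t' : UTree m n, (∃ c ∈ t.1.verts, c.length = 3 ∧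
      t'.1.verts = insert c.reverse (t.1.verts.erase c) ∧ t'.1.label = t.1.label) ∧
    x = of t' + of t}

open FreeAbelianGroup (of) in
/-- The relation `I = H - X`: the three trees agree except at the two ends of the edge `x`, where
the four adjacent edges are `a` (upper left), `b` (upper right), `c` (lower left) and
`d` (lower right), and the cyclic orderings are the counterclockwise ones. -/
def ihxRel (m n : ℕ) : Set (FreeAbelianGroup (UTree m n)) :=
  {y | ∃ (tI tH tX : UTree m n) (W : Finset (Cycle (Fin (2 * n + 1))))
      (x a b c d : Fin (2 * n + 1)),
    tI.1.verts = W ∪ {([x, b, a] : Cycle _), ([x, c, d] : Cycle _)} ∧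
    tH.1.verts = W ∪ {([x, a, c] : Cycle _), ([x, d, b] : Cycle _)} ∧
    tX.1.verts = W ∪ {([x, b, c] : Cycle _), ([x, d, a] : Cycle _)} ∧
    tH.1.label = tI.1.label ∧ tX.1.label = tI.1.label ∧
    y = of tI - (of tH - of tX)}

/-- The group `𝒯_n` of oriented labeled unitrivalent trees with `n` internal vertices modulo
antisymmetry and IHX relations. -/
abbrev TreeGroup (m n : ℕ) :=
  FreeAbelianGroup (UTree m n) ⧸ AddSubgroup.closure (isoRel m n ∪ asRel m n ∪ ihxRel m n)

/-- The class of a tree in `𝒯_n`. -/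
def treeClass {n : ℕ} (t : UTree m n) : TreeGroup m n :=
  QuotientAddGroup.mk (FreeAbelianGroup.of t)

/-- The numbering of the edges is compatible with the cyclic orderings at the vertices: after the
edge `0` it lists, for one internal vertex after the other, the two edges at this vertex that
point away from the edge `0`, in the order in which they follow the third edge `p` in the cyclic
ordering. (That `p` is the edge towards the edge `0` is automatic in a tree. Each tree has such
numberings, and they all define the same orientation in the sense of orderings of the edges up to
even permutations. For trees built by brackets it is the orientation that numbers the root edge
first, then the edges of the first factor and then those of the second.) -/
def Compatible {n : ℕ} (t : UTree m n) : Prop :=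
  ∀ c ∈ t.1.verts, c.length = 3 → ∃ (p : Fin (2 * n + 1)) (j : Fin n),
    c = ([p, ⟨2 * j + 1, by omega⟩, ⟨2 * j + 2, by omega⟩] : Cycle _)

end TreeHomology

namespace TreeHomology
variable {m e : ℕ}

/-! ### Shifting edge sets -/

/-! Chain map. The expansions of `t.attach v` are of two kinds. Either they arise from an expansion
of `t` by attaching the root afterwards, with the two new edges numbered in the opposite order, and
the factor (-1)^deg absorbs the sign. Or the root is split off together with one edge `h` at `v`,
and then it sits in the middle of `h`: this tree is `edgeRoot`. Seen from the other end of `h` it is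
the same tree with the opposite orientation, and if `h` is a leaf edge it has the form (i, J). So
the second kind cancels in the quotient (`sum_edgeRoot_eq_zero`).

Comparison of homology. Up to sign, a rooted tree not of the form (i, J) is some `t.attach v`, with
the root at a vertex of valence at least four, or some `t.edgeRoot v h` with `h` joining internal
vertices (`rooted_cases`). Pushing the root outwards along boundaries of trees `t.attach w` shows
that every chain is a boundary plus a combination of trees of the first kind (`rootedChainsBar_le`).
Conversely, let Φ kill the trees of the first kind and send `t.edgeRoot v h` to the sum of all
`t.attach x` with `x` internal and beyond `h`, modulo the image of η. Exchanging the ends of `h`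
changes the sign of this value, because the two sums add up to η(t) up to sign. The vertices beyond
the various edges at `v` are all vertices but `v`, so Φ(∂(t.attach v)) = ±η(t) - t.attach v, which
is -t.attach v in the quotient (`exists_splitRoot_boundaryBar`). Hence a cycle of trees of the first
kind lies in the image of η, which gives surjectivity. If η(x) is a boundary, the same argument
gives x' with η(x - ∂x') = 0.

Kernel in degree zero. Forgetting the root after η is multiplication by `n`, the number of trivalent
vertices, so the kernel is torsion. Torsion is spanned by the trees with an orientation reversing
automorphism and has exponent two (`mem_torsionSpan`), so it does not contribute for odd `n`. For
even `n` each such tree is a boundary: a reversing automorphism of 2-power order with as many fixed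
edges as possible exchanges two edges at one end of some edge `p` and fixes the edges at the other
end. The contraction of `p` has three expansions, namely the tree itself and two that this
automorphism interchanges with sign -1 (`cls_mem_map_boundary_of_not_evenAut`).

Identification of 𝒯_n. Numberings compatible with the cyclic orderings exist and differ by even
permutations, so each vertex-oriented tree has a sign `orientSign` comparing it with the given
numbering. Reversing a vertex changes this sign; in an IHX triple I and X have the same sign and H
the opposite one. Thus I - H + X goes, up to sign, to the sum of the three expansions at a
four-valent vertex, and these sums are exactly the boundaries in degree zero (`exists_treeEquiv`).
-/

/-- Shift a set of edges by one and add the new edge `0`. -/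
def ins (A : Finset (Fin e)) : Finset (Fin (e + 1)) := insert 0 (up A)

@[simp] theorem succ_mem_up {v : Finset (Fin e)} {i : Fin e} : i.succ ∈ up v ↔ i ∈ v := by
  simp [up]

@[simp] theorem zero_notMem_up {v : Finset (Fin e)} : (0 : Fin (e + 1)) ∉ up v := by
  simp [up]

@[simp] theorem succ_mem_ins {v : Finset (Fin e)} {i : Fin e} : i.succ ∈ ins v ↔ i ∈ v := by
  simp [ins]

@[simp] theorem zero_mem_ins {v : Finset (Fin e)} : (0 : Fin (e + 1)) ∈ ins v := by
  simp [ins]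

theorem finset_ext_fin {A B : Finset (Fin (e + 1))} (h0 : 0 ∈ A ↔ 0 ∈ B)
    (hs : ∀ i : Fin e, i.succ ∈ A ↔ i.succ ∈ B) : A = B := by
  ext i
  exact Fin.cases h0 hs i

theorem up_injective : Function.Injective (up : Finset (Fin e) → _) :=
  Finset.image_injective (Fin.succ_injective e)

theorem ins_injective : Function.Injective (ins : Finset (Fin e) → _) := by
  intro A B h
  ext i
  rw [← succ_mem_ins, h, succ_mem_ins]

@[simp] theorem up_inj {A B : Finset (Fin e)} : up A = up B ↔ A = B := up_injective.eq_iff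

@[simp] theorem ins_inj {A B : Finset (Fin e)} : ins A = ins B ↔ A = B := ins_injective.eq_iff

@[simp] theorem ins_ne_up {A B : Finset (Fin e)} : ins A ≠ up B :=
  fun h => zero_notMem_up (h ▸ zero_mem_ins)

@[simp] theorem up_ne_ins {A B : Finset (Fin e)} : up B ≠ ins A := fun h => ins_ne_up h.symm

@[simp] theorem card_up (v : Finset (Fin e)) : (up v).card = v.card :=
  Finset.card_image_of_injective _ (Fin.succ_injective e)

@[simp] theorem card_ins (v : Finset (Fin e)) : (ins v).card = v.card + 1 := by
  rw [ins, Finset.card_insert_of_notMem zero_notMem_up, card_up]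

theorem up_sdiff (A B : Finset (Fin e)) : up (A \ B) = up A \ up B :=
  finset_ext_fin (by simp) (by simp)

theorem ins_sdiff_ins (A B : Finset (Fin e)) : ins A \ ins B = up (A \ B) :=
  finset_ext_fin (by simp) (by simp)

theorem ins_empty : ins (∅ : Finset (Fin e)) = {0} := by simp [ins, up]

theorem up_singleton (i : Fin e) : up {i} = {i.succ} := by simp [up]

theorem exists_up_of_zero_notMem {A : Finset (Fin (e + 1))} (h : 0 ∉ A) : ∃ B, A = up B :=
  ⟨Finset.univ.filter fun i => i.succ ∈ A, finset_ext_fin (by simpa using h) (by simp)⟩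

theorem exists_ins_of_zero_mem {A : Finset (Fin (e + 1))} (h : 0 ∈ A) : ∃ B, A = ins B :=
  ⟨Finset.univ.filter fun i => i.succ ∈ A, finset_ext_fin (by simpa using h) (by simp)⟩

@[simp] theorem up_subset_up {A B : Finset (Fin e)} : up A ⊆ up B ↔ A ⊆ B := by
  refine ⟨fun h i hi => ?_, fun h => Finset.image_subset_image h⟩
  simpa using h (succ_mem_up.2 hi)

@[simp] theorem ins_subset_ins {A B : Finset (Fin e)} : ins A ⊆ ins B ↔ A ⊆ B := by
  refine ⟨fun h i hi => ?_, fun h => Finset.insert_subset_insert _ (Finset.image_subset_image h)⟩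
  simpa using h (succ_mem_ins.2 hi)

/-! ### Renumbering -/

namespace Sys

theorem relabel_one (t : Sys m e) : t.relabel 1 = t := by
  ext1
  · simp [relabel]
  · rfl

theorem relabel_mul (t : Sys m e) (σ τ : Equiv.Perm (Fin e)) :
    t.relabel (τ * σ) = (t.relabel σ).relabel τ := by
  ext1
  · simp [relabel, Finset.image_image, Function.comp_def]
  · rfl

theorem relabel_inv_relabel (t : Sys m e) (σ : Equiv.Perm (Fin e)) :
    (t.relabel σ).relabel σ⁻¹ = t := by
  rw [← relabel_mul, inv_mul_cancel, relabel_one]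

theorem image_mem_relabel {t : Sys m e} {σ : Equiv.Perm (Fin e)} {v : Finset (Fin e)} :
    v.image σ ∈ (t.relabel σ).stars ↔ v ∈ t.stars := by
  simp only [relabel, Finset.mem_image]
  exact ⟨fun ⟨w, hw, h⟩ => image_inj σ h ▸ hw, fun h => ⟨v, h, rfl⟩⟩

theorem mem_relabel {t : Sys m e} {σ : Equiv.Perm (Fin e)} {v : Finset (Fin e)} :
    v ∈ (t.relabel σ).stars ↔ ∃ w ∈ t.stars, w.image σ = v := by
  simp [relabel]

theorem label_relabel (t : Sys m e) (σ : Equiv.Perm (Fin e)) (i : Fin e) :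
    (t.relabel σ).label (σ i) = t.label i := by
  simp [relabel]

theorem singleton_mem_relabel {t : Sys m e} {σ : Equiv.Perm (Fin e)} {i : Fin e} :
    {σ i} ∈ (t.relabel σ).stars ↔ {i} ∈ t.stars := by
  rw [← image_mem_relabel (t := t) (σ := σ), Finset.image_singleton]

end Sys

theorem exists_upPerm {σ : Equiv.Perm (Fin (e + 1))} (h : σ 0 = 0) : ∃ τ, σ = upPerm τ := by
  refine ⟨(Equiv.Perm.decomposeFin σ).2, ?_⟩
  have h1 : (Equiv.Perm.decomposeFin σ).1 = 0 := by
    have h2 := Equiv.Perm.decomposeFin_symm_apply_zero (Equiv.Perm.decomposeFin σ).1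
      (Equiv.Perm.decomposeFin σ).2
    rw [Prod.mk.eta, Equiv.symm_apply_apply, h] at h2
    exact h2.symm
  rw [upPerm, ← h1, Prod.mk.eta, Equiv.symm_apply_apply]

theorem sq_sign (σ : Equiv.Perm (Fin e)) :
    (Equiv.Perm.sign σ : ℤ) * (Equiv.Perm.sign σ : ℤ) = 1 := by
  rcases Int.units_eq_one_or (Equiv.Perm.sign σ) with h | h <;> simp [h]

theorem sign_smul_sign_smul {A : Type*} [AddCommGroup A] (σ : Equiv.Perm (Fin e)) (a : A) :
    (Equiv.Perm.sign σ : ℤ) • (Equiv.Perm.sign σ : ℤ) • a = a := by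
  rw [smul_smul, sq_sign, one_smul]

/-- A homomorphism on `Chains m` can be prescribed on a class of oriented trees if the prescribed
values are compatible with renumbering; it can be chosen to vanish on all other trees. -/
theorem exists_lift {A : Type*} [AddCommGroup A] (R : ∀ e, Sys m e → A → Prop)
    (hR : ∀ e (t : Sys m e) (σ : Equiv.Perm (Fin e)) (a b : A), R e t a → R e (t.relabel σ) b →
      b = (Equiv.Perm.sign σ : ℤ) • a) :
    ∃ f : Chains m →+ A, (∀ e (t : Sys m e) a, R e t a → f (cls t) = a) ∧
      ∀ e (t : Sys m e), (∀ σ a, ¬ R e (t.relabel σ) a) → f (cls t) = 0 := by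
  classical
  let P : ∀ e, Sys m e → Equiv.Perm (Fin e) × A → Prop := fun e t p => R e (t.relabel p.1) p.2
  -- The value is transported from any renumbering of `t` on which one is prescribed, and it is `0`
  -- if there is none.
  let F : ∀ e, Sys m e → A := fun e t => if h : ∃ p, P e t p then
    (Equiv.Perm.sign h.choose.1 : ℤ) • h.choose.2 else 0
  -- The choice does not matter: two admissible renumberings `p.1` and `σ` differ by `σ * p.1⁻¹`,
  -- and `hR` compares their values.
  have hF : ∀ e (t : Sys m e) σ a, R e (t.relabel σ) a →
      F e t = (Equiv.Perm.sign σ : ℤ) • a := by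
    intro e t σ a h
    have hex : ∃ p, P e t p := ⟨(σ, a), h⟩
    have hs := hex.choose_spec
    simp only [F, dif_pos hex]
    set p := hex.choose
    have h2 : R e ((t.relabel p.1).relabel (σ * p.1⁻¹)) a := by
      rw [← Sys.relabel_mul, inv_mul_cancel_right]
      exact h
    rw [hR _ _ _ _ _ hs h2, smul_smul]
    congr 1
    rw [map_mul, map_inv, Int.units_inv_eq_self, Units.val_mul, ← mul_assoc, sq_sign, one_mul]
  refine ⟨liftChains F ?_, fun e t a h => ?_, fun e t h => ?_⟩
  · intro e t σ
    by_cases hex : ∃ p, P e t p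
    · obtain ⟨p, hp⟩ := hex
      have h2 : R e ((t.relabel σ).relabel (p.1 * σ⁻¹)) p.2 := by
        rw [← Sys.relabel_mul, inv_mul_cancel_right]
        exact hp
      rw [hF _ _ _ _ hp, hF _ _ _ _ h2, smul_smul, map_mul, map_inv, Int.units_inv_eq_self,
        Units.val_mul, mul_comm]
    · have hex' : ¬ ∃ p, P e (t.relabel σ) p := by
        rintro ⟨p, hp⟩
        refine hex ⟨(p.1 * σ, p.2), ?_⟩
        change R e (t.relabel (p.1 * σ)) p.2
        rw [Sys.relabel_mul]
        exact hp
      simp only [F, dif_neg hex, dif_neg hex', smul_zero]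
  · rw [liftChains_cls, hF e t 1 a (by rwa [Sys.relabel_one])]
    simp
  · rw [liftChains_cls]
    simp only [F]
    rw [dif_neg]
    rintro ⟨p, hp⟩
    exact h _ _ hp

/-! ### Replacing a vertex -/

/-- Remove the vertex `v`, shift the numbers of all edges and add the vertices in `N`, which may
use the new edge `0`. -/
def Sys.repl (t : Sys m e) (v : Finset (Fin e)) (N : Finset (Finset (Fin (e + 1)))) :
    Sys m (e + 1) where
  stars := (t.stars.erase v).image up ∪ N
  label := Fin.cons none t.label

theorem Sys.expand_eq_repl (t : Sys m e) (v : Finset (Fin e)) (P : Finset (Finset (Fin e))) :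
    t.expand v P = t.repl v (P.image ins) := rfl

theorem Sys.attach_eq_repl (t : Sys m e) (v : Finset (Fin e)) :
    t.attach v = t.repl v {ins v, {0}} := rfl

/-- The action on edge sets of the exchange of the first two numbers. -/
def swapSet (A : Finset (Fin (e + 2))) : Finset (Fin (e + 2)) := A.image (Equiv.swap 0 1)

/-- After two insertions the old edges start at `2`. A set `up (ins A)` contains the edge `1` and
`ins (up A)` the edge `0`, so exchanging the new edges interchanges these two shapes and preserves
the other two. -/
theorem swapSet_up_up (A : Finset (Fin e)) : swapSet (up (up A)) = up (up A) := by
  have : ∀ i : Fin e, Equiv.swap (0 : Fin (e + 2)) 1 i.succ.succ = i.succ.succ := fun i =>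
    Equiv.swap_apply_of_ne_of_ne (Fin.succ_ne_zero _) (by
      rw [← Fin.succ_zero_eq_one]; exact fun h => Fin.succ_ne_zero _ (Fin.succ_injective _ h))
  simp only [swapSet, up, Finset.image_image]
  exact Finset.image_congr fun i _ => this i

theorem swapSet_up_ins (A : Finset (Fin e)) : swapSet (up (ins A)) = ins (up A) := by
  have h := swapSet_up_up A
  have h1 : up (ins A) = insert 1 (up (up A)) := by
    simp [ins, up, Finset.image_insert]
  rw [h1, swapSet, Finset.image_insert, Equiv.swap_apply_right, ← swapSet, h, ins]

theorem swapSet_swapSet (A : Finset (Fin (e + 2))) : swapSet (swapSet A) = A := by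
  simp [swapSet, Finset.image_image, Function.comp_def]

theorem swapSet_ins_up (A : Finset (Fin e)) : swapSet (ins (up A)) = up (ins A) := by
  rw [← swapSet_up_ins, swapSet_swapSet]

theorem swapSet_ins_ins (A : Finset (Fin e)) : swapSet (ins (ins A)) = ins (ins A) := by
  have h := swapSet_up_up A
  have h1 : ins (ins A) = insert 0 (insert 1 (up (up A))) := by
    simp [ins, up, Finset.image_insert]
  rw [h1, swapSet, Finset.image_insert, Finset.image_insert, Equiv.swap_apply_right,
    Equiv.swap_apply_left, ← swapSet, h, Finset.insert_comm]

theorem swapSet_singleton_zero : swapSet ({0} : Finset (Fin (e + 2))) = up {0} := by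
  simp [swapSet, up]

theorem swapSet_up_singleton_zero : swapSet (up {0} : Finset (Fin (e + 2))) = {0} := by
  simp [swapSet, up]

theorem cons_cons_comp_swap (l : Fin e → Option (Fin m)) :
    (Fin.cons none (Fin.cons none l : Fin (e + 1) → Option (Fin m)) : Fin (e + 2) → _) ∘
      (Equiv.swap (0 : Fin (e + 2)) 1).symm
      = (Fin.cons none (Fin.cons none l : Fin (e + 1) → Option (Fin m)) : Fin (e + 2) → _) := by
  funext i
  refine Fin.cases ?_ (fun i => Fin.cases ?_ (fun i => ?_) i) i
  · simp only [Function.comp, Equiv.symm_swap, Equiv.swap_apply_left]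
    rw [← Fin.succ_zero_eq_one]
    simp only [Fin.cons_succ, Fin.cons_zero]
  · simp only [Function.comp, Equiv.symm_swap, Fin.succ_zero_eq_one, Equiv.swap_apply_right]
    rw [← Fin.succ_zero_eq_one]
    simp only [Fin.cons_succ, Fin.cons_zero]
  · have : Equiv.swap (0 : Fin (e + 2)) 1 i.succ.succ = i.succ.succ :=
      Equiv.swap_apply_of_ne_of_ne (Fin.succ_ne_zero _) (by
        rw [← Fin.succ_zero_eq_one]; exact fun h => Fin.succ_ne_zero _ (Fin.succ_injective _ h))
    simp only [Function.comp, Equiv.symm_swap, this]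

theorem sign_swap_zero_one : Equiv.Perm.sign (Equiv.swap (0 : Fin (e + 2)) 1) = -1 :=
  Equiv.Perm.sign_swap (by simp)

theorem cls_swap (t : Sys m (e + 2)) : cls (t.relabel (Equiv.swap 0 1)) = - cls t := by
  rw [cls_relabel, sign_swap_zero_one]; simp

/-- Replacements at two different vertices commute up to the exchange of the new edges. -/
theorem repl_repl_of_ne {t : Sys m e} {v w : Finset (Fin e)}
    (N N' : Finset (Finset (Fin (e + 1)))) (hN : ∀ A ∈ N, A ≠ up w) (hN' : ∀ A ∈ N', A ≠ up v)
    (M M' : Finset (Finset (Fin (e + 2)))) (hM : M = (N.image up).image swapSet)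
    (hM' : M' = (N'.image up).image swapSet) :
    (t.repl v N).repl (up w) M' = ((t.repl w N').repl (up v) M).relabel (Equiv.swap 0 1) := by
  -- Both double replacements keep the vertices other than `v` and `w`. The hypothesis on `N`
  -- ensures that the second removal takes away no new vertex.
  have key : ∀ (v w : Finset (Fin e)) (N : Finset (Finset (Fin (e + 1)))),
      (∀ A ∈ N, A ≠ up w) → ((t.repl v N).stars.erase (up w)).image up
        = ((t.stars.erase v).erase w).image (fun x => up (up x)) ∪ N.image up := by
    intro v w N hN
    simp only [Sys.repl]
    rw [Finset.erase_union_distrib, ← Finset.image_erase up_injective,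
      Finset.erase_eq_of_notMem (fun h => hN _ h rfl), Finset.image_union, Finset.image_image]
    rfl
  ext1
  · change ((t.repl v N).stars.erase (up w)).image up ∪ M'
      = (((t.repl w N').stars.erase (up v)).image up ∪ M).image swapSet
    rw [key v w N hN, key w v N' hN', Finset.image_union, Finset.image_union, Finset.image_image,
      hM, hM', Finset.image_image (g := swapSet) (f := swapSet), Finset.erase_right_comm]
    have h1 : swapSet ∘ (fun x : Finset (Fin e) => up (up x)) = fun x => up (up x) := by
      funext x; exact swapSet_up_up x
    have h2 : (swapSet ∘ swapSet : Finset (Fin (e + 2)) → _) = id := by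
      funext x; exact swapSet_swapSet x
    rw [h1, h2, Finset.image_id, Finset.union_assoc, Finset.union_assoc,
      Finset.union_comm (N.image up)]
  · exact (cons_cons_comp_swap _).symm

/-- This serves for a second replacement at a vertex created by the first one; `hB` says that `B` is
not an old vertex. -/
theorem repl_repl_stars (t : Sys m e) (v : Finset (Fin e)) {N : Finset (Finset (Fin (e + 1)))}
    {B : Finset (Fin (e + 1))} (hB : ∀ w ∈ t.stars, w ≠ v → up w ≠ B)
    (M : Finset (Finset (Fin (e + 2)))) :
    ((t.repl v N).repl B M).stars
      = (t.stars.erase v).image (fun x => up (up x)) ∪ (N.erase B).image up ∪ M := by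
  simp only [Sys.repl]
  rw [Finset.erase_union_distrib, Finset.image_union, Finset.erase_eq_of_notMem (s := Finset.image _ _),
    Finset.image_image]
  · rfl
  · simp only [Finset.mem_image, Finset.mem_erase, not_exists, not_and]
    exact fun w hw => hB w hw.2 hw.1

/-! ### Sums over partitions -/

/-- The first parts of the ordered partitions of `v` into two sets with at least two elements. -/
def halves (v : Finset (Fin e)) : Finset (Finset (Fin e)) :=
  v.powerset.filter (fun A => 2 ≤ A.card ∧ 2 ≤ (v \ A).card)

/-- The parts that are joined with an extra element in the partitions of `v` with an extra
element. -/
def parts (v : Finset (Fin e)) : Finset (Finset (Fin e)) :=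
  v.powerset.filter (fun A => 1 ≤ A.card ∧ 2 ≤ (v \ A).card)

theorem mem_halves {v A : Finset (Fin e)} :
    A ∈ halves v ↔ A ⊆ v ∧ 2 ≤ A.card ∧ 2 ≤ (v \ A).card := by
  simp [halves]

theorem mem_parts {v A : Finset (Fin e)} :
    A ∈ parts v ↔ A ⊆ v ∧ 1 ≤ A.card ∧ 2 ≤ (v \ A).card := by
  simp [parts]

theorem partitions_eq_image (v : Finset (Fin e)) :
    partitions v = (halves v).image (fun A => {A, v \ A}) := rfl

theorem mem_partitions {v : Finset (Fin e)} {P : Finset (Finset (Fin e))} :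
    P ∈ partitions v ↔ ∃ A ∈ halves v, P = {A, v \ A} := by
  rw [partitions_eq_image, Finset.mem_image]
  exact ⟨fun ⟨A, h, h'⟩ => ⟨A, h, h'.symm⟩, fun ⟨A, h, h'⟩ => ⟨A, h, h'.symm⟩⟩

theorem compl_mem_halves {v A : Finset (Fin e)} (h : A ∈ halves v) : v \ A ∈ halves v := by
  rw [mem_halves] at h ⊢
  rw [Finset.sdiff_sdiff_eq_self h.1]
  exact ⟨Finset.sdiff_subset, h.2.2, h.2.1⟩

theorem ne_sdiff_of_mem_halves {v A : Finset (Fin e)} (h : A ∈ halves v) : A ≠ v \ A := by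
  intro h'
  rw [mem_halves] at h
  obtain ⟨x, hx⟩ := Finset.card_pos.1 (by omega : 0 < A.card)
  have := hx
  rw [h'] at this
  exact (Finset.mem_sdiff.1 this).2 hx

/-- An unordered partition comes from exactly two ordered ones. -/
theorem filter_halves {v A : Finset (Fin e)} (h : A ∈ halves v) :
    (halves v).filter (fun B => ({B, v \ B} : Finset (Finset (Fin e))) = {A, v \ A})
      = {A, v \ A} := by
  have hA := (mem_halves.1 h).1
  ext B
  simp only [Finset.mem_filter, Finset.mem_insert, Finset.mem_singleton]
  constructor
  · rintro ⟨-, h2⟩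
    have : B ∈ ({A, v \ A} : Finset (Finset (Fin e))) := h2 ▸ Finset.mem_insert_self _ _
    simpa using this
  · rintro (rfl | rfl)
    · exact ⟨h, rfl⟩
    · refine ⟨compl_mem_halves h, ?_⟩
      rw [Finset.sdiff_sdiff_eq_self hA, Finset.pair_comm]

/-- A partition together with a choice of one of its parts is the same as an ordered partition. This
removes the unordered sets from all later sums over the ends of a new edge. -/
theorem sum_partitions_sum {M : Type*} [AddCommMonoid M] (v : Finset (Fin e))
    (g : Finset (Finset (Fin e)) → Finset (Fin e) → M) :
    ∑ P ∈ partitions v, ∑ A ∈ P, g P A = ∑ A ∈ halves v, g {A, v \ A} A := by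
  rw [partitions_eq_image, Finset.sum_image' (fun A => g {A, v \ A} A)]
  intro A hA
  rw [filter_halves hA]
  refine Finset.sum_congr rfl fun B hB => ?_
  rcases Finset.mem_insert.1 hB with rfl | hB
  · rfl
  · rw [Finset.mem_singleton.1 hB, Finset.sdiff_sdiff_eq_self (mem_halves.1 hA).1,
      Finset.pair_comm]

/-- The extra edge `0` singles out the part containing it, so no pairing of parts remains. That part
needs only one further element, hence the bound `1` in `parts`. -/
theorem partitions_ins (v : Finset (Fin e)) :
    partitions (ins v) = (parts v).image (fun A => {ins A, up (v \ A)}) := by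
  ext P
  rw [mem_partitions, Finset.mem_image]
  constructor
  · rintro ⟨A, hA, rfl⟩
    wlog h0 : 0 ∈ A generalizing A
    · have := this (ins v \ A) (compl_mem_halves hA) (by simp [h0])
      rwa [Finset.sdiff_sdiff_eq_self (mem_halves.1 hA).1, Finset.pair_comm] at this
    · obtain ⟨B, rfl⟩ := exists_ins_of_zero_mem h0
      rw [mem_halves, ins_sdiff_ins] at hA
      refine ⟨B, mem_parts.2 ⟨by simpa using hA.1, by simpa using hA.2.1, by simpa using hA.2.2⟩, ?_⟩
      rw [ins_sdiff_ins]
  · rintro ⟨A, hA, rfl⟩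
    rw [mem_parts] at hA
    refine ⟨ins A, mem_halves.2 ⟨by simpa using hA.1, by simpa using hA.2.1, ?_⟩, ?_⟩
    · rw [ins_sdiff_ins]; simpa using hA.2.2
    · rw [ins_sdiff_ins]

theorem sum_partitions_ins {M : Type*} [AddCommMonoid M] (v : Finset (Fin e))
    (g : Finset (Finset (Fin (e + 1))) → M) :
    ∑ P ∈ partitions (ins v), g P = ∑ A ∈ parts v, g {ins A, up (v \ A)} := by
  rw [partitions_ins, Finset.sum_image]
  intro A _ B _ h
  have : ins A ∈ ({ins B, up (v \ B)} : Finset (Finset (Fin (e + 1)))) := by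
    beta_reduce at h; rw [← h]; simp
  simpa using this

theorem partitions_up (v : Finset (Fin e)) :
    partitions (up v) = (partitions v).image (fun P => P.image up) := by
  rw [partitions_eq_image, partitions_eq_image, Finset.image_image]
  have h : halves (up v) = (halves v).image up := by
    ext A
    rw [mem_halves, Finset.mem_image]
    constructor
    · rintro ⟨h1, h2, h3⟩
      have h0 : 0 ∉ A := fun h => zero_notMem_up (h1 h)
      obtain ⟨B, rfl⟩ := exists_up_of_zero_notMem h0
      rw [← up_sdiff] at h3
      exact ⟨B, mem_halves.2 ⟨by simpa using h1, by simpa using h2, by simpa using h3⟩, rfl⟩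
    · rintro ⟨B, hB, rfl⟩
      rw [mem_halves] at hB
      rw [← up_sdiff]
      simpa using hB
  rw [h, Finset.image_image]
  refine Finset.image_congr fun A _ => ?_
  simp [Finset.image_insert, up_sdiff]

theorem sum_partitions_up {M : Type*} [AddCommMonoid M] (v : Finset (Fin e))
    (g : Finset (Finset (Fin (e + 1))) → M) :
    ∑ P ∈ partitions (up v), g P = ∑ P ∈ partitions v, g (P.image up) := by
  rw [partitions_up, Finset.sum_image]
  exact fun A _ B _ h => Finset.image_injective up_injective h

theorem sum_offDiag_antisymm {ι M : Type*} [DecidableEq ι] [AddCommGroup M] (s : Finset ι)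
    (G : ι → ι → M) (h : ∀ v ∈ s, ∀ w ∈ s, v ≠ w → G v w + G w v = 0) :
    ∑ v ∈ s, ∑ w ∈ s.erase v, G v w = 0 := by
  rw [Finset.sum_sigma']
  refine Finset.sum_involution (fun p _ => ⟨p.2, p.1⟩) ?_ ?_ ?_ ?_
  · rintro ⟨v, w⟩ hp
    simp only [Finset.mem_sigma, Finset.mem_erase] at hp
    exact h v hp.1 w hp.2.2 hp.2.1.symm
  · rintro ⟨v, w⟩ hp _ h'
    simp only [Finset.mem_sigma, Finset.mem_erase] at hp
    exact hp.2.1 (congrArg Sigma.fst h')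
  · rintro ⟨v, w⟩ hp
    simp only [Finset.mem_sigma, Finset.mem_erase] at hp ⊢
    exact ⟨hp.2.2, hp.2.1.symm, hp.1⟩
  · rintro ⟨v, w⟩ _
    rfl

/-- New vertices contain the edge `0` and shifted old ones do not, so the union is disjoint. -/
theorem sum_repl {M : Type*} [AddCommMonoid M] (t : Sys m e) (v : Finset (Fin e))
    {N : Finset (Finset (Fin (e + 1)))} (hN : ∀ A ∈ N, 0 ∈ A) (F : Finset (Fin (e + 1)) → M) :
    ∑ w ∈ (t.repl v N).stars, F w = ∑ w ∈ t.stars.erase v, F (up w) + ∑ w ∈ N, F w := by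
  rw [Sys.repl, Finset.sum_union, Finset.sum_image fun _ _ _ _ h => up_injective h]
  rw [Finset.disjoint_left]
  intro A hA hA'
  obtain ⟨B, -, rfl⟩ := Finset.mem_image.1 hA
  exact zero_notMem_up (hN _ hA')

/-! ### The square of the boundary operator -/

theorem boundary_cls (t : Sys m e) :
    boundary m (cls t) = ∑ v ∈ t.stars, ∑ P ∈ partitions v, cls (t.expand v P) := by
  rw [boundary, liftChains_cls]

theorem zero_mem_of_mem_image_ins {P : Finset (Finset (Fin e))} {A : Finset (Fin (e + 1))}
    (h : A ∈ P.image ins) : 0 ∈ A := by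
  obtain ⟨B, -, rfl⟩ := Finset.mem_image.1 h
  exact zero_mem_ins

theorem ne_up_of_zero_mem {A : Finset (Fin (e + 1))} (h : 0 ∈ A) (w : Finset (Fin e)) :
    A ≠ up w := fun h' => zero_notMem_up (h' ▸ h)

theorem image_ins_image_up (P : Finset (Finset (Fin e))) :
    (P.image up).image ins = ((P.image ins).image up).image swapSet := by
  simp only [Finset.image_image]
  exact Finset.image_congr fun A _ => (swapSet_up_ins A).symm

/-- The resulting trees agree except that their new edges `0` and `1` are exchanged. -/
theorem expand_expand_of_ne (t : Sys m e) (v w : Finset (Fin e)) (P P' : Finset (Finset (Fin e))) :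
    cls ((t.expand v P).expand (up w) (P'.image up))
      = - cls ((t.expand w P').expand (up v) (P.image up)) := by
  rw [← cls_swap]
  simp only [Sys.expand_eq_repl]
  rw [repl_repl_of_ne (P.image ins) (P'.image ins)
    (fun A hA => ne_up_of_zero_mem (zero_mem_of_mem_image_ins hA) _)
    (fun A hA => ne_up_of_zero_mem (zero_mem_of_mem_image_ins hA) _)
    _ _ (image_ins_image_up P) (image_ins_image_up P')]

theorem expand_expand_ins_stars (t : Sys m e) {v A X : Finset (Fin e)} (hA : A ∈ halves v) :
    ((t.expand v {A, v \ A}).expand (ins A) {ins X, up (A \ X)}).stars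
      = (t.stars.erase v).image (fun x => up (up x)) ∪
        {up (ins (v \ A)), ins (ins X), ins (up (A \ X))} := by
  simp only [Sys.expand_eq_repl]
  rw [repl_repl_stars t v (fun w _ _ => up_ne_ins)]
  have h : (({A, v \ A} : Finset (Finset (Fin e))).image ins).erase (ins A) = {ins (v \ A)} := by
    rw [Finset.image_insert, Finset.image_singleton, Finset.erase_insert]
    simpa using ne_sdiff_of_mem_halves hA
  rw [h, Finset.image_singleton, Finset.image_insert, Finset.image_singleton, Finset.union_assoc]
  rfl

/-- Expanding twice at the place of `v` produces a path of three vertices carrying the blocks `v \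
A`, `X`, `A \ X` in this order. The same path arises by splitting off `A \ X` before `v \ A`, and
then the two new edges are numbered the other way round. -/
theorem expand_expand_ins (t : Sys m e) {v A X : Finset (Fin e)} (hA : A ∈ halves v)
    (hX : X ∈ parts A) :
    cls ((t.expand v {A, v \ A}).expand (ins A) {ins X, up (A \ X)})
      = - cls ((t.expand v {v \ (A \ X), v \ (v \ (A \ X))}).expand (ins (v \ (A \ X)))
        {ins X, up ((v \ (A \ X)) \ X)}) := by
  have hA1 := mem_halves.1 hA
  have hX1 := mem_parts.1 hX
  have hs : A \ X ⊆ v := Finset.sdiff_subset.trans hA1.1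
  have e2 : (v \ (A \ X)) \ X = v \ A := by
    ext i
    have h1 := @hA1.1 i
    have h2 := @hX1.1 i
    simp only [Finset.mem_sdiff]
    tauto
  have hA' : v \ (A \ X) ∈ halves v := by
    rw [mem_halves, Finset.sdiff_sdiff_eq_self hs]
    refine ⟨Finset.sdiff_subset, ?_, hX1.2.2⟩
    exact hA1.2.2.trans (Finset.card_le_card (Finset.sdiff_subset_sdiff le_rfl Finset.sdiff_subset))
  rw [← cls_swap]
  congr 1
  ext1
  · rw [expand_expand_ins_stars t hA]
    change _ = Finset.image swapSet _
    rw [expand_expand_ins_stars t hA', Finset.sdiff_sdiff_eq_self hs, e2, Finset.image_union,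
      Finset.image_image, Finset.image_insert, Finset.image_insert, Finset.image_singleton,
      swapSet_up_ins, swapSet_ins_ins, swapSet_ins_up]
    congr 1
    · exact Finset.image_congr fun A _ => (swapSet_up_up A).symm
    · ext B; simp only [Finset.mem_insert, Finset.mem_singleton]; tauto
  · exact (cons_cons_comp_swap _).symm

/-- The double expansions cancel in pairs: at two different vertices by the order of the vertices,
at one vertex by reversing the path of three blocks. -/
theorem boundary_boundary (x : Chains m) : boundary m (boundary m x) = 0 := by
  suffices h : (boundary m).comp (boundary m) = 0 from DFunLike.congr_fun h x
  refine QuotientAddGroup.addMonoidHom_ext _ (FreeAbelianGroup.lift_ext _ _ fun ⟨e, t⟩ => ?_)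
  change boundary m (boundary m (cls t)) = 0
  have key : ∀ v ∈ t.stars, ∀ P ∈ partitions v, boundary m (cls (t.expand v P))
      = ∑ w ∈ t.stars.erase v, ∑ P' ∈ partitions w,
          cls ((t.expand v P).expand (up w) (P'.image up))
        + ∑ A ∈ P, ∑ X ∈ parts A, cls ((t.expand v P).expand (ins A) {ins X, up (A \ X)}) := by
    intro v _ P _
    rw [boundary_cls, Sys.expand_eq_repl, sum_repl _ _ (fun A hA => zero_mem_of_mem_image_ins hA),
      Finset.sum_image fun _ _ _ _ h => ins_injective h]
    simp only [sum_partitions_up, sum_partitions_ins]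
  rw [boundary_cls, map_sum, Finset.sum_congr rfl fun v hv => by
    rw [map_sum, Finset.sum_congr rfl (key v hv), Finset.sum_add_distrib, Finset.sum_comm,
      sum_partitions_sum v fun P A => ∑ X ∈ parts A,
        cls ((t.expand v P).expand (ins A) {ins X, up (A \ X)})]]
  rw [Finset.sum_add_distrib, sum_offDiag_antisymm, zero_add]
  · refine Finset.sum_eq_zero fun v _ => ?_
    rw [Finset.sum_sigma']
    -- The involution exchanges the outer blocks `v \ A` and `A \ X` and keeps the middle block `X`.
    refine Finset.sum_involution (fun p _ => ⟨v \ (p.1 \ p.2), p.2⟩) ?_ ?_ ?_ ?_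
    · rintro ⟨A, X⟩ hp
      simp only [Finset.mem_sigma] at hp
      rw [expand_expand_ins t hp.1 hp.2, neg_add_cancel]
    · rintro ⟨A, X⟩ hp _ h
      simp only [Finset.mem_sigma, mem_halves, mem_parts] at hp
      have h1 : v \ (A \ X) = A := congrArg Sigma.fst h
      obtain ⟨i, hi⟩ := Finset.card_pos.1 (by omega : 0 < (A \ X).card)
      have h2 : i ∈ v \ (A \ X) := h1.symm ▸ (Finset.mem_sdiff.1 hi).1
      exact (Finset.mem_sdiff.1 h2).2 hi
    · rintro ⟨A, X⟩ hp
      simp only [Finset.mem_sigma, mem_halves, mem_parts] at hp ⊢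
      obtain ⟨⟨h1, h2, h3⟩, h4, h5, h6⟩ := hp
      have e2 : (v \ (A \ X)) \ X = v \ A := by
        ext i
        have h1 := @h1 i
        have h2 := @h4 i
        simp only [Finset.mem_sdiff]
        tauto
      rw [Finset.sdiff_sdiff_eq_self (Finset.sdiff_subset.trans h1), e2]
      refine ⟨⟨Finset.sdiff_subset, ?_, h6⟩, ?_, h5, h3⟩
      · exact h3.trans (Finset.card_le_card
          (Finset.sdiff_subset_sdiff le_rfl Finset.sdiff_subset))
      · intro i hi
        simp [h1 (h4 hi), hi]
    · rintro ⟨A, X⟩ hp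
      simp only [Finset.mem_sigma, mem_halves, mem_parts] at hp
      simp only [Sigma.mk.injEq, heq_eq_eq, and_true]
      ext i
      have h1 := @hp.1.1 i
      have h2 := @hp.2.1 i
      simp only [Finset.mem_sdiff]
      tauto
  · intro v _ w _ _
    rw [Finset.sum_comm, ← Finset.sum_add_distrib]
    refine Finset.sum_eq_zero fun P _ => ?_
    rw [← Finset.sum_add_distrib]
    refine Finset.sum_eq_zero fun P' _ => ?_
    rw [expand_expand_of_ne, neg_add_cancel]

theorem boundaryBar_boundaryBar (x : ChainsBar m) : boundaryBar m (boundaryBar m x) = 0 := by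
  induction x using QuotientAddGroup.induction_on with
  | H x =>
    change QuotientAddGroup.mk (boundary m (boundary m x)) = 0
    rw [boundary_boundary]
    rfl

/-! ### A criterion for trees -/

namespace Sys

/-- Connectedness, as an induction principle on the vertices. -/
def Conn (t : Sys m e) : Prop :=
  ∀ p : Finset (Fin e) → Prop, (∃ u ∈ t.stars, p u) →
    (∀ u ∈ t.stars, p u → ∀ w ∈ t.stars, ∀ i ∈ u, i ∈ w → p w) → ∀ w ∈ t.stars, p w

theorem exists_ends {t : Sys m e} (h2 : ∀ i, (t.stars.filter (fun v => i ∈ v)).card = 2)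
    (i : Fin e) : ∃ u w, u ≠ w ∧ u ∈ t.stars ∧ w ∈ t.stars ∧ i ∈ u ∧ i ∈ w ∧
      ∀ x ∈ t.stars, i ∈ x → x = u ∨ x = w := by
  obtain ⟨u, w, huw, h⟩ := Finset.card_eq_two.1 (h2 i)
  have hm : ∀ x, (x ∈ t.stars ∧ i ∈ x) ↔ x = u ∨ x = w := fun x => by
    have := Finset.ext_iff.1 h x
    simpa using this
  exact ⟨u, w, huw, ((hm u).2 (.inl rfl)).1, ((hm w).2 (.inr rfl)).1, ((hm u).2 (.inl rfl)).2,
    ((hm w).2 (.inr rfl)).2, fun x hx hi => (hm x).1 ⟨hx, hi⟩⟩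

theorem graph_preconnected_iff (t : Sys m e) (hne : t.stars.Nonempty) :
    t.graph.Connected ↔ t.Conn := by
  constructor
  · intro h p hex hp w hw
    obtain ⟨u, hu, hpu⟩ := hex
    obtain ⟨q⟩ := h.preconnected ⟨u, hu⟩ ⟨w, hw⟩
    have : ∀ (a b : t.stars) (q : t.graph.Walk a b), p a.1 → p b.1 := by
      intro a b q
      induction q with
      | nil => exact id
      | cons hadj _ ih =>
        intro ha
        obtain ⟨i, hi, hi'⟩ := Finset.not_disjoint_iff.1 hadj.2
        exact ih (hp _ (Subtype.prop _) ha _ (Subtype.prop _) i hi hi')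
    exact this _ _ q hpu
  · intro h
    have : Nonempty t.stars := ⟨⟨hne.choose, hne.choose_spec⟩⟩
    refine ⟨fun a b => ?_⟩
    have := h (fun x => ∀ hx : x ∈ t.stars, t.graph.Reachable a ⟨x, hx⟩)
      ⟨a.1, a.2, fun _ => SimpleGraph.Reachable.refl _⟩ (fun u hu hpu w hw i hi hi' hw' => by
        by_cases huw : u = w
        · subst huw; exact hpu hu
        · refine (hpu hu).trans (SimpleGraph.Adj.reachable ⟨fun h => huw (congrArg Subtype.val h), ?_⟩)
          exact Finset.not_disjoint_iff.2 ⟨i, hi, hi'⟩)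
    exact this b.1 b.2 b.2

theorem exists_commonEdge (t : Sys m e) :
    ∃ g : t.graph.edgeSet → Fin e, ∀ ε, ∀ x ∈ ε.1, g ε ∈ x.1 := by
  have : ∀ ε : t.graph.edgeSet, ∃ i : Fin e, ∀ x ∈ ε.1, i ∈ x.1 := by
    rintro ⟨ε, hε⟩
    induction ε using Sym2.ind with
    | _ u w =>
      obtain ⟨i, hi, hi'⟩ := Finset.not_disjoint_iff.1 (show t.graph.Adj u w from hε).2
      refine ⟨i, fun x hx => ?_⟩
      rcases Sym2.mem_iff.1 hx with rfl | rfl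
      · exact hi
      · exact hi'
  exact ⟨fun ε => (this ε).choose, fun ε => (this ε).choose_spec⟩

/-- Acyclicity and the absence of parallel edges are replaced by an Euler characteristic count. This
form is easy to check after a replacement, where one vertex and one edge are added. The map `g` from
edges of the graph to edge numbers links both sides: it is injective when each number has two ends,
and surjective as well. -/
theorem isTree_iff (t : Sys m e) : t.IsTree ↔
    (∀ i, (t.stars.filter (fun v => i ∈ v)).card = 2) ∧
    (∀ v ∈ t.stars, v.card = 1 ∨ 3 ≤ v.card) ∧ t.Conn ∧ t.stars.card = e + 1 := by
  obtain ⟨g, hg⟩ := t.exists_commonEdge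
  have hends : (∀ i, (t.stars.filter (fun v => i ∈ v)).card = 2) → ∀ ε : t.graph.edgeSet,
      ∀ (u w : t.stars), u ≠ w → g ε ∈ u.1 → g ε ∈ w.1 → ε.1 = s(u, w) := by
    rintro h2 ⟨ε, hε⟩ u w huw hu hw
    induction ε using Sym2.ind with
    | _ a b =>
      have hab : a ≠ b := (show t.graph.Adj a b from hε).1
      have ha := hg ⟨s(a, b), hε⟩ a (by simp)
      have hb := hg ⟨s(a, b), hε⟩ b (by simp)
      obtain ⟨p, q, -, -, -, -, -, h⟩ := exists_ends h2 (g ⟨s(a, b), hε⟩)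
      have h1 := h _ a.2 ha
      have h3 := h _ b.2 hb
      have h4 := h _ u.2 hu
      have h5 := h _ w.2 hw
      have h6 : a.1 ≠ b.1 := fun h => hab (Subtype.ext h)
      have h7 : u.1 ≠ w.1 := fun h => huw (Subtype.ext h)
      simp only [Sym2.eq_iff, Subtype.ext_iff]
      grind
  have hinj : (∀ i, (t.stars.filter (fun v => i ∈ v)).card = 2) → Function.Injective g := by
    rintro h2 ⟨ε, hε⟩ ε' h
    induction ε using Sym2.ind with
    | _ a b =>
      have hab : a ≠ b := (show t.graph.Adj a b from hε).1
      refine Subtype.ext (hends h2 ε' a b hab ?_ ?_).symm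
      · exact h ▸ hg ⟨s(a, b), hε⟩ a (by simp)
      · exact h ▸ hg ⟨s(a, b), hε⟩ b (by simp)
  have hV : Nat.card t.stars = t.stars.card := by simp
  constructor
  · rintro ⟨h2, hp, ht, hv⟩
    have := ht.connected.nonempty
    have hne : t.stars.Nonempty := Finset.nonempty_coe_sort.1 this
    refine ⟨h2, hv, (graph_preconnected_iff t hne).1 ht.connected, ?_⟩
    have hsurj : Function.Surjective g := by
      intro i
      obtain ⟨u, w, huw, hu, hw, hiu, hiw, -⟩ := exists_ends h2 i
      have hadj : t.graph.Adj ⟨u, hu⟩ ⟨w, hw⟩ :=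
        ⟨fun h => huw (congrArg Subtype.val h), Finset.not_disjoint_iff.2 ⟨i, hiu, hiw⟩⟩
      refine ⟨⟨s(⟨u, hu⟩, ⟨w, hw⟩), hadj⟩, ?_⟩
      exact Finset.card_le_one.1 (hp u hu w hw huw) _
        (Finset.mem_inter.2 ⟨hg ⟨_, hadj⟩ ⟨u, hu⟩ (by simp), hg ⟨_, hadj⟩ ⟨w, hw⟩ (by simp)⟩) _
        (Finset.mem_inter.2 ⟨hiu, hiw⟩)
    have hc := Nat.card_eq_of_bijective g ⟨hinj h2, hsurj⟩
    have := (SimpleGraph.isTree_iff_connected_and_card.1 ht).2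
    rw [hc, hV, Nat.card_fin] at this
    exact this.symm
  · rintro ⟨h2, hv, hc, hcard⟩
    have hne : t.stars.Nonempty := Finset.card_pos.1 (by omega)
    have hconn := (graph_preconnected_iff t hne).2 hc
    -- A connected graph on `e + 1` vertices has at least `e` edges, and injectivity of `g` allows
    -- at most `e`. So `g` is bijective, which yields acyclicity and excludes parallel edges.
    have hle := hconn.card_vert_le_card_edgeSet_add_one
    have hle' := Nat.card_le_card_of_injective g (hinj h2)
    rw [hV, hcard] at hle
    rw [Nat.card_fin] at hle'
    have hE : Nat.card t.graph.edgeSet = e := by omega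
    have hbij : Function.Bijective g :=
      (Nat.bijective_iff_injective_and_card g).2 ⟨hinj h2, by rw [hE, Nat.card_fin]⟩
    refine ⟨h2, fun u hu w hw huw => ?_,
      SimpleGraph.isTree_iff_connected_and_card.2 ⟨hconn, by rw [hE, hV, hcard]⟩, hv⟩
    rw [Finset.card_le_one]
    intro i hi j hj
    rw [Finset.mem_inter] at hi hj
    obtain ⟨ε, rfl⟩ := hbij.2 i
    obtain ⟨ε', rfl⟩ := hbij.2 j
    have huw' : (⟨u, hu⟩ : t.stars) ≠ ⟨w, hw⟩ := fun h => huw (congrArg Subtype.val h)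
    rw [Subtype.ext ((hends h2 ε _ _ huw' hi.1 hi.2).trans (hends h2 ε' _ _ huw' hj.1 hj.2).symm)]

theorem IsTree.conn {t : Sys m e} (h : t.IsTree) : t.Conn := ((isTree_iff t).1 h).2.2.1

theorem IsTree.card_stars {t : Sys m e} (h : t.IsTree) : t.stars.card = e + 1 :=
  ((isTree_iff t).1 h).2.2.2

theorem IsTree.exists_ends {t : Sys m e} (h : t.IsTree) (i : Fin e) :
    ∃ u w, u ≠ w ∧ u ∈ t.stars ∧ w ∈ t.stars ∧ i ∈ u ∧ i ∈ w ∧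
      ∀ x ∈ t.stars, i ∈ x → x = u ∨ x = w := Sys.exists_ends h.two_ends i

theorem IsTree.exists_other_end {t : Sys m e} (h : t.IsTree) {v : Finset (Fin e)}
    (hv : v ∈ t.stars) {i : Fin e} (hi : i ∈ v) :
    ∃ w ∈ t.stars, w ≠ v ∧ i ∈ w ∧ ∀ x ∈ t.stars, i ∈ x → x = v ∨ x = w := by
  obtain ⟨a, b, hab, ha, hb, hia, hib, h⟩ := h.exists_ends i
  rcases h v hv hi with rfl | rfl
  · exact ⟨b, hb, hab.symm, hib, h⟩
  · exact ⟨a, ha, hab, hia, fun x hx hxi => (h x hx hxi).symm⟩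

theorem IsTree.eq_of_mem_mem {t : Sys m e} (h : t.IsTree) {u w : Finset (Fin e)}
    (hu : u ∈ t.stars) (hw : w ∈ t.stars) (huw : u ≠ w) {i j : Fin e} (hiu : i ∈ u) (hiw : i ∈ w)
    (hju : j ∈ u) (hjw : j ∈ w) : i = j :=
  Finset.card_le_one.1 (h.no_parallel u hu w hw huw) _ (Finset.mem_inter.2 ⟨hiu, hiw⟩) _
    (Finset.mem_inter.2 ⟨hju, hjw⟩)

theorem isTree_relabel {t : Sys m e} (h : t.IsTree) (σ : Equiv.Perm (Fin e)) :
    (t.relabel σ).IsTree := by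
  obtain ⟨h1, h2, h3, h4⟩ := (isTree_iff t).1 h
  refine (isTree_iff _).2 ⟨fun i => ?_, fun v hv => ?_, ?_, ?_⟩
  · rw [← h1 (σ.symm i)]
    simp only [relabel, Finset.filter_image, Finset.mem_image]
    rw [Finset.card_image_of_injective _ (image_inj σ)]
    congr 1
    refine Finset.filter_congr fun v _ => ?_
    exact ⟨fun ⟨a, ha, h⟩ => by rwa [← h, Equiv.symm_apply_apply], fun h => ⟨_, h, by simp⟩⟩
  · obtain ⟨w, hw, rfl⟩ := mem_relabel.1 hv
    rw [Finset.card_image_of_injective _ σ.injective]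
    exact h2 w hw
  · rintro p ⟨u, hu, hpu⟩ hp w hw
    obtain ⟨u, hu', rfl⟩ := mem_relabel.1 hu
    obtain ⟨w, hw', rfl⟩ := mem_relabel.1 hw
    refine h3 (fun x => p (x.image σ)) ⟨u, hu', hpu⟩ (fun a ha hpa b hb i hia hib => ?_) w hw'
    exact hp _ (image_mem_relabel.2 ha) hpa _ (image_mem_relabel.2 hb) (σ i)
      (Finset.mem_image_of_mem _ hia) (Finset.mem_image_of_mem _ hib)
  · rw [relabel, Finset.card_image_of_injective _ (image_inj σ), h4]

theorem isUnrooted_relabel {t : Sys m e} (h : t.IsUnrooted) (σ : Equiv.Perm (Fin e)) :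
    (t.relabel σ).IsUnrooted := by
  refine ⟨isTree_relabel h.toIsTree σ, fun i => ?_⟩
  obtain ⟨i, rfl⟩ := σ.surjective i
  rw [label_relabel, singleton_mem_relabel]
  exact h.labeled i

theorem isRooted_relabel {t : Sys m e} (h : t.IsRooted) (σ : Equiv.Perm (Fin e)) :
    (t.relabel σ).IsRooted := by
  refine ⟨isTree_relabel h.toIsTree σ, fun i => ?_, ?_⟩
  · obtain ⟨i, rfl⟩ := σ.surjective i
    rw [label_relabel, singleton_mem_relabel]
    exact h.labeled i
  · obtain ⟨r, hr, hr'⟩ := h.root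
    refine ⟨σ r, by beta_reduce; rwa [label_relabel, singleton_mem_relabel], fun i => ?_⟩
    obtain ⟨i, rfl⟩ := σ.surjective i
    simp only [label_relabel, singleton_mem_relabel]
    exact fun h => congrArg σ (hr' i h)

theorem isLeafBracket_relabel {t : Sys m e} (h : t.IsLeafBracket) (σ : Equiv.Perm (Fin e)) :
    (t.relabel σ).IsLeafBracket := by
  obtain ⟨r, a, b, h1, h2, h3, h4, h5, h6, h7, h8⟩ := h
  refine ⟨σ r, σ a, σ b, by simpa using h1, by simpa using h2, by simpa using h3, ?_, ?_, ?_, ?_, ?_⟩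
  · have := (image_mem_relabel (σ := σ)).2 h4
    simpa [Finset.image_insert] using this
  · rwa [singleton_mem_relabel]
  · rwa [label_relabel]
  · rwa [singleton_mem_relabel]
  · rwa [label_relabel]

theorem card_univalent_relabel (t : Sys m e) (σ : Equiv.Perm (Fin e)) :
    (t.relabel σ).univalent.card = t.univalent.card := by
  simp only [univalent, relabel, Finset.filter_image]
  rw [Finset.card_image_of_injective _ (image_inj σ)]
  simp only [Finset.card_image_of_injective _ σ.injective]

/-! ### Trees and the replacement of a vertex -/

/-- `N` consists of two vertices sharing the new edge and the edges at `v`. -/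
structure Splits (v : Finset (Fin e)) (N : Finset (Finset (Fin (e + 1)))) : Prop where
  card : N.card = 2
  zero_mem : ∀ A ∈ N, 0 ∈ A
  sum : ∀ j : Fin e, ∑ A ∈ N, (if j.succ ∈ A then 1 else 0) = if j ∈ v then 1 else 0

theorem Splits.mem_iff {v : Finset (Fin e)} {N : Finset (Finset (Fin (e + 1)))} (h : Splits v N)
    {j : Fin e} : j ∈ v ↔ ∃ A ∈ N, j.succ ∈ A := by
  have := h.sum j
  constructor
  · intro hj
    by_contra! hc
    rw [if_pos hj, Finset.sum_eq_zero fun A hA => if_neg (hc A hA)] at this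
    omega
  · rintro ⟨A, hA, hj⟩
    by_contra hc
    rw [if_neg hc, Finset.sum_eq_zero_iff] at this
    have := this A hA
    simp [hj] at this

theorem splits_pair {A B : Finset (Fin e)} (h : Disjoint A B) (hne : A ≠ B) :
    Splits (A ∪ B) {ins A, ins B} := by
  refine ⟨Finset.card_pair (by simpa using hne), by simp, fun j => ?_⟩
  rw [Finset.sum_pair (by simpa using hne)]
  simp only [succ_mem_ins, Finset.mem_union]
  have := fun hj : j ∈ A => Finset.disjoint_left.1 h hj
  split_ifs <;> simp_all

theorem splits_halves {v A : Finset (Fin e)} (hA : A ∈ halves v) :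
    Splits v (({A, v \ A} : Finset (Finset (Fin e))).image ins) := by
  have := splits_pair (Finset.disjoint_sdiff (s := A) (t := v)) (ne_sdiff_of_mem_halves hA)
  rw [Finset.union_sdiff_of_subset (mem_halves.1 hA).1] at this
  rwa [Finset.image_insert, Finset.image_singleton]

theorem splits_attach {v : Finset (Fin e)} (hv : v.Nonempty) : Splits v {ins v, {0}} := by
  have := splits_pair (Finset.disjoint_empty_right v) hv.ne_empty
  rwa [Finset.union_empty, ins_empty] at this

theorem sum_stars_erase {M : Type*} [AddCommMonoid M] {t : Sys m e} {v : Finset (Fin e)}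
    (hv : v ∈ t.stars) (F : Finset (Fin e) → M) :
    ∑ w ∈ t.stars.erase v, F w + F v = ∑ w ∈ t.stars, F w := by
  rw [add_comm]; exact Finset.add_sum_erase _ _ hv

theorem mem_repl {t : Sys m e} {v : Finset (Fin e)} {N : Finset (Finset (Fin (e + 1)))}
    {x : Finset (Fin (e + 1))} :
    x ∈ (t.repl v N).stars ↔ (∃ w ∈ t.stars, w ≠ v ∧ up w = x) ∨ x ∈ N := by
  simp only [repl, Finset.mem_union, Finset.mem_image, Finset.mem_erase]
  exact or_congr_left (exists_congr fun w => by tauto)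

/-- Contracting the new edge `0` collapses `N` to `v`. Properties of vertices are pushed forward or
pulled back along this contraction. -/
theorem conn_repl_iff {t : Sys m e} {v : Finset (Fin e)} (hv : v ∈ t.stars)
    {N : Finset (Finset (Fin (e + 1)))} (hN : Splits v N) : (t.repl v N).Conn ↔ t.Conn := by
  have hNne : N.Nonempty := Finset.card_pos.1 (by rw [hN.card]; omega)
  constructor
  · rintro h q ⟨u, hu, hqu⟩ hq w hw
    -- The property of `y` is that its image `x` under the contraction satisfies `q`; a vertex
    -- containing `0` has image `v`.
    have key := h (fun y => ∃ x ∈ t.stars, q x ∧ ((x ≠ v ∧ y = up x) ∨ (x = v ∧ 0 ∈ y))) ?_ ?_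
    · by_cases hwv : w = v
      · obtain ⟨A, hA⟩ := hNne
        obtain ⟨x, hx, hqx, h1 | h1⟩ := key A (mem_repl.2 (.inr hA))
        · exact absurd h1.2 (ne_up_of_zero_mem (hN.zero_mem A hA) _)
        · rw [hwv, ← h1.1]; exact hqx
      · obtain ⟨x, hx, hqx, h1 | h1⟩ := key (up w) (mem_repl.2 (.inl ⟨w, hw, hwv, rfl⟩))
        · rw [up_injective h1.2]; exact hqx
        · exact absurd h1.2 zero_notMem_up
    · by_cases huv : u = v
      · obtain ⟨A, hA⟩ := hNne
        exact ⟨A, mem_repl.2 (.inr hA), u, hu, hqu, .inr ⟨huv, hN.zero_mem A hA⟩⟩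
      · exact ⟨up u, mem_repl.2 (.inl ⟨u, hu, huv, rfl⟩), u, hu, hqu, .inl ⟨huv, rfl⟩⟩
    · rintro a ha ⟨x, hx, hqx, h1⟩ b hb i hia hib
      have hxi : i = 0 ∧ x = v ∨ ∃ j ∈ x, i = j.succ := by
        rcases h1 with ⟨h1, rfl⟩ | ⟨h1, h2⟩
        · right
          revert hia
          refine Fin.cases (by simp) (fun j => ?_) i
          exact fun h => ⟨j, by simpa using h, rfl⟩
        · revert hia
          refine Fin.cases (fun _ => .inl ⟨rfl, h1⟩) (fun j hj => ?_) i
          refine .inr ⟨j, ?_, rfl⟩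
          rcases mem_repl.1 ha with ⟨w, -, -, rfl⟩ | hA
          · simp at h2
          · rw [h1]; exact hN.mem_iff.2 ⟨a, hA, hj⟩
      rcases mem_repl.1 hb with ⟨w, hw, hwv, rfl⟩ | hB
      · rcases hxi with ⟨rfl, rfl⟩ | ⟨j, hj, rfl⟩
        · simp at hib
        · exact ⟨w, hw, hq x hx hqx w hw j hj (by simpa using hib), .inl ⟨hwv, rfl⟩⟩
      · refine ⟨v, hv, ?_, .inr ⟨rfl, hN.zero_mem b hB⟩⟩
        rcases hxi with ⟨rfl, rfl⟩ | ⟨j, hj, rfl⟩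
        · exact hqx
        · exact hq x hx hqx v hv j hj (hN.mem_iff.2 ⟨b, hB, hib⟩)
  · rintro h p ⟨u, hu, hpu⟩ hp w hw
    have hNp : ∀ A ∈ N, ∀ B ∈ N, p A → p B := fun A hA B hB hpA =>
      hp A (mem_repl.2 (.inr hA)) hpA B (mem_repl.2 (.inr hB)) 0 (hN.zero_mem A hA)
        (hN.zero_mem B hB)
    have key := h (fun x => (x ≠ v ∧ p (up x)) ∨ (x = v ∧ ∃ A ∈ N, p A)) ?_ ?_
    · rcases mem_repl.1 hw with ⟨x, hx, hxv, rfl⟩ | hA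
      · rcases key x hx with h1 | h1
        · exact h1.2
        · exact absurd h1.1 hxv
      · rcases key v hv with h1 | ⟨-, A, hA', h1⟩
        · exact absurd rfl h1.1
        · exact hNp A hA' w hA h1
    · rcases mem_repl.1 hu with ⟨x, hx, hxv, rfl⟩ | hA
      · exact ⟨x, hx, .inl ⟨hxv, hpu⟩⟩
      · exact ⟨v, hv, .inr ⟨rfl, u, hA, hpu⟩⟩
    · intro a ha hpa b hb i hia hib
      have h1 : ∃ y ∈ (t.repl v N).stars, p y ∧ i.succ ∈ y := by
        rcases hpa with ⟨h1, h2⟩ | ⟨rfl, A, hA, h1⟩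
        · exact ⟨up a, mem_repl.2 (.inl ⟨a, ha, h1, rfl⟩), h2, by simpa using hia⟩
        · obtain ⟨B, hB, hiB⟩ := hN.mem_iff.1 hia
          exact ⟨B, mem_repl.2 (.inr hB), hNp A hA B hB h1, hiB⟩
      obtain ⟨y, hy, hpy, hiy⟩ := h1
      by_cases hbv : b = v
      · subst hbv
        obtain ⟨B, hB, hiB⟩ := hN.mem_iff.1 hib
        exact .inr ⟨rfl, B, hB, hp y hy hpy B (mem_repl.2 (.inr hB)) _ hiy hiB⟩
      · exact .inl ⟨hbv, hp y hy hpy _ (mem_repl.2 (.inl ⟨b, hb, hbv, rfl⟩)) _ hiy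
          (by simpa using hib)⟩

/-- By `isTree_iff` it remains to compare counts: vertices and edges both increase by one, and
`Splits` keeps the number of ends of every old edge. -/
theorem isTree_repl_iff {t : Sys m e} {v : Finset (Fin e)} (hv : v ∈ t.stars)
    {N : Finset (Finset (Fin (e + 1)))} (hN : Splits v N)
    (hval : ∀ A ∈ N, A.card = 1 ∨ 3 ≤ A.card) (hval' : 3 ≤ v.card) :
    (t.repl v N).IsTree ↔ t.IsTree := by
  rw [isTree_iff, isTree_iff, conn_repl_iff hv hN]
  have h1 : (∀ i, ((t.repl v N).stars.filter (fun v => i ∈ v)).card = 2) ↔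
      ∀ i, (t.stars.filter (fun v => i ∈ v)).card = 2 := by
    have hsucc : ∀ j : Fin e, ((t.repl v N).stars.filter (fun v => j.succ ∈ v)).card
        = (t.stars.filter (fun v => j ∈ v)).card := fun j => by
      rw [Finset.card_filter, sum_repl t v hN.zero_mem, hN.sum, Finset.card_filter]
      simp only [succ_mem_up]
      exact sum_stars_erase hv fun w => if j ∈ w then 1 else 0
    have h0 : ((t.repl v N).stars.filter (fun v => 0 ∈ v)).card = 2 := by
      rw [Finset.card_filter, sum_repl t v hN.zero_mem, ← hN.card, Finset.card_eq_sum_ones]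
      simp only [zero_notMem_up, if_false, Finset.sum_const_zero, zero_add]
      exact Finset.sum_congr rfl fun A hA => if_pos (hN.zero_mem A hA)
    exact ⟨fun h j => by rw [← hsucc]; exact h _,
      fun h i => Fin.cases h0 (fun j => by rw [hsucc]; exact h j) i⟩
  have h2 : (∀ w ∈ (t.repl v N).stars, w.card = 1 ∨ 3 ≤ w.card) ↔
      ∀ w ∈ t.stars, w.card = 1 ∨ 3 ≤ w.card := by
    constructor
    · intro h w hw
      by_cases hwv : w = v
      · subst hwv; exact .inr hval'
      · simpa using h (up w) (mem_repl.2 (.inl ⟨w, hw, hwv, rfl⟩))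
    · intro h w hw
      rcases mem_repl.1 hw with ⟨x, hx, hxv, rfl⟩ | hA
      · simpa using h x hx
      · exact hval w hA
  have h3 : (t.repl v N).stars.card = t.stars.card + 1 := by
    rw [Finset.card_eq_sum_ones, sum_repl t v hN.zero_mem, ← Finset.card_eq_sum_ones,
      ← Finset.card_eq_sum_ones, hN.card, Finset.card_erase_of_mem hv]
    have := Finset.card_pos.2 ⟨v, hv⟩
    omega
  rw [h1, h2, h3, Nat.add_right_cancel_iff]

theorem degree_eq_sum (t : Sys m e) : t.degree = ∑ v ∈ t.stars, (v.card - 3) := by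
  rw [degree, internal, Finset.sum_filter]
  exact Finset.sum_congr rfl fun v _ => by split_ifs <;> omega

theorem card_univalent_eq_sum (t : Sys m e) :
    t.univalent.card = ∑ v ∈ t.stars, if v.card = 1 then 1 else 0 := by
  rw [univalent, Finset.card_filter]

/-! ### Expansions: trees, labels, degree and number of leaves. -/

section expand

variable {t : Sys m e} {v A : Finset (Fin e)}

theorem card_of_mem_halves (hA : A ∈ halves v) : A.card + (v \ A).card = v.card := by
  rw [add_comm]; exact Finset.card_sdiff_add_card_eq_card (mem_halves.1 hA).1

theorem isTree_expand_iff (hv : v ∈ t.stars) (hA : A ∈ halves v) :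
    (t.expand v {A, v \ A}).IsTree ↔ t.IsTree := by
  have h1 := card_of_mem_halves hA
  have h2 := mem_halves.1 hA
  rw [expand_eq_repl]
  refine isTree_repl_iff hv (splits_halves hA) (fun B hB => .inr ?_) (by omega)
  simp only [Finset.image_insert, Finset.image_singleton, Finset.mem_insert,
    Finset.mem_singleton] at hB
  rcases hB with rfl | rfl <;> rw [card_ins] <;> omega

theorem singleton_succ_mem_repl_iff {N : Finset (Finset (Fin (e + 1)))} (hv : v.card ≠ 1)
    (hN : ∀ A ∈ N, 0 ∈ A) {j : Fin e} : {j.succ} ∈ (t.repl v N).stars ↔ {j} ∈ t.stars := by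
  rw [mem_repl]
  constructor
  · rintro (⟨w, hw, -, h⟩ | h)
    · rw [← up_singleton, up_inj] at h
      exact h ▸ hw
    · exact absurd (Finset.mem_singleton.1 (hN _ h)) (Fin.succ_ne_zero _).symm
  · exact fun h => .inl ⟨{j}, h, fun h => hv (by simp [← h]), up_singleton j⟩

theorem singleton_zero_notMem_expand (hA : A ∈ halves v) :
    {0} ∉ (t.expand v {A, v \ A}).stars := by
  have h2 := mem_halves.1 hA
  rw [expand_eq_repl, mem_repl]
  rintro (⟨w, -, -, h⟩ | h)
  · exact ne_up_of_zero_mem (by simp) w h.symm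
  · simp only [Finset.image_insert, Finset.image_singleton, Finset.mem_insert,
      Finset.mem_singleton] at h
    rcases h with h | h
    · have := congrArg Finset.card h
      simp at this; simp [this] at h2
    · have := congrArg Finset.card h
      rw [card_ins, Finset.card_singleton] at this; omega

theorem isUnrooted_expand_iff (hv : v ∈ t.stars) (hA : A ∈ halves v) :
    (t.expand v {A, v \ A}).IsUnrooted ↔ t.IsUnrooted := by
  have h1 := card_of_mem_halves hA
  have h2 := mem_halves.1 hA
  have hs : ∀ j : Fin e, {j.succ} ∈ (t.expand v {A, v \ A}).stars ↔ {j} ∈ t.stars := fun j =>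
    singleton_succ_mem_repl_iff (by omega) fun A hA => zero_mem_of_mem_image_ins hA
  constructor
  · intro h
    refine ⟨(isTree_expand_iff hv hA).1 h.toIsTree, fun i => ?_⟩
    rw [← hs]; exact h.labeled i.succ
  · intro h
    refine ⟨(isTree_expand_iff hv hA).2 h.toIsTree, fun i => ?_⟩
    refine Fin.cases ?_ (fun j => ?_) i
    · exact iff_of_false (fun h => h rfl) (singleton_zero_notMem_expand hA)
    · rw [hs]; exact h.labeled j

theorem isRooted_expand_iff (hv : v ∈ t.stars) (hA : A ∈ halves v) :
    (t.expand v {A, v \ A}).IsRooted ↔ t.IsRooted := by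
  have h1 := card_of_mem_halves hA
  have h2 := mem_halves.1 hA
  have hs : ∀ j : Fin e, {j.succ} ∈ (t.expand v {A, v \ A}).stars ↔ {j} ∈ t.stars := fun j =>
    singleton_succ_mem_repl_iff (by omega) fun A hA => zero_mem_of_mem_image_ins hA
  constructor
  · intro h
    refine ⟨(isTree_expand_iff hv hA).1 h.toIsTree, fun i hi => ?_, ?_⟩
    · rw [← hs]; exact h.labeled i.succ hi
    · obtain ⟨r, ⟨h1, h2⟩, h3⟩ := h.root
      induction r using Fin.cases with
      | zero => exact absurd h1 (singleton_zero_notMem_expand hA)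
      | succ j =>
        exact ⟨j, ⟨(hs j).1 h1, h2⟩, fun k hk => Fin.succ_injective _ (h3 _ ⟨(hs k).2 hk.1, hk.2⟩)⟩
  · intro h
    refine ⟨(isTree_expand_iff hv hA).2 h.toIsTree, fun i => ?_, ?_⟩
    · refine Fin.cases (fun h => absurd rfl h) (fun j hj => ?_) i
      rw [hs]; exact h.labeled j hj
    · obtain ⟨r, ⟨h1, h2⟩, h3⟩ := h.root
      refine ⟨r.succ, ⟨(hs r).2 h1, h2⟩, fun k => ?_⟩
      refine Fin.cases (fun h1 => absurd h1.1 (singleton_zero_notMem_expand hA))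
        (fun j h1 => ?_) k
      exact congrArg Fin.succ (h3 j ⟨(hs j).1 h1.1, h1.2⟩)

theorem sum_expand_stars {M : Type*} [AddCommMonoid M] (hA : A ∈ halves v)
    (F : Finset (Fin (e + 1)) → M) :
    ∑ w ∈ (t.expand v {A, v \ A}).stars, F w
      = ∑ w ∈ t.stars.erase v, F (up w) + (F (ins A) + F (ins (v \ A))) := by
  rw [expand_eq_repl, sum_repl t v fun A hA => zero_mem_of_mem_image_ins hA,
    Finset.sum_image fun _ _ _ _ h => ins_injective h, Finset.sum_pair (ne_sdiff_of_mem_halves hA)]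

/-- The valences of the two new vertices add up to `v.card + 2`, and subtracting `3` twice loses
one. Both are at least three, so the truncated differences are genuine. -/
theorem degree_expand (hv : v ∈ t.stars) (hA : A ∈ halves v) :
    (t.expand v {A, v \ A}).degree + 1 = t.degree := by
  have h1 := card_of_mem_halves hA
  have h2 := mem_halves.1 hA
  rw [degree_eq_sum, degree_eq_sum, sum_expand_stars hA, ← sum_stars_erase hv]
  simp only [card_up, card_ins]
  omega

theorem card_univalent_expand (hv : v ∈ t.stars) (hA : A ∈ halves v) :
    (t.expand v {A, v \ A}).univalent.card = t.univalent.card := by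
  have h1 := card_of_mem_halves hA
  have h2 := mem_halves.1 hA
  rw [card_univalent_eq_sum, card_univalent_eq_sum, sum_expand_stars hA, ← sum_stars_erase hv]
  simp only [card_up, card_ins]
  rw [if_neg (by omega), if_neg (by omega), if_neg (by omega)]

end expand

/-! ### Root attachments: trees, labels, degree and number of leaves. -/

section attach

variable {t : Sys m e} {v : Finset (Fin e)}

theorem isTree_attach_iff (hv : v ∈ t.stars) (hc : 3 ≤ v.card) :
    (t.attach v).IsTree ↔ t.IsTree := by
  rw [attach_eq_repl]
  refine isTree_repl_iff hv (splits_attach (Finset.card_pos.1 (by omega))) (fun B hB => ?_) hc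
  simp only [Finset.mem_insert, Finset.mem_singleton] at hB
  rcases hB with rfl | rfl
  · rw [card_ins]; omega
  · simp

theorem zero_mem_attach_pair {A : Finset (Fin (e + 1))}
    (h : A ∈ ({ins v, {0}} : Finset (Finset (Fin (e + 1))))) : 0 ∈ A := by
  simp only [Finset.mem_insert, Finset.mem_singleton] at h
  rcases h with rfl | rfl <;> simp

theorem singleton_zero_mem_attach : {0} ∈ (t.attach v).stars :=
  mem_repl.2 (.inr (by simp))

theorem ins_mem_attach : ins v ∈ (t.attach v).stars :=
  mem_repl.2 (.inr (Finset.mem_insert_self _ _))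

theorem isRooted_attach_iff (hv : v ∈ t.stars) (hc : 3 ≤ v.card) :
    (t.attach v).IsRooted ↔ t.IsUnrooted := by
  have hs : ∀ j : Fin e, {j.succ} ∈ (t.attach v).stars ↔ {j} ∈ t.stars := fun j =>
    singleton_succ_mem_repl_iff (by omega) fun A hA => zero_mem_attach_pair hA
  constructor
  · intro h
    refine ⟨(isTree_attach_iff hv hc).1 h.toIsTree, fun i => ⟨fun hi => ?_, fun hi hl => ?_⟩⟩
    · rw [← hs]; exact h.labeled i.succ hi
    · have := h.root.unique ⟨(hs i).2 hi, hl⟩ ⟨singleton_zero_mem_attach, rfl⟩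
      exact Fin.succ_ne_zero _ this
  · intro h
    refine ⟨(isTree_attach_iff hv hc).2 h.toIsTree, fun i => ?_, 0,
      ⟨singleton_zero_mem_attach, rfl⟩, fun i => ?_⟩
    · refine Fin.cases (fun h => absurd rfl h) (fun j hj => ?_) i
      rw [hs]; exact (h.labeled j).1 hj
    · refine Fin.cases (fun _ => rfl) (fun j hj => ?_) i
      exact absurd hj.2 ((h.labeled j).2 ((hs j).1 hj.1))

theorem sum_attach_stars {M : Type*} [AddCommMonoid M] (hv : v.Nonempty)
    (F : Finset (Fin (e + 1)) → M) :
    ∑ w ∈ (t.attach v).stars, F w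
      = ∑ w ∈ t.stars.erase v, F (up w) + (F (ins v) + F {0}) := by
  rw [attach_eq_repl, sum_repl t v fun A hA => zero_mem_attach_pair hA, Finset.sum_pair]
  rw [← ins_empty, Ne, ins_inj]
  exact hv.ne_empty

theorem degree_attach (hv : v ∈ t.stars) (hc : 3 ≤ v.card) :
    (t.attach v).degree = t.degree + 1 := by
  rw [degree_eq_sum, degree_eq_sum, sum_attach_stars (Finset.card_pos.1 (by omega)),
    ← sum_stars_erase hv]
  simp only [card_up, card_ins, Finset.card_singleton]
  omega

theorem card_univalent_attach (hv : v ∈ t.stars) (hc : 3 ≤ v.card) :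
    (t.attach v).univalent.card = t.univalent.card + 1 := by
  rw [card_univalent_eq_sum, card_univalent_eq_sum,
    sum_attach_stars (Finset.card_pos.1 (by omega)), ← sum_stars_erase hv]
  simp only [card_up, card_ins, Finset.card_singleton]
  rw [if_neg (by omega), if_neg (by omega : ¬ v.card = 1)]
  simp

end attach

end Sys
theorem mem_image_perm {σ : Equiv.Perm (Fin e)} {s : Finset (Fin e)} {i : Fin e} :
    i ∈ s.image σ ↔ σ.symm i ∈ s := by
  rw [Finset.mem_image]
  exact ⟨fun ⟨a, ha, h⟩ => by rwa [← h, Equiv.symm_apply_apply], fun h => ⟨_, h, by simp⟩⟩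

/-! ### Attaching a root edge in the middle of an edge -/

/-- The tree `t` with a root edge attached to the middle of the edge `h` at the vertex `v`. The
root edge has the number `1`, and the half of `h` at `v` has the number `0`. -/
def Sys.edgeRoot (t : Sys m e) (v : Finset (Fin e)) (h : Fin e) : Sys m (e + 2) :=
  (t.attach v).expand (ins v) {ins {h}, up (v \ {h})}

theorem attach_expand_ins_stars (t : Sys m e) {v : Finset (Fin e)} (hv : v.Nonempty)
    (A : Finset (Fin e)) :
    ((t.attach v).expand (ins v) {ins A, up (v \ A)}).stars
      = (t.stars.erase v).image (fun x => up (up x)) ∪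
        {up {0}, ins (ins A), ins (up (v \ A))} := by
  rw [Sys.expand_eq_repl, Sys.attach_eq_repl, repl_repl_stars t v (fun w _ _ => up_ne_ins)]
  have h : ({ins v, {0}} : Finset (Finset (Fin (e + 1)))).erase (ins v) = {{0}} := by
    rw [Finset.erase_insert]
    rw [← ins_empty, Finset.mem_singleton, ins_inj]
    exact hv.ne_empty
  rw [h, Finset.image_singleton, Finset.image_insert, Finset.image_singleton, Finset.union_assoc]
  rfl

theorem expand_attach_ins_stars (t : Sys m e) {v A : Finset (Fin e)} (hA : A ∈ halves v) :
    ((t.expand v {A, v \ A}).attach (ins A)).stars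
      = (t.stars.erase v).image (fun x => up (up x)) ∪
        {up (ins (v \ A)), ins (ins A), {0}} := by
  rw [Sys.expand_eq_repl, Sys.attach_eq_repl, repl_repl_stars t v (fun w _ _ => up_ne_ins)]
  have h : (({A, v \ A} : Finset (Finset (Fin e))).image ins).erase (ins A) = {ins (v \ A)} := by
    rw [Finset.image_insert, Finset.image_singleton, Finset.erase_insert]
    simpa using ne_sdiff_of_mem_halves hA
  rw [h, Finset.image_singleton, Finset.union_assoc]
  rfl

theorem mem_edgeRoot {t : Sys m e} {v : Finset (Fin e)} (hv : v.Nonempty) {h : Fin e}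
    {x : Finset (Fin (e + 2))} : x ∈ (t.edgeRoot v h).stars ↔
      (∃ w ∈ t.stars, w ≠ v ∧ up (up w) = x) ∨ x = up {0} ∨ x = ins (ins {h}) ∨
        x = ins (up (v \ {h})) := by
  rw [Sys.edgeRoot, attach_expand_ins_stars t hv]
  simp only [Finset.mem_union, Finset.mem_image, Finset.mem_erase, Finset.mem_insert,
    Finset.mem_singleton]
  exact or_congr_left (exists_congr fun w => by tauto)

/-- The root edge and the expansion edge are inserted in the opposite order; this sign is what
(-1)^deg compensates. -/
theorem attach_expand_of_ne (t : Sys m e) (v w : Finset (Fin e)) (P : Finset (Finset (Fin e))) :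
    cls ((t.attach v).expand (up w) (P.image up)) = - cls ((t.expand w P).attach (up v)) := by
  rw [← cls_swap]
  congr 1
  rw [Sys.expand_eq_repl, Sys.attach_eq_repl, Sys.expand_eq_repl, Sys.attach_eq_repl]
  refine repl_repl_of_ne _ (P.image ins)
    (fun A hA => ne_up_of_zero_mem (Sys.zero_mem_attach_pair hA) _)
    (fun A hA => ne_up_of_zero_mem (zero_mem_of_mem_image_ins hA) _)
    _ _ ?_ (image_ins_image_up P)
  simp only [Finset.image_insert, Finset.image_singleton]
  rw [swapSet_up_ins, swapSet_up_singleton_zero]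

/-- If the part next to the root has at least two old edges, then `v` could have been expanded
before the root was attached to that part. -/
theorem attach_expand_halves (t : Sys m e) {v A : Finset (Fin e)} (hA : A ∈ halves v) :
    cls ((t.attach v).expand (ins v) {ins A, up (v \ A)})
      = - cls ((t.expand v {A, v \ A}).attach (ins A)) := by
  have hv : v.Nonempty := by
    have := mem_halves.1 hA
    exact (Finset.card_pos.1 (by omega : 0 < A.card)).mono this.1
  rw [← cls_swap]
  congr 1
  ext1
  · change _ = Finset.image swapSet _
    rw [attach_expand_ins_stars t hv, expand_attach_ins_stars t hA, Finset.image_union,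
      Finset.image_image, Finset.image_insert, Finset.image_insert, Finset.image_singleton,
      swapSet_up_ins, swapSet_ins_ins, swapSet_singleton_zero]
    congr 1
    · exact Finset.image_congr fun A _ => (swapSet_up_up A).symm
    · ext B; simp only [Finset.mem_insert, Finset.mem_singleton]; tauto
  · exact (cons_cons_comp_swap _).symm

/-- Singletons put the root in the middle of an edge, halves come from expansions of the unrooted
tree. The bound on `v` makes the complement of a singleton large enough. -/
theorem parts_eq (v : Finset (Fin e)) (hc : 3 ≤ v.card) :
    parts v = v.image (fun h => {h}) ∪ halves v := by
  ext A
  simp only [mem_parts, Finset.mem_union, mem_halves, Finset.mem_image]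
  constructor
  · rintro ⟨h1, h2, h3⟩
    by_cases h : A.card = 1
    · obtain ⟨a, rfl⟩ := Finset.card_eq_one.1 h
      exact .inl ⟨a, by simpa using h1, rfl⟩
    · exact .inr ⟨h1, by omega, h3⟩
  · rintro (⟨a, ha, rfl⟩ | ⟨h1, h2, h3⟩)
    · refine ⟨by simpa using ha, by simp, ?_⟩
      rw [Finset.card_sdiff_of_subset (by simpa using ha), Finset.card_singleton]
      omega
    · exact ⟨h1, by omega, h3⟩

theorem sum_parts {M : Type*} [AddCommMonoid M] (v : Finset (Fin e)) (hc : 3 ≤ v.card)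
    (g : Finset (Fin e) → M) :
    ∑ A ∈ parts v, g A = ∑ h ∈ v, g {h} + ∑ A ∈ halves v, g A := by
  rw [parts_eq v hc, Finset.sum_union, Finset.sum_image fun _ _ _ _ h => Finset.singleton_injective h]
  rw [Finset.disjoint_left]
  intro A hA hA'
  obtain ⟨a, -, rfl⟩ := Finset.mem_image.1 hA
  have := (mem_halves.1 hA').2.1
  simp at this

theorem partitions_eq_empty {v : Finset (Fin e)} (hv : v.card < 4) : partitions v = ∅ := by
  rw [Finset.eq_empty_iff_forall_notMem]
  intro P hP
  have := card_of_mem_partitions hP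
  omega

/-- The sum over `edgeRoot` is the only part not coming from the boundary of `t`. Both the chain map
property and the homology computation rest on this formula. -/
theorem boundary_cls_attach (t : Sys m e) {v : Finset (Fin e)} (hc : 3 ≤ v.card) :
    boundary m (cls (t.attach v)) = ∑ h ∈ v, cls (t.edgeRoot v h)
      - (∑ w ∈ t.stars.erase v, ∑ P ∈ partitions w, cls ((t.expand w P).attach (up v))
        + ∑ A ∈ halves v, cls ((t.expand v {A, v \ A}).attach (ins A))) := by
  rw [boundary_cls, Sys.sum_attach_stars (Finset.card_pos.1 (by omega)),
    partitions_eq_empty (v := {0}) (by simp), Finset.sum_empty, add_zero, sum_partitions_ins,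
    sum_parts v hc]
  simp only [sum_partitions_up, attach_expand_of_ne]
  rw [Finset.sum_congr rfl fun A hA => attach_expand_halves t hA]
  simp only [Finset.sum_neg_distrib]
  change _ + (∑ h ∈ v, cls (t.edgeRoot v h) + _) = _
  abel

/-! ### Exchanging the ends of an edge -/

theorem swap_succ_succ_ne {h i : Fin e} (hi : i ≠ h) :
    Equiv.swap (0 : Fin (e + 2)) h.succ.succ i.succ.succ = i.succ.succ :=
  Equiv.swap_apply_of_ne_of_ne (Fin.succ_ne_zero _) (by simpa using hi)

theorem swap_succ_succ_one {h : Fin e} :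
    Equiv.swap (0 : Fin (e + 2)) h.succ.succ (Fin.succ 0) = Fin.succ 0 :=
  Equiv.swap_apply_of_ne_of_ne (Fin.succ_ne_zero _)
    (fun h' => Fin.succ_ne_zero _ (Fin.succ_injective _ h').symm)

theorem finset_ext_fin_two {A B : Finset (Fin (e + 2))} (h0 : 0 ∈ A ↔ 0 ∈ B)
    (h1 : Fin.succ 0 ∈ A ↔ Fin.succ 0 ∈ B)
    (hs : ∀ i : Fin e, i.succ.succ ∈ A ↔ i.succ.succ ∈ B) : A = B :=
  finset_ext_fin h0 fun i => Fin.cases h1 hs i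

theorem image_swap_succ_succ {h : Fin e} {A B : Finset (Fin (e + 2))}
    (h0 : h.succ.succ ∈ A ↔ 0 ∈ B) (hh : 0 ∈ A ↔ h.succ.succ ∈ B)
    (h1 : Fin.succ 0 ∈ A ↔ Fin.succ 0 ∈ B)
    (hs : ∀ i : Fin e, i ≠ h → (i.succ.succ ∈ A ↔ i.succ.succ ∈ B)) :
    A.image (Equiv.swap 0 h.succ.succ) = B := by
  refine finset_ext_fin_two ?_ ?_ fun i => ?_
  · rw [mem_image_perm, Equiv.symm_swap, Equiv.swap_apply_left, h0]
  · rw [mem_image_perm, Equiv.symm_swap, swap_succ_succ_one, h1]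
  · rw [mem_image_perm, Equiv.symm_swap]
    by_cases hi : i = h
    · subst hi; rw [Equiv.swap_apply_right, hh]
    · rw [swap_succ_succ_ne hi, hs i hi]

/-- The root cuts `h` into two halves, numbered `0` (the half at the chosen end) and `h.succ.succ`.
Choosing the other end exchanges these numbers. The half numbered `0` carries no label, so `h` must
not carry one either. -/
theorem edgeRoot_other_end {t : Sys m e} (ht : t.IsTree) {v w : Finset (Fin e)}
    (hv : v ∈ t.stars) (hw : w ∈ t.stars) (hvw : v ≠ w) {h : Fin e} (hhv : h ∈ v) (hhw : h ∈ w)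
    (hl : t.label h = none) :
    t.edgeRoot w h = (t.edgeRoot v h).relabel (Equiv.swap 0 h.succ.succ) := by
  have h1 : ∀ x : Finset (Fin e), h ∉ x →
      (up (up x)).image (Equiv.swap 0 h.succ.succ) = up (up x) := fun x hx =>
    image_swap_succ_succ (by simpa using hx) (by simpa using hx) Iff.rfl (fun i hi => Iff.rfl)
  -- Here `x` is the far end of `h`: in it the exchange replaces the number of `h` by `0`.
  have h2 : ∀ x : Finset (Fin e), h ∈ x →
      (up (up x)).image (Equiv.swap 0 h.succ.succ) = ins (up (x \ {h})) := fun x hx =>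
    image_swap_succ_succ (by simpa using hx) (by simp) (by rw [succ_mem_up, succ_mem_ins]; simp)
      (fun i hi => by simp [hi])
  have h3 : (ins (up (v \ {h}))).image (Equiv.swap 0 h.succ.succ) = up (up v) :=
    image_swap_succ_succ (by simp) (by simpa using hhv) (by rw [succ_mem_up, succ_mem_ins]; simp)
      (fun i hi => by simp [hi])
  have h4 : (ins (ins {h})).image (Equiv.swap 0 h.succ.succ) = ins (ins {h}) :=
    image_swap_succ_succ (by simp) (by simp) (by simp) (fun i hi => Iff.rfl)
  have h5 : (up {0} : Finset (Fin (e + 2))).image (Equiv.swap 0 h.succ.succ) = up {0} :=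
    image_swap_succ_succ (by simp) (by simp) Iff.rfl (fun i hi => Iff.rfl)
  have hends : ∀ x ∈ t.stars, h ∈ x → x = v ∨ x = w := by
    obtain ⟨w', -, hne, hhw', hw'⟩ := ht.exists_other_end hv hhv
    rcases hw' w hw hhw with rfl | rfl
    · exact absurd rfl hvw
    · exact hw'
  ext1
  · ext x
    rw [mem_edgeRoot ⟨h, hhw⟩, Sys.mem_relabel]
    simp only [mem_edgeRoot ⟨h, hhv⟩]
    constructor
    · rintro (⟨y, hy, hyw, rfl⟩ | rfl | rfl | rfl)
      · by_cases hyv : y = v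
        · subst hyv
          exact ⟨_, .inr (.inr (.inr rfl)), h3⟩
        · have : h ∉ y := fun hhy => (hends y hy hhy).elim hyv hyw
          exact ⟨_, .inl ⟨y, hy, hyv, rfl⟩, h1 y this⟩
      · exact ⟨_, .inr (.inl rfl), h5⟩
      · exact ⟨_, .inr (.inr (.inl rfl)), h4⟩
      · exact ⟨_, .inl ⟨w, hw, hvw.symm, rfl⟩, h2 w hhw⟩
    · rintro ⟨z, ⟨y, hy, hyv, rfl⟩ | rfl | rfl | rfl, rfl⟩
      · by_cases hyw : y = w
        · subst hyw
          exact .inr (.inr (.inr (h2 y hhw)))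
        · have : h ∉ y := fun hhy => (hends y hy hhy).elim hyv hyw
          exact .inl ⟨y, hy, hyw, (h1 y this).symm⟩
      · exact .inr (.inl h5)
      · exact .inr (.inr (.inl h4))
      · exact .inl ⟨v, hv, hvw, h3.symm⟩
  · funext i
    change (Fin.cons none (Fin.cons none t.label : Fin (e + 1) → _) : Fin (e + 2) → _) i
      = (Fin.cons none (Fin.cons none t.label : Fin (e + 1) → _) : Fin (e + 2) → _)
        ((Equiv.swap 0 h.succ.succ).symm i)
    rw [Equiv.symm_swap]
    refine Fin.cases ?_ (fun i => Fin.cases ?_ (fun i => ?_) i) i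
    · rw [Equiv.swap_apply_left]
      simp [hl]
    · rw [swap_succ_succ_one]
    · by_cases hi : i = h
      · subst hi; rw [Equiv.swap_apply_right]; simp [hl]
      · rw [swap_succ_succ_ne hi]

theorem cls_edgeRoot_other_end {t : Sys m e} (ht : t.IsTree) {v w : Finset (Fin e)}
    (hv : v ∈ t.stars) (hw : w ∈ t.stars) (hvw : v ≠ w) {h : Fin e} (hhv : h ∈ v) (hhw : h ∈ w)
    (hl : t.label h = none) : cls (t.edgeRoot w h) = - cls (t.edgeRoot v h) := by
  rw [edgeRoot_other_end ht hv hw hvw hhv hhw hl, cls_relabel,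
    Equiv.Perm.sign_swap (Fin.succ_ne_zero _).symm]
  simp

theorem isLeafBracket_edgeRoot {t : Sys m e} {v : Finset (Fin e)} (hv : 3 ≤ v.card) {h : Fin e}
    (hs : {h} ∈ t.stars) (hl : t.label h ≠ none) : (t.edgeRoot v h).IsLeafBracket := by
  have hne : v.Nonempty := Finset.card_pos.1 (by omega)
  refine ⟨Fin.succ 0, h.succ.succ, 0, ?_, Fin.succ_ne_zero _, Fin.succ_ne_zero _, ?_, ?_, rfl, ?_, hl⟩
  · exact fun h' => Fin.succ_ne_zero _ (Fin.succ_injective _ h').symm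
  · rw [mem_edgeRoot hne]
    refine .inr (.inr (.inl ?_))
    ext i
    simp only [ins, up, Finset.mem_insert, Finset.mem_singleton, Finset.image_insert, Finset.image_singleton]
    tauto
  · rw [mem_edgeRoot hne, ← up_singleton]
    exact .inr (.inl rfl)
  · rw [mem_edgeRoot hne, ← up_singleton, ← up_singleton]
    refine .inl ⟨{h}, hs, ?_, rfl⟩
    rintro rfl
    simp at hv

/-- The class in the quotient by the trees `(i, J)`. -/
def clsBar (t : Sys m e) : ChainsBar m := QuotientAddGroup.mk (cls t)

theorem clsBar_eq_zero {t : Sys m e} (h : t.IsLeafBracket) : clsBar t = 0 :=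
  (QuotientAddGroup.eq_zero_iff _).2 (AddSubgroup.subset_closure ⟨e, t, h, rfl⟩)

theorem clsBar_relabel (t : Sys m e) (σ : Equiv.Perm (Fin e)) :
    clsBar (t.relabel σ) = (Equiv.Perm.sign σ : ℤ) • clsBar t := by
  rw [clsBar, cls_relabel]; rfl

theorem boundaryBar_clsBar (t : Sys m e) :
    boundaryBar m (clsBar t) = QuotientAddGroup.mk' (leafBrackets m) (boundary m (cls t)) := rfl

theorem attachRoot_cls (t : Sys m e) :
    attachRoot m (cls t) = ((-1 : ℤ) ^ t.degree) • ∑ v ∈ t.internal, clsBar (t.attach v) := by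
  rw [attachRoot, AddMonoidHom.comp_apply, liftChains_cls, map_zsmul, map_sum]
  rfl

/-! ### The chain map property -/

theorem sum_flags {M : Type*} [AddCommMonoid M] {t : Sys m e}
    (F : Finset (Fin e) → Fin e → M) :
    ∑ v ∈ t.internal, ∑ h ∈ v, F v h
      = ∑ h, ∑ v ∈ t.stars.filter (fun v => h ∈ v), if 3 ≤ v.card then F v h else 0 := by
  rw [Sys.internal, Finset.sum_filter]
  simp only [Finset.sum_filter]
  rw [Finset.sum_comm]
  refine Finset.sum_congr rfl fun v _ => ?_
  split_ifs with hc
  · rw [← Finset.sum_filter]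
    exact Finset.sum_congr (by ext; simp) fun _ _ => rfl
  · simp

theorem Sys.IsUnrooted.label_eq_none {t : Sys m e} (ht : t.IsUnrooted) {u w : Finset (Fin e)}
    (hu : u ∈ t.stars) (hw : w ∈ t.stars) (huw : u ≠ w) {h : Fin e} (hhu : h ∈ u) (hhw : h ∈ w)
    (hcu : 3 ≤ u.card) (hcw : 3 ≤ w.card) : t.label h = none := by
  by_contra hc
  have h1 := (ht.labeled h).1 hc
  obtain ⟨a, b, -, -, -, -, -, hab⟩ := ht.exists_ends h
  have h2 := hab u hu hhu
  have h3 := hab w hw hhw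
  have h4 := hab {h} h1 (by simp)
  have h5 : u ≠ {h} := by rintro rfl; simp at hcu
  have h6 : w ≠ {h} := by rintro rfl; simp at hcw
  grind

/-- Grouped by edges, an edge with two internal ends contributes two opposite terms. A leaf edge
contributes at most one term, a tree (i, J), which is zero in the quotient. -/
theorem sum_edgeRoot_eq_zero {t : Sys m e} (ht : t.IsUnrooted) :
    ∑ v ∈ t.internal, ∑ h ∈ v, clsBar (t.edgeRoot v h) = 0 := by
  rw [sum_flags]
  refine Finset.sum_eq_zero fun h _ => ?_
  obtain ⟨u, w, huw, hf⟩ := Finset.card_eq_two.1 (ht.two_ends h)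
  have hm : ∀ x, x = u ∨ x = w → x ∈ t.stars ∧ h ∈ x := fun x hx => by
    have := Finset.ext_iff.1 hf x
    simpa using this.2 (by simpa using hx)
  obtain ⟨hu, hhu⟩ := hm u (.inl rfl)
  obtain ⟨hw, hhw⟩ := hm w (.inr rfl)
  have leaf : ∀ x, x ∈ t.stars → h ∈ x → 3 ≤ x.card → ∀ y, y ∈ t.stars → h ∈ y → ¬ 3 ≤ y.card →
      clsBar (t.edgeRoot x h) = 0 := by
    intro x hx hhx hcx y hy hhy hcy
    have hy1 : y.card = 1 := (ht.valence y hy).resolve_right hcy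
    obtain ⟨a, rfl⟩ := Finset.card_eq_one.1 hy1
    rw [Finset.mem_singleton] at hhy
    subst hhy
    exact clsBar_eq_zero (isLeafBracket_edgeRoot hcx hy ((ht.labeled h).2 hy))
  rw [hf, Finset.sum_pair huw]
  split_ifs with h1 h2 h2
  · have := cls_edgeRoot_other_end ht.toIsTree hu hw huw hhu hhw
      (ht.label_eq_none hu hw huw hhu hhw h1 h2)
    have h' : clsBar (t.edgeRoot w h) = - clsBar (t.edgeRoot u h) := by
      rw [clsBar, this]; rfl
    rw [h', add_neg_cancel]
  · rw [leaf u hu hhu h1 w hw hhw h2, add_zero]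
  · rw [leaf w hw hhw h2 u hu hhu h1, add_zero]
  · rw [add_zero]

theorem sum_internal_expand {M : Type*} [AddCommMonoid M] {t : Sys m e} {v A : Finset (Fin e)}
    (hA : A ∈ halves v) (F : Finset (Fin (e + 1)) → M) :
    ∑ x ∈ (t.expand v {A, v \ A}).internal, F x
      = ∑ x ∈ t.internal.erase v, F (up x) + (F (ins A) + F (ins (v \ A))) := by
  have h2 := mem_halves.1 hA
  rw [Sys.internal, Finset.sum_filter, Sys.sum_expand_stars hA]
  simp only [card_up, card_ins]
  rw [if_pos (by omega), if_pos (by omega), ← Finset.sum_filter, Sys.internal, Finset.filter_erase]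

/-- Attaching a root anticommutes with expanding up to the `edgeRoot` terms, which cancel. Since an
expansion lowers the degree by one, the factor (-1)^deg turns this into commutation. -/
theorem boundaryBar_attachRoot_cls {t : Sys m e} (ht : t.IsUnrooted) :
    boundaryBar m (attachRoot m (cls t)) = attachRoot m (boundary m (cls t)) := by
  have key : ∀ v ∈ t.stars, ∀ P ∈ partitions v, attachRoot m (cls (t.expand v P))
      = -(((-1 : ℤ) ^ t.degree) • (∑ x ∈ t.internal.erase v, clsBar ((t.expand v P).attach (up x))
        + ∑ A ∈ P, clsBar ((t.expand v P).attach (ins A)))) := by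
    intro v hv P hP
    obtain ⟨A, hA, rfl⟩ := mem_partitions.1 hP
    rw [attachRoot_cls, ← Sys.degree_expand hv hA, sum_internal_expand hA,
      Finset.sum_pair (ne_sdiff_of_mem_halves hA), pow_succ, mul_neg_one, neg_smul, neg_neg]
  have hR : attachRoot m (boundary m (cls t)) = -(((-1 : ℤ) ^ t.degree) •
      (∑ v ∈ t.stars, ∑ P ∈ partitions v, ∑ x ∈ t.internal.erase v,
          clsBar ((t.expand v P).attach (up x))
        + ∑ v ∈ t.stars, ∑ A ∈ halves v, clsBar ((t.expand v {A, v \ A}).attach (ins A)))) := by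
    rw [boundary_cls, map_sum, Finset.sum_congr rfl fun v hv => by
      rw [map_sum, Finset.sum_congr rfl (key v hv)]]
    simp only [Finset.sum_neg_distrib, ← Finset.smul_sum]
    congr 2
    rw [← Finset.sum_add_distrib]
    refine Finset.sum_congr rfl fun v _ => ?_
    rw [Finset.sum_add_distrib,
      sum_partitions_sum v fun P A => clsBar ((t.expand v P).attach (ins A))]
  rw [hR, attachRoot_cls, map_zsmul, ← zsmul_neg, map_sum]
  congr 1
  have hL : ∀ v ∈ t.internal, boundaryBar m (clsBar (t.attach v))
      = ∑ h ∈ v, clsBar (t.edgeRoot v h)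
      - (∑ w ∈ t.stars.erase v, ∑ P ∈ partitions w, clsBar ((t.expand w P).attach (up v))
        + ∑ A ∈ halves v, clsBar ((t.expand v {A, v \ A}).attach (ins A))) := by
    intro v hv
    rw [boundaryBar_clsBar, boundary_cls_attach t (Finset.mem_filter.1 hv).2]
    simp only [map_sub, map_add, map_sum]
    rfl
  rw [Finset.sum_congr rfl hL, Finset.sum_sub_distrib, sum_edgeRoot_eq_zero ht, zero_sub,
    Finset.sum_add_distrib]
  congr 2
  · rw [Finset.sum_congr rfl fun v _ => Finset.sum_comm (s := partitions v)]
    refine Finset.sum_comm' fun v w => ?_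
    simp only [Finset.mem_erase, Sys.internal, Finset.mem_filter, ne_eq, eq_comm (a := v)]
    tauto
  -- A vertex with a half has valence at least four, so summing over all vertices instead of the
  -- internal ones adds nothing.
  · refine Finset.sum_subset (Finset.filter_subset _ _) fun v hv hv' => ?_
    refine Finset.sum_eq_zero fun A hA => absurd (Finset.mem_filter.2 ⟨hv, ?_⟩) hv'
    have h1 := Sys.card_of_mem_halves hA
    have h2 := mem_halves.1 hA
    omega

theorem mem_closure_induction_cls {S : Set (Chains m)} {p : Chains m → Prop}
    (hS : ∀ x ∈ S, p x) (h0 : p 0) (hadd : ∀ x y, p x → p y → p (x + y))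
    (hneg : ∀ x, p x → p (-x)) {x : Chains m} (hx : x ∈ AddSubgroup.closure S) : p x :=
  AddSubgroup.closure_induction (p := fun x _ => p x) hS h0 (fun _ _ _ _ => hadd _ _)
    (fun _ _ => hneg _) hx

theorem boundaryBar_attachRoot {k d : ℕ} {x : Chains m} (hx : x ∈ unrootedChains m k d) :
    boundaryBar m (attachRoot m x) = attachRoot m (boundary m x) := by
  refine mem_closure_induction_cls (p := fun x => boundaryBar m (attachRoot m x)
    = attachRoot m (boundary m x)) ?_ (by simp) (fun x y hx hy => by simp [hx, hy])
    (fun x hx => by simp [hx]) hx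
  rintro _ ⟨e, t, ht, -, -, rfl⟩
  exact boundaryBar_attachRoot_cls ht

theorem clsBar_mem_rootedChainsBar {k d : ℕ} {t : Sys m e} (ht : t.IsRooted)
    (hk : t.univalent.card = k + 1) (hd : t.degree = d) : clsBar t ∈ rootedChainsBar m k d :=
  AddSubgroup.mem_map_of_mem _ (AddSubgroup.subset_closure ⟨e, t, ht, hk, hd, rfl⟩)

theorem clsBar_attach_mem {k d : ℕ} {t : Sys m e} (ht : t.IsUnrooted) (hk : t.univalent.card = k)
    (hd : t.degree = d) {v : Finset (Fin e)} (hv : v ∈ t.internal) :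
    clsBar (t.attach v) ∈ rootedChainsBar m k (d + 1) := by
  obtain ⟨hv, hc⟩ := Finset.mem_filter.1 hv
  exact clsBar_mem_rootedChainsBar ((Sys.isRooted_attach_iff hv hc).2 ht)
    (by rw [Sys.card_univalent_attach hv hc, hk]) (by rw [Sys.degree_attach hv hc, hd])

theorem attachRoot_mem {k d : ℕ} {x : Chains m} (hx : x ∈ unrootedChains m k d) :
    attachRoot m x ∈ rootedChainsBar m k (d + 1) := by
  refine mem_closure_induction_cls (p := fun x => attachRoot m x ∈ rootedChainsBar m k (d + 1))
    ?_ (by rw [map_zero]; exact zero_mem _) (fun x y hx hy => by rw [map_add]; exact add_mem hx hy)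
    (fun x hx => by rw [map_neg]; exact neg_mem hx) hx
  rintro _ ⟨e, t, ht, hk, hd, rfl⟩
  rw [attachRoot_cls]
  exact zsmul_mem (sum_mem fun v hv => clsBar_attach_mem ht hk hd hv) _

/-! ### Contraction of an edge and removal of the root -/

/-- The tree `t` is `s` with its edge `0` contracted to a vertex `v`. As `v` is not yet a vertex of
`s`, removing it again loses nothing. -/
theorem exists_eq_repl {s : Sys m (e + 1)} (hl : s.label 0 = none) {v : Finset (Fin e)}
    (hv : up v ∉ s.stars) : ∃ t : Sys m e, v ∈ t.stars ∧
      s = t.repl v (s.stars.filter fun A => 0 ∈ A) := by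
  refine ⟨⟨insert v (Finset.univ.filter fun w => up w ∈ s.stars), fun i => s.label i.succ⟩,
    Finset.mem_insert_self _ _, ?_⟩
  ext1
  · ext x
    rw [Sys.mem_repl]
    simp only [Finset.mem_insert, Finset.mem_filter, Finset.mem_univ, true_and]
    constructor
    · intro hx
      by_cases h0 : 0 ∈ x
      · exact .inr ⟨hx, h0⟩
      · obtain ⟨w, rfl⟩ := exists_up_of_zero_notMem h0
        exact .inl ⟨w, .inr hx, fun h => hv (h ▸ hx), rfl⟩
    · rintro (⟨w, rfl | hw, hwv, rfl⟩ | ⟨hx, -⟩)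
      · exact absurd rfl hwv
      · exact hw
      · exact hx
  · funext i
    exact Fin.cases hl (fun _ => rfl) i

theorem filter_zero_eq_pair {s : Sys m (e + 1)} (hs : s.IsTree) {a b : Finset (Fin (e + 1))}
    (ha : a ∈ s.stars) (hb : b ∈ s.stars) (h0a : 0 ∈ a) (h0b : 0 ∈ b) (hab : a ≠ b) :
    (s.stars.filter fun A => 0 ∈ A) = {a, b} := by
  refine (Finset.eq_of_subset_of_card_le ?_ ?_).symm
  · intro x hx
    rcases Finset.mem_insert.1 hx with rfl | hx
    · exact Finset.mem_filter.2 ⟨ha, h0a⟩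
    · rw [Finset.mem_singleton.1 hx]; exact Finset.mem_filter.2 ⟨hb, h0b⟩
  · rw [hs.two_ends, Finset.card_pair hab]

/-- The contraction of an internal edge. -/
theorem exists_eq_expand {s : Sys m (e + 1)} (hs : s.IsTree) (hl : s.label 0 = none)
    {A B : Finset (Fin e)} (hA : ins A ∈ s.stars) (hB : ins B ∈ s.stars) (hAB : A ≠ B)
    (hcA : 2 ≤ A.card) (hcB : 2 ≤ B.card) :
    ∃ t : Sys m e, A ∪ B ∈ t.stars ∧ A ∈ halves (A ∪ B) ∧ (A ∪ B) \ A = B ∧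
      s = t.expand (A ∪ B) {A, (A ∪ B) \ A} := by
  have hdisj : Disjoint A B := by
    rw [Finset.disjoint_left]
    intro i hi hi'
    have := hs.eq_of_mem_mem hA hB (by simpa using hAB) (i := 0) (j := i.succ)
      (by simp) (by simp) (by simpa using hi) (by simpa using hi')
    exact Fin.succ_ne_zero _ this.symm
  have hsd : (A ∪ B) \ A = B := by
    rw [Finset.union_sdiff_cancel_left hdisj]
  -- Such a vertex would share two edges with `ins A`.
  have hup : up (A ∪ B) ∉ s.stars := by
    intro h
    obtain ⟨i, hi, j, hj, hij⟩ := Finset.one_lt_card.1 (by omega : 1 < A.card)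
    refine hij (Fin.succ_injective _ (hs.eq_of_mem_mem hA h ins_ne_up ?_ ?_ ?_ ?_)) <;>
      simp [hi, hj]
  obtain ⟨t, hv, ht⟩ := exists_eq_repl hl hup
  refine ⟨t, hv, mem_halves.2 ⟨Finset.subset_union_left, hcA, by rwa [hsd]⟩, hsd, ?_⟩
  rw [hsd, Sys.expand_eq_repl, Finset.image_insert, Finset.image_singleton,
    ← filter_zero_eq_pair hs hA hB zero_mem_ins zero_mem_ins (by simpa using hAB)]
  exact ht

/-- The removal of the root edge. -/
theorem exists_eq_attach {s : Sys m (e + 1)} (hs : s.IsTree) (hl : s.label 0 = none)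
    (h0 : {0} ∈ s.stars) {v : Finset (Fin e)} (hv : ins v ∈ s.stars) (hc : 2 ≤ v.card) :
    ∃ t : Sys m e, v ∈ t.stars ∧ s = t.attach v := by
  have hne : ins v ≠ {0} := by
    rw [← ins_empty, Ne, ins_inj]; rintro rfl; simp at hc
  have hup : up v ∉ s.stars := by
    intro h
    obtain ⟨i, hi, j, hj, hij⟩ := Finset.one_lt_card.1 (by omega : 1 < v.card)
    refine hij (Fin.succ_injective _ (hs.eq_of_mem_mem hv h ins_ne_up ?_ ?_ ?_ ?_)) <;>
      simp [hi, hj]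
  obtain ⟨t, hv', ht⟩ := exists_eq_repl hl hup
  refine ⟨t, hv', ?_⟩
  rw [Sys.attach_eq_repl, ← filter_zero_eq_pair hs hv h0 zero_mem_ins (by simp) hne]
  exact ht

/-! ### Classification of rooted trees -/

theorem edgeRoot_eq_expand {t : Sys m e} {v : Finset (Fin e)} {h : Fin e} :
    t.edgeRoot v h = (t.attach v).expand (ins v) {ins {h}, ins v \ ins {h}} := by
  rw [Sys.edgeRoot, ins_sdiff_ins]

theorem ins_singleton_mem_halves {v : Finset (Fin e)} (hv : 3 ≤ v.card) {h : Fin e} (hh : h ∈ v) :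
    ins {h} ∈ halves (ins v) := by
  rw [mem_halves, ins_sdiff_ins, card_up, card_ins]
  refine ⟨by simpa using hh, by simp, ?_⟩
  rw [Finset.card_sdiff_of_subset (by simpa using hh), Finset.card_singleton]
  omega

theorem degree_edgeRoot {t : Sys m e} {v : Finset (Fin e)} (hv : v ∈ t.stars) (hc : 3 ≤ v.card)
    {h : Fin e} (hh : h ∈ v) : (t.edgeRoot v h).degree = t.degree := by
  have := Sys.degree_expand (Sys.ins_mem_attach (t := t)) (ins_singleton_mem_halves hc hh)
  rw [← edgeRoot_eq_expand, Sys.degree_attach hv hc] at this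
  omega

theorem card_univalent_edgeRoot {t : Sys m e} {v : Finset (Fin e)} (hv : v ∈ t.stars)
    (hc : 3 ≤ v.card) {h : Fin e} (hh : h ∈ v) :
    (t.edgeRoot v h).univalent.card = t.univalent.card + 1 := by
  rw [edgeRoot_eq_expand, Sys.card_univalent_expand Sys.ins_mem_attach
    (ins_singleton_mem_halves hc hh), Sys.card_univalent_attach hv hc]

theorem isRooted_edgeRoot {t : Sys m e} (ht : t.IsUnrooted) {v : Finset (Fin e)}
    (hv : v ∈ t.stars) (hc : 3 ≤ v.card) {h : Fin e} (hh : h ∈ v) : (t.edgeRoot v h).IsRooted := by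
  rw [edgeRoot_eq_expand, Sys.isRooted_expand_iff Sys.ins_mem_attach
    (ins_singleton_mem_halves hc hh), Sys.isRooted_attach_iff hv hc]
  exact ht

theorem mem_internal {t : Sys m e} {v : Finset (Fin e)} :
    v ∈ t.internal ↔ v ∈ t.stars ∧ 3 ≤ v.card := Finset.mem_filter

/-- Contracting the edge `0` merges the trivalent root vertex with its neighbour, after which the
root sits at a vertex of valence at least four and can be removed. -/
theorem exists_edgeRoot {s : Sys m (e + 2)} (hs : s.IsRooted) (h1 : up {0} ∈ s.stars)
    (hl0 : s.label 0 = none) (hl1 : s.label (Fin.succ 0) = none) {h : Fin e}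
    (hA : ins (ins {h}) ∈ s.stars) (hh : up (up {h}) ∉ s.stars) (h0 : {0} ∉ s.stars) :
    ∃ (t : Sys m e) (v w : Finset (Fin e)), t.IsUnrooted ∧ v ∈ t.internal ∧ w ∈ t.internal ∧
      v ≠ w ∧ h ∈ v ∧ h ∈ w ∧ s = t.edgeRoot v h := by
  obtain ⟨y, hy, hyA, h0y, -⟩ := hs.exists_other_end hA (i := 0) (by simp)
  have hcy : 3 ≤ y.card := by
    refine (hs.valence y hy).resolve_left fun hc => ?_
    obtain ⟨a, rfl⟩ := Finset.card_eq_one.1 hc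
    rw [Finset.mem_singleton] at h0y
    exact h0 (h0y ▸ hy)
  obtain ⟨B, rfl⟩ := exists_ins_of_zero_mem h0y
  rw [card_ins] at hcy
  obtain ⟨t₂, hv₂, hh₂, hsd, rfl⟩ := exists_eq_expand hs.toIsTree hl0 hA hy
    (by simpa using hyA.symm) (by simp) (by omega)
  have ht₂ := (Sys.isRooted_expand_iff hv₂ hh₂).1 hs
  have hcard := Sys.card_of_mem_halves hh₂
  have h20 : {0} ∈ t₂.stars := by
    rw [up_singleton, Sys.expand_eq_repl] at h1
    refine (Sys.singleton_succ_mem_repl_iff ?_ fun A hA => zero_mem_of_mem_image_ins hA).1 h1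
    rw [hsd] at hcard
    omega
  obtain ⟨v, hv⟩ := exists_ins_of_zero_mem (A := ins {h} ∪ B) (by simp)
  rw [hv] at hv₂ hh₂ hsd hcard
  rw [hsd] at hcard
  simp only [card_ins, Finset.card_singleton] at hcard
  obtain ⟨t, hvt, rfl⟩ := exists_eq_attach ht₂.toIsTree hl1 h20 hv₂ (by omega)
  have hcv : 3 ≤ v.card := by omega
  have ht := (Sys.isRooted_attach_iff hvt hcv).1 ht₂
  have hhv : h ∈ v := by
    have := (mem_halves.1 hh₂).1
    simpa using this
  obtain ⟨w, hw, hwv, hhw, -⟩ := ht.exists_other_end hvt hhv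
  have heq : (t.attach v).expand (ins {h} ∪ B) {ins {h}, (ins {h} ∪ B) \ ins {h}}
      = t.edgeRoot v h := by
    rw [hv, edgeRoot_eq_expand]
  refine ⟨t, v, w, ht, mem_internal.2 ⟨hvt, hcv⟩, mem_internal.2 ⟨hw, ?_⟩, hwv.symm, hhv, hhw,
    heq⟩
  refine (ht.valence w hw).resolve_left fun hc => hh ?_
  obtain ⟨a, rfl⟩ := Finset.card_eq_one.1 hc
  rw [Finset.mem_singleton] at hhw
  subst hhw
  rw [heq, mem_edgeRoot ⟨h, hhv⟩]
  exact .inl ⟨_, hw, hwv, rfl⟩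

/-- The cases are distinguished by the vertex at the root: valence at least four, trivalent with a
leaf, or trivalent with two internal edges. Only the last one needs a renumbering, to match the
conventions of `edgeRoot`. -/
theorem root_cases {s : Sys m (e + 1)} (hs : s.IsRooted) (h0 : {0} ∈ s.stars)
    (hl : s.label 0 = none) : s.IsLeafBracket ∨
      (∃ (t : Sys m e) (v : Finset (Fin e)), t.IsUnrooted ∧ v ∈ t.internal ∧ s = t.attach v) ∨
      ∃ (e' : ℕ) (t : Sys m e') (v w : Finset (Fin e')) (h : Fin e') (he : e' + 2 = e + 1)
        (σ : Equiv.Perm (Fin (e + 1))), t.IsUnrooted ∧ v ∈ t.internal ∧ w ∈ t.internal ∧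
        v ≠ w ∧ h ∈ v ∧ h ∈ w ∧ s.relabel σ = he ▸ t.edgeRoot v h := by
  obtain ⟨x, hx, hx0, h0x, -⟩ := hs.exists_other_end h0 (i := 0) (by simp)
  have hcx : 3 ≤ x.card := by
    refine (hs.valence x hx).resolve_left fun hc => ?_
    obtain ⟨a, rfl⟩ := Finset.card_eq_one.1 hc
    rw [Finset.mem_singleton] at h0x
    exact hx0 (by rw [h0x])
  obtain ⟨v, rfl⟩ := exists_ins_of_zero_mem h0x
  rw [card_ins] at hcx
  by_cases hc3 : 3 ≤ v.card
  · obtain ⟨t, hv, rfl⟩ := exists_eq_attach hs.toIsTree hl h0 hx (by omega)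
    exact .inr (.inl ⟨t, v, (Sys.isRooted_attach_iff hv hc3).1 hs, mem_internal.2 ⟨hv, hc3⟩, rfl⟩)
  obtain ⟨a, b, hab, rfl⟩ := Finset.card_eq_two.1 (by omega : v.card = 2)
  have hlab : ∀ i : Fin e, {i.succ} ∈ s.stars → s.label i.succ ≠ none := fun i hi hn =>
    Fin.succ_ne_zero _ (hs.root.unique ⟨hi, hn⟩ ⟨h0, hl⟩)
  have hins : ∀ a b : Fin e, ins {a, b} = {0, a.succ, b.succ} := fun a b => by simp [ins, up]
  by_cases ha : {a.succ} ∈ s.stars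
  · refine .inl ⟨0, a.succ, b.succ, (Fin.succ_ne_zero _).symm, (Fin.succ_ne_zero _).symm,
      by simpa using hab, by rwa [← hins], h0, hl, ha, hlab a ha⟩
  by_cases hb : {b.succ} ∈ s.stars
  · refine .inl ⟨0, b.succ, a.succ, (Fin.succ_ne_zero _).symm, (Fin.succ_ne_zero _).symm,
      by simpa using hab.symm, by rwa [← hins, Finset.pair_comm], h0, hl, hb, hlab b hb⟩
  right; right
  obtain ⟨e, rfl⟩ : ∃ e', e = e' + 1 := Nat.exists_eq_succ_of_ne_zero (by
    rintro rfl; exact a.elim0)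
  have h10 : (Fin.succ 0 : Fin (e + 2)) ≠ 0 := Fin.succ_ne_zero _
  -- This moves the root to `1` and one of the two internal edges to `0`, as in `edgeRoot`.
  let σ : Equiv.Perm (Fin (e + 2)) := Equiv.swap 0 (Fin.succ 0) * Equiv.swap (Fin.succ 0) b.succ
  have hσb : σ b.succ = 0 := by simp [σ]
  have hσ0 : σ 0 = Fin.succ 0 := by
    simp only [σ, Equiv.Perm.mul_apply]
    rw [Equiv.swap_apply_of_ne_of_ne (a := Fin.succ 0) h10.symm (Fin.succ_ne_zero b).symm,
      Equiv.swap_apply_left]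
  have hσa : ∃ h : Fin e, σ a.succ = h.succ.succ := by
    have h1 : σ a.succ ≠ 0 := fun h => hab (Fin.succ_injective _ (σ.injective (h.trans hσb.symm)))
    have h2 : σ a.succ ≠ Fin.succ 0 := fun h =>
      Fin.succ_ne_zero _ (σ.injective (h.trans hσ0.symm))
    obtain ⟨i, hi⟩ := Fin.exists_succ_eq.2 h1
    rw [← hi] at h2
    obtain ⟨j, hj⟩ := Fin.exists_succ_eq.2 (fun h => h2 (congrArg Fin.succ h))
    exact ⟨j, by rw [hj, hi]⟩
  obtain ⟨h, hσa⟩ := hσa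
  have g1 : up {0} ∈ (s.relabel σ).stars := by
    rw [up_singleton, ← hσ0]; exact Sys.singleton_mem_relabel.2 h0
  have g2 : (s.relabel σ).label 0 = none := by
    rw [← hσb, Sys.label_relabel]
    by_contra hn
    exact hb (hs.labeled _ hn)
  have g3 : (s.relabel σ).label (Fin.succ 0) = none := by
    rw [← hσ0, Sys.label_relabel]; exact hl
  have g4 : ins (ins {h}) ∈ (s.relabel σ).stars := by
    have h1 := (Sys.image_mem_relabel (σ := σ)).2 hx
    rw [hins] at h1
    simp only [Finset.image_insert, Finset.image_singleton, hσ0, hσa, hσb] at h1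
    convert h1 using 1
    ext i
    simp only [ins, up, Finset.mem_insert, Finset.mem_singleton, Finset.image_insert,
      Finset.image_singleton]
    tauto
  have g5 : up (up {h}) ∉ (s.relabel σ).stars := by
    rw [up_singleton, up_singleton, ← hσa]
    exact fun h => ha (Sys.singleton_mem_relabel.1 h)
  have g6 : {0} ∉ (s.relabel σ).stars := by
    rw [← hσb]
    exact fun h => hb (Sys.singleton_mem_relabel.1 h)
  obtain ⟨t, v, w, ht, hv, hw, hvw, hhv, hhw, heq⟩ :=
    exists_edgeRoot (Sys.isRooted_relabel hs σ) g1 g2 g3 g4 g5 g6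
  exact ⟨e, t, v, w, h, rfl, σ, ht, hv, hw, hvw, hhv, hhw, heq⟩

theorem clsBar_eq_smul (s : Sys m e) (σ : Equiv.Perm (Fin e)) :
    clsBar s = (Equiv.Perm.sign σ : ℤ) • clsBar (s.relabel σ) := by
  rw [clsBar_relabel, sign_smul_sign_smul]

/-- Up to sign, the class of a rooted tree vanishes or is obtained from an unrooted tree by
attaching a root edge to an internal vertex or to an edge between internal vertices. -/
theorem rooted_cases {s : Sys m e} (hs : s.IsRooted) : clsBar s = 0 ∨
      (∃ (e' : ℕ) (t : Sys m e') (v : Finset (Fin e')) (c : ℤ), t.IsUnrooted ∧ v ∈ t.internal ∧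
        t.univalent.card + 1 = s.univalent.card ∧ t.degree + 1 = s.degree ∧
        clsBar s = c • clsBar (t.attach v)) ∨
      ∃ (e' : ℕ) (t : Sys m e') (v w : Finset (Fin e')) (h : Fin e') (c : ℤ), t.IsUnrooted ∧
        v ∈ t.internal ∧ w ∈ t.internal ∧ v ≠ w ∧ h ∈ v ∧ h ∈ w ∧
        t.univalent.card + 1 = s.univalent.card ∧ t.degree = s.degree ∧
        clsBar s = c • clsBar (t.edgeRoot v h) := by
  obtain ⟨r, ⟨hr, hrl⟩, -⟩ := hs.root
  obtain ⟨e, rfl⟩ : ∃ e', e = e' + 1 := Nat.exists_eq_succ_of_ne_zero (by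
    rintro rfl; exact r.elim0)
  have hsw : Equiv.swap 0 r r = 0 := Equiv.swap_apply_right _ _
  rw [clsBar_eq_smul s (Equiv.swap 0 r), ← Sys.card_univalent_relabel s (Equiv.swap 0 r),
    ← degree_relabel s (Equiv.swap 0 r)]
  have h1 : {0} ∈ (s.relabel (Equiv.swap 0 r)).stars := by
    have := (Sys.singleton_mem_relabel (σ := Equiv.swap 0 r)).2 hr
    rwa [hsw] at this
  have h2 : (s.relabel (Equiv.swap 0 r)).label 0 = none := by
    have := Sys.label_relabel s (Equiv.swap 0 r) r
    rwa [hsw, hrl] at this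
  rcases root_cases (Sys.isRooted_relabel hs _) h1 h2 with h | h | h
  · left; rw [clsBar_eq_zero h, smul_zero]
  · right; left
    obtain ⟨t, v, ht, hv, h⟩ := h
    rw [h]
    obtain ⟨hv', hc⟩ := mem_internal.1 hv
    exact ⟨e, t, v, _, ht, hv, (Sys.card_univalent_attach hv' hc).symm,
      (Sys.degree_attach hv' hc).symm, rfl⟩
  · right; right
    obtain ⟨e', t, v, w, h, he, σ, ht, hv, hw, hvw, hhv, hhw, h'⟩ := h
    obtain rfl : e = e' + 1 := by omega
    obtain ⟨hv', hc⟩ := mem_internal.1 hv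
    rw [clsBar_eq_smul (s.relabel _) σ, ← Sys.card_univalent_relabel (s.relabel _) σ,
      ← degree_relabel (s.relabel _) σ, h', smul_smul]
    exact ⟨e', t, v, w, h, _, ht, hv, hw, hvw, hhv, hhw,
      (card_univalent_edgeRoot hv' hc hhv).symm, (degree_edgeRoot hv' hc hhv).symm, rfl⟩

/-! ### The two sides of an edge -/

namespace Sys

/-- Two vertices share an edge other than `h`. -/
def AdjAvoid (t : Sys m e) (h : Fin e) (u w : Finset (Fin e)) : Prop :=
  u ∈ t.stars ∧ w ∈ t.stars ∧ ∃ i, i ≠ h ∧ i ∈ u ∧ i ∈ w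

open Classical in
/-- The vertices that can be reached from `v` without crossing the edge `h`. -/
noncomputable def side (t : Sys m e) (h : Fin e) (v : Finset (Fin e)) : Finset (Finset (Fin e)) :=
  t.stars.filter (Relation.ReflTransGen (t.AdjAvoid h) v)

variable {t : Sys m e} {h : Fin e} {u v w x y : Finset (Fin e)}

theorem mem_side : x ∈ t.side h v ↔ x ∈ t.stars ∧ Relation.ReflTransGen (t.AdjAvoid h) v x := by
  classical
  simp [side]

theorem side_subset : t.side h v ⊆ t.stars := fun _ hx => (mem_side.1 hx).1

theorem self_mem_side (hv : v ∈ t.stars) : v ∈ t.side h v :=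
  mem_side.2 ⟨hv, Relation.ReflTransGen.refl⟩

theorem mem_side_of_adj (hx : x ∈ t.side h v) (hy : y ∈ t.stars) {i : Fin e} (hi : i ≠ h)
    (hix : i ∈ x) (hiy : i ∈ y) : y ∈ t.side h v :=
  mem_side.2 ⟨hy, (mem_side.1 hx).2.tail ⟨side_subset hx, hy, i, hi, hix, hiy⟩⟩

theorem side_induction {p : Finset (Fin e) → Prop} (hv : v ∈ t.stars) (hpv : p v)
    (hp : ∀ x ∈ t.side h v, p x → ∀ y ∈ t.side h v, ∀ i, i ≠ h → i ∈ x → i ∈ y → p y) :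
    ∀ x ∈ t.side h v, p x := by
  intro x hx
  have := (mem_side.1 hx).2
  clear hx
  suffices hs : x ∈ t.side h v ∧ p x from hs.2
  induction this with
  | refl => exact ⟨self_mem_side hv, hpv⟩
  | tail _ hadj ih =>
    obtain ⟨h1, h2, i, hi, hix, hiy⟩ := hadj
    have hy := mem_side_of_adj ih.1 h2 hi hix hiy
    exact ⟨hy, hp _ ih.1 ih.2 _ hy i hi hix hiy⟩

/-- Every edge of a tree is a bridge. A path avoiding `h` avoids the graph edge between `v` and `w`,
because `h` is the only number these vertices share. -/
theorem IsTree.notMem_side (ht : t.IsTree) (hv : v ∈ t.stars) (hw : w ∈ t.stars) (hvw : v ≠ w)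
    (hhv : h ∈ v) (hhw : h ∈ w) : w ∉ t.side h v := by
  intro hws
  have hadj : t.graph.Adj ⟨v, hv⟩ ⟨w, hw⟩ :=
    ⟨fun h => hvw (congrArg Subtype.val h), Finset.not_disjoint_iff.2 ⟨h, hhv, hhw⟩⟩
  have hb := SimpleGraph.isAcyclic_iff_forall_adj_isBridge.1 ht.isTree.isAcyclic hadj
  rw [SimpleGraph.isBridge_iff] at hb
  refine hb ?_
  have := side_induction (t := t) (h := h) (v := v) (p := fun x => ∀ hx : x ∈ t.stars,
    (t.graph \ SimpleGraph.fromEdgeSet {s(⟨v, hv⟩, ⟨w, hw⟩)}).Reachable ⟨v, hv⟩ ⟨x, hx⟩) hv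
    (fun _ => SimpleGraph.Reachable.refl _) ?_ w hws hw
  · exact this
  · intro x hx hpx y hy i hi hix hiy hy'
    by_cases hxy : x = y
    · subst hxy; exact hpx hy'
    · refine (hpx (side_subset hx)).trans (SimpleGraph.Adj.reachable ?_)
      rw [SimpleGraph.sdiff_adj]
      refine ⟨⟨fun h => hxy (congrArg Subtype.val h), Finset.not_disjoint_iff.2 ⟨i, hix, hiy⟩⟩, ?_⟩
      rw [SimpleGraph.fromEdgeSet_adj]
      rintro ⟨hm, -⟩
      rw [Set.mem_singleton_iff, Sym2.eq_iff] at hm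
      simp only [Subtype.mk.injEq] at hm
      rcases hm with ⟨rfl, rfl⟩ | ⟨rfl, rfl⟩
      · exact hi (ht.eq_of_mem_mem hv hw hvw hix hiy hhv hhw)
      · exact hi (ht.eq_of_mem_mem hw hv hvw.symm hix hiy hhw hhv)

theorem IsTree.ends (ht : t.IsTree) (hv : v ∈ t.stars) (hw : w ∈ t.stars) (hvw : v ≠ w)
    (hhv : h ∈ v) (hhw : h ∈ w) : ∀ x ∈ t.stars, h ∈ x → x = v ∨ x = w := by
  obtain ⟨w', -, -, -, hw'⟩ := ht.exists_other_end hv hhv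
  rcases hw' w hw hhw with rfl | rfl
  · exact absurd rfl hvw
  · exact hw'

/-- Removing an edge leaves two components: disjointness comes from the bridge property, exhaustion
from connectedness. -/
theorem IsTree.side_eq_sdiff (ht : t.IsTree) (hv : v ∈ t.stars) (hw : w ∈ t.stars) (hvw : v ≠ w)
    (hhv : h ∈ v) (hhw : h ∈ w) : t.side h w = t.stars \ t.side h v := by
  have hends := ht.ends hv hw hvw hhv hhw
  ext x
  rw [Finset.mem_sdiff]
  constructor
  · intro hx
    refine ⟨side_subset hx, side_induction (p := fun x => x ∉ t.side h v) hw
      (ht.notMem_side hv hw hvw hhv hhw) (fun x hx hpx y hy i hi hix hiy hys => ?_) x hx⟩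
    exact hpx (mem_side_of_adj hys (side_subset hx) hi hiy hix)
  · rintro ⟨hx, hxv⟩
    refine (ht.conn (fun x => x ∈ t.side h v ∨ x ∈ t.side h w) ⟨v, hv, .inl (self_mem_side hv)⟩
      (fun a ha hpa b hb i hia hib => ?_) x hx).resolve_left hxv
    by_cases hi : i = h
    · subst hi
      rcases hends b hb hib with rfl | rfl
      · exact .inl (self_mem_side hb)
      · exact .inr (self_mem_side hb)
    · exact hpa.imp (fun h => mem_side_of_adj h hb hi hia hib)
        (fun h => mem_side_of_adj h hb hi hia hib)

/-- The vertices beyond the edge `h`, seen from its end `v`. -/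
noncomputable def far (t : Sys m e) (v : Finset (Fin e)) (h : Fin e) : Finset (Finset (Fin e)) :=
  t.stars \ t.side h v

theorem far_subset : t.far v h ⊆ t.stars := Finset.sdiff_subset

theorem IsTree.far_eq_side (ht : t.IsTree) (hv : v ∈ t.stars) (hw : w ∈ t.stars) (hvw : v ≠ w)
    (hhv : h ∈ v) (hhw : h ∈ w) : t.far v h = t.side h w :=
  (ht.side_eq_sdiff hv hw hvw hhv hhw).symm

/-- The branches at `v` along different edges are separated by `v`: a path staying in the branch of
`h'` never crosses `h`. -/
theorem IsTree.far_subset_side (ht : t.IsTree) (hv : v ∈ t.stars) (hhv : h ∈ v) {h' : Fin e}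
    (hhv' : h' ∈ v) (hne : h' ≠ h) : t.far v h' ⊆ t.side h v := by
  obtain ⟨w', hw', hwv', hhw', -⟩ := ht.exists_other_end hv hhv'
  obtain ⟨w, hw, hwv, hhw, hends⟩ := ht.exists_other_end hv hhv
  rw [ht.far_eq_side hv hw' hwv'.symm hhv' hhw']
  have hvn := ht.notMem_side hw' hv hwv' hhw' hhv'
  refine side_induction hw' (mem_side_of_adj (self_mem_side hv) hw' hne hhv' hhw') ?_
  intro x hx hpx y hy i hi hix hiy
  by_cases hih : i = h
  · subst hih
    rcases hends x (side_subset hx) hix with rfl | rfl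
    · exact absurd hx hvn
    rcases hends y (side_subset hy) hiy with rfl | rfl
    · exact absurd hy hvn
    exact hpx
  · exact mem_side_of_adj hpx (side_subset hy) hih hix hiy

/-- The branch gets smaller as one moves away from `v`; this drives the induction that pushes the
root outwards. -/
theorem IsTree.far_ssubset_far (ht : t.IsTree) (hv : v ∈ t.stars) (hw : w ∈ t.stars)
    (hvw : v ≠ w) (hhv : h ∈ v) (hhw : h ∈ w) {h' : Fin e} (hhw' : h' ∈ w) (hne : h' ≠ h) :
    t.far w h' ⊂ t.far v h := by
  rw [ht.far_eq_side hv hw hvw hhv hhw, Finset.ssubset_iff_of_subset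
    (ht.far_subset_side hw hhw hhw' hne)]
  exact ⟨w, self_mem_side hw, fun h => (Finset.mem_sdiff.1 h).2 (self_mem_side hw)⟩

/-- Every vertex other than `v` lies in the branch of some edge at `v`. The branches are disjoint,
so sums over them add up to the sum over all vertices but `v`. -/
theorem IsTree.erase_eq_biUnion_far (ht : t.IsTree) (hv : v ∈ t.stars) :
    t.stars.erase v = v.biUnion (t.far v) := by
  ext x
  rw [Finset.mem_erase, Finset.mem_biUnion]
  constructor
  · rintro ⟨hxv, hx⟩
    refine (ht.conn (fun x => x = v ∨ ∃ h ∈ v, x ∈ t.far v h) ⟨v, hv, .inl rfl⟩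
      (fun a ha hpa b hb i hia hib => ?_) x hx).resolve_left hxv
    by_cases hbv : b = v
    · exact .inl hbv
    right
    rcases hpa with rfl | ⟨h, hh, hpa⟩
    · exact ⟨i, hia, by
        rw [ht.far_eq_side hv hb (Ne.symm hbv) hia hib]; exact self_mem_side hb⟩
    · obtain ⟨w, hw, hwv, hhw, hends⟩ := ht.exists_other_end hv hh
      refine ⟨h, hh, ?_⟩
      rw [ht.far_eq_side hv hw hwv.symm hh hhw] at hpa ⊢
      by_cases hih : i = h
      · subst hih
        rcases hends b hb hib with rfl | rfl
        · exact absurd rfl hbv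
        · exact self_mem_side hb
      · exact mem_side_of_adj hpa hb hih hia hib
  · rintro ⟨h, hh, hx⟩
    refine ⟨?_, far_subset hx⟩
    rintro rfl
    exact (Finset.mem_sdiff.1 hx).2 (self_mem_side hv)

theorem IsTree.sum_far {M : Type*} [AddCommMonoid M] (ht : t.IsTree) (hv : v ∈ t.stars)
    (F : Finset (Fin e) → M) : ∑ h ∈ v, ∑ x ∈ t.far v h, F x = ∑ x ∈ t.stars.erase v, F x := by
  rw [ht.erase_eq_biUnion_far hv, Finset.sum_biUnion]
  intro h hh h' hh' hne
  rw [Function.onFun, Finset.disjoint_left]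
  intro x hx hx'
  exact (Finset.mem_sdiff.1 hx).2 (ht.far_subset_side hv hh hh' (Ne.symm hne) hx')

theorem IsTree.sum_far_add_sum_far {M : Type*} [AddCommMonoid M] (ht : t.IsTree)
    (hv : v ∈ t.stars) (hw : w ∈ t.stars) (hvw : v ≠ w) (hhv : h ∈ v) (hhw : h ∈ w)
    (F : Finset (Fin e) → M) :
    ∑ x ∈ t.far v h, F x + ∑ x ∈ t.far w h, F x = ∑ x ∈ t.stars, F x := by
  rw [ht.far_eq_side hw hv hvw.symm hhw hhv]
  exact Finset.sum_sdiff side_subset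

theorem side_relabel (t : Sys m e) (σ : Equiv.Perm (Fin e)) (h : Fin e) (v : Finset (Fin e)) :
    (t.relabel σ).side (σ h) (v.image σ) = (t.side h v).image (fun x => x.image σ) := by
  have key : ∀ (t : Sys m e) (σ : Equiv.Perm (Fin e)) (h : Fin e) (v x : Finset (Fin e)),
      x ∈ t.side h v → x.image σ ∈ (t.relabel σ).side (σ h) (v.image σ) := by
    intro t σ h v x hx
    obtain ⟨hx, hr⟩ := mem_side.1 hx
    refine mem_side.2 ⟨image_mem_relabel.2 hx, ?_⟩
    refine Relation.ReflTransGen.lift (fun x => x.image σ) ?_ _ _ hr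
    rintro a b ⟨ha, hb, i, hi, hia, hib⟩
    exact ⟨image_mem_relabel.2 ha, image_mem_relabel.2 hb, σ i, by simpa using hi,
      Finset.mem_image_of_mem _ hia, Finset.mem_image_of_mem _ hib⟩
  have hinv : ∀ x : Finset (Fin e), (x.image σ).image (σ⁻¹ : Equiv.Perm (Fin e)) = x := fun x => by
    simp [Finset.image_image, Function.comp_def]
  ext x
  rw [Finset.mem_image]
  constructor
  · intro hx
    obtain ⟨y, hy, rfl⟩ := mem_relabel.1 (side_subset hx)
    have := key _ σ⁻¹ _ _ _ hx
    rw [hinv, hinv, relabel_inv_relabel,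
      show σ⁻¹ (σ h) = h from σ.symm_apply_apply h] at this
    exact ⟨y, this, rfl⟩
  · rintro ⟨y, hy, rfl⟩
    exact key _ _ _ _ _ hy

theorem far_relabel (t : Sys m e) (σ : Equiv.Perm (Fin e)) (h : Fin e) (v : Finset (Fin e)) :
    (t.relabel σ).far (v.image σ) (σ h) = (t.far v h).image (fun x => x.image σ) := by
  rw [far, side_relabel, far, Finset.image_sdiff _ _ (image_inj σ)]
  rfl

end Sys
/-! ### Recovering the tree from the tree with a root edge -/

theorem image_up_upPerm (τ : Equiv.Perm (Fin e)) (v : Finset (Fin e)) :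
    (up v).image (upPerm τ) = up (v.image τ) := (up_image τ v).symm

theorem image_ins_upPerm (τ : Equiv.Perm (Fin e)) (v : Finset (Fin e)) :
    (ins v).image (upPerm τ) = ins (v.image τ) := image_insert_up τ v

theorem eq_relabel {t t₂ : Sys m e} {τ : Equiv.Perm (Fin e)}
    (hs : ∀ x, x.image τ ∈ t₂.stars ↔ x ∈ t.stars) (hl : ∀ i, t₂.label (τ i) = t.label i) :
    t₂ = t.relabel τ := by
  ext1
  · ext y
    obtain ⟨x, rfl⟩ : ∃ x : Finset (Fin e), x.image τ = y :=
      ⟨y.image τ.symm, by simp [Finset.image_image, Function.comp_def]⟩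
    rw [hs, Sys.image_mem_relabel]
  · funext i
    obtain ⟨i, rfl⟩ := τ.surjective i
    rw [hl, Sys.label_relabel]

theorem up_mem_attach {t : Sys m e} {v x : Finset (Fin e)} :
    up x ∈ (t.attach v).stars ↔ x ∈ t.stars ∧ x ≠ v := by
  rw [Sys.attach_eq_repl, Sys.mem_repl]
  constructor
  · rintro (⟨w, hw, hwv, h⟩ | h)
    · rw [up_inj] at h; exact h ▸ ⟨hw, hwv⟩
    · exact absurd (Sys.zero_mem_attach_pair h) zero_notMem_up
  · exact fun h => .inl ⟨x, h.1, h.2, rfl⟩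

theorem eq_of_zero_mem_attach {t : Sys m e} {v : Finset (Fin e)} {x : Finset (Fin (e + 1))}
    (hx : x ∈ (t.attach v).stars) (h0 : 0 ∈ x) : x = ins v ∨ x = {0} := by
  rw [Sys.attach_eq_repl, Sys.mem_repl] at hx
  rcases hx with ⟨w, -, -, rfl⟩ | h
  · exact absurd h0 zero_notMem_up
  · simpa using h

/-- The root is the only unlabeled leaf, so an isomorphism preserves the number `0`, and then also
the vertex at which the root is attached. Hence `t` is determined by `t.attach v` together with its
orientation. -/
theorem attach_relabel_inj {t t₂ : Sys m e} (ht₂ : t₂.IsUnrooted)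
    {v v₂ : Finset (Fin e)} (hv : v ∈ t.internal) (hv₂ : v₂ ∈ t₂.internal)
    {σ : Equiv.Perm (Fin (e + 1))} (hσ : t₂.attach v₂ = (t.attach v).relabel σ) :
    ∃ τ, σ = upPerm τ ∧ t₂ = t.relabel τ ∧ v₂ = v.image τ := by
  obtain ⟨hv, hc⟩ := mem_internal.1 hv
  obtain ⟨hv₂, hc₂⟩ := mem_internal.1 hv₂
  have hroot := ((Sys.isRooted_attach_iff hv₂ hc₂).2 ht₂).root
  have h0 : σ 0 = 0 := by
    refine hroot.unique ⟨?_, ?_⟩ ⟨Sys.singleton_zero_mem_attach, rfl⟩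
    · rw [hσ, Sys.singleton_mem_relabel]; exact Sys.singleton_zero_mem_attach
    · rw [hσ, Sys.label_relabel]; rfl
  obtain ⟨τ, rfl⟩ := exists_upPerm h0
  have hvv : v₂ = v.image τ := by
    have h1 : ins (v.image τ) ∈ (t₂.attach v₂).stars := by
      rw [hσ, ← image_ins_upPerm, Sys.image_mem_relabel]
      exact Sys.ins_mem_attach
    rcases eq_of_zero_mem_attach h1 zero_mem_ins with h | h
    · exact (ins_injective h).symm
    · rw [← ins_empty, ins_inj, Finset.image_eq_empty] at h
      simp [h] at hc
  refine ⟨τ, rfl, eq_relabel (fun x => ?_) (fun i => ?_), hvv⟩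
  · by_cases hx : x = v
    · subst hx; rw [← hvv]; exact iff_of_true hv₂ hv
    · have h1 : up (x.image τ) ∈ (t₂.attach v₂).stars ↔ up x ∈ (t.attach v).stars := by
        rw [hσ, ← image_up_upPerm, Sys.image_mem_relabel]
      rw [up_mem_attach, up_mem_attach, hvv] at h1
      simpa [hx, (image_inj τ).eq_iff] using h1
  · have := Sys.label_relabel (t.attach v) (upPerm τ) i.succ
    rw [← hσ, upPerm_succ] at this
    exact this

theorem up_up_mem_edgeRoot {t : Sys m e} {v x : Finset (Fin e)} (hv : v.Nonempty) {h : Fin e} :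
    up (up x) ∈ (t.edgeRoot v h).stars ↔ x ∈ t.stars ∧ x ≠ v := by
  rw [mem_edgeRoot hv]
  constructor
  · rintro (⟨w, hw, hwv, h⟩ | h | h | h)
    · rw [up_inj, up_inj] at h; exact h ▸ ⟨hw, hwv⟩
    · rw [up_inj, ← ins_empty] at h; exact absurd h up_ne_ins
    · exact absurd h up_ne_ins
    · exact absurd h up_ne_ins
  · exact fun h => .inl ⟨x, h.1, h.2, rfl⟩

theorem ins_ins_mem_edgeRoot {t : Sys m e} {v x : Finset (Fin e)} (hv : v.Nonempty) {h : Fin e} :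
    ins (ins x) ∈ (t.edgeRoot v h).stars ↔ x = {h} := by
  rw [mem_edgeRoot hv]
  simp

theorem ins_up_mem_edgeRoot {t : Sys m e} {v x : Finset (Fin e)} (hv : v.Nonempty) {h : Fin e} :
    ins (up x) ∈ (t.edgeRoot v h).stars ↔ x = v \ {h} := by
  rw [mem_edgeRoot hv]
  simp

theorem eq_ins_ins_of_one_mem {t : Sys m e} {v : Finset (Fin e)} {x : Finset (Fin (e + 2))}
    (hv : v.Nonempty) {h : Fin e} (hx : x ∈ (t.edgeRoot v h).stars) (h1 : Fin.succ 0 ∈ x)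
    (hc : x.card = 3) : x = ins (ins {h}) := by
  rw [mem_edgeRoot hv] at hx
  rcases hx with ⟨w, -, -, rfl⟩ | rfl | rfl | rfl
  · rw [succ_mem_up] at h1; simp at h1
  · simp at hc
  · rfl
  · rw [succ_mem_ins] at h1; simp at h1

/-- A tree `t` with an edge `h` joining the internal vertices `v` and `w`. -/
structure Sys.IsFlag (t : Sys m e) (v w : Finset (Fin e)) (h : Fin e) : Prop where
  left : v ∈ t.internal
  right : w ∈ t.internal
  ne : v ≠ w
  mem_left : h ∈ v
  mem_right : h ∈ w

theorem Sys.IsFlag.symm {t : Sys m e} {v w : Finset (Fin e)} {h : Fin e} (hf : t.IsFlag v w h) :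
    t.IsFlag w v h :=
  ⟨hf.right, hf.left, hf.ne.symm, hf.mem_right, hf.mem_left⟩

theorem Sys.IsFlag.label_eq_none {t : Sys m e} (ht : t.IsUnrooted) {v w : Finset (Fin e)}
    {h : Fin e} (hf : t.IsFlag v w h) : t.label h = none :=
  ht.label_eq_none (mem_internal.1 hf.left).1 (mem_internal.1 hf.right).1 hf.ne hf.mem_left
    hf.mem_right (mem_internal.1 hf.left).2 (mem_internal.1 hf.right).2

theorem edgeRoot_root {t : Sys m e} (ht : t.IsUnrooted) {v w : Finset (Fin e)} {h : Fin e}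
    (hf : t.IsFlag v w h) {r : Fin (e + 2)} (hr : {r} ∈ (t.edgeRoot v h).stars)
    (hl : (t.edgeRoot v h).label r = none) : r = Fin.succ 0 := by
  obtain ⟨hv, hc⟩ := mem_internal.1 hf.left
  refine (isRooted_edgeRoot ht hv hc hf.mem_left).root.unique ⟨hr, hl⟩ ⟨?_, rfl⟩
  rw [mem_edgeRoot ⟨h, hf.mem_left⟩, up_singleton]
  exact .inr (.inl rfl)

theorem singleton_one_mem_edgeRoot {t : Sys m e} {v : Finset (Fin e)} (hv : v.Nonempty)
    {h : Fin e} : {Fin.succ 0} ∈ (t.edgeRoot v h).stars := by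
  rw [mem_edgeRoot hv, up_singleton]
  exact .inr (.inl rfl)

/-- The number `1` is fixed because it belongs to the root. The condition `σ 0 = 0` selects the
isomorphisms that respect the chosen end of the subdivided edge. -/
theorem edgeRoot_relabel_inj {t t₂ : Sys m e} (ht₂ : t₂.IsUnrooted) {v w v₂ w₂ : Finset (Fin e)}
    {h h₂ : Fin e} (hf : t.IsFlag v w h) (hf₂ : t₂.IsFlag v₂ w₂ h₂)
    {σ : Equiv.Perm (Fin (e + 2))} (hσ : t₂.edgeRoot v₂ h₂ = (t.edgeRoot v h).relabel σ)
    (h0 : σ 0 = 0) :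
    ∃ τ, σ = upPerm (upPerm τ) ∧ t₂ = t.relabel τ ∧ v₂ = v.image τ ∧ h₂ = τ h := by
  have hne : v.Nonempty := ⟨h, hf.mem_left⟩
  have hne₂ : v₂.Nonempty := ⟨h₂, hf₂.mem_left⟩
  have h1 : σ (Fin.succ 0) = Fin.succ 0 := by
    refine edgeRoot_root ht₂ hf₂ ?_ ?_
    · rw [hσ, Sys.singleton_mem_relabel]; exact singleton_one_mem_edgeRoot hne
    · rw [hσ, Sys.label_relabel]; rfl
  obtain ⟨σ, rfl⟩ := exists_upPerm h0
  rw [upPerm_succ, Fin.succ_inj] at h1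
  obtain ⟨τ, rfl⟩ := exists_upPerm h1
  have hh : h₂ = τ h := by
    have h1 : ins (ins {τ h}) ∈ (t₂.edgeRoot v₂ h₂).stars := by
      rw [hσ, ← Finset.image_singleton, ← image_ins_upPerm, ← image_ins_upPerm,
        Sys.image_mem_relabel, ins_ins_mem_edgeRoot hne]
    rw [ins_ins_mem_edgeRoot hne₂] at h1
    exact (Finset.singleton_injective h1).symm
  have hvv : v₂ = v.image τ := by
    have h1 : ins (up ((v \ {h}).image τ)) ∈ (t₂.edgeRoot v₂ h₂).stars := by
      rw [hσ, ← image_up_upPerm, ← image_ins_upPerm, Sys.image_mem_relabel,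
        ins_up_mem_edgeRoot hne]
    rw [ins_up_mem_edgeRoot hne₂] at h1
    rw [← Finset.insert_erase hf₂.mem_left, ← Finset.insert_erase hf.mem_left,
      Finset.erase_eq, Finset.erase_eq, Finset.image_insert, h1, hh]
  refine ⟨τ, rfl, eq_relabel (fun x => ?_) (fun i => ?_), hvv, hh⟩
  · by_cases hx : x = v
    · subst hx; rw [← hvv]
      exact iff_of_true (mem_internal.1 hf₂.left).1 (mem_internal.1 hf.left).1
    · have h1 : up (up (x.image τ)) ∈ (t₂.edgeRoot v₂ h₂).stars ↔
          up (up x) ∈ (t.edgeRoot v h).stars := by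
        rw [hσ, ← image_up_upPerm, ← image_up_upPerm, Sys.image_mem_relabel]
      rw [up_up_mem_edgeRoot hne₂, up_up_mem_edgeRoot hne, hvv] at h1
      simpa [hx, (image_inj τ).eq_iff] using h1
  · have := Sys.label_relabel (t.edgeRoot v h) (upPerm (upPerm τ)) i.succ.succ
    rw [← hσ, upPerm_succ, upPerm_succ] at this
    exact this

theorem not_isLeafBracket_edgeRoot {t : Sys m e} (ht : t.IsUnrooted) {v w : Finset (Fin e)}
    {h : Fin e} (hf : t.IsFlag v w h) : ¬ (t.edgeRoot v h).IsLeafBracket := by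
  rintro ⟨r, a, b, hra, hrb, hab, h3, hr, hrl, ha, hal⟩
  obtain rfl := edgeRoot_root ht hf hr hrl
  have h4 := eq_ins_ins_of_one_mem ⟨h, hf.mem_left⟩ h3 (by simp)
    (Finset.card_eq_three.2 ⟨_, _, _, hra, hrb, hab, rfl⟩)
  have ha' : a ∈ ins (ins {h}) := h4 ▸ (by simp)
  refine hal ?_
  clear h4 h3 hra hrb ha hal hab
  induction a using Fin.cases with
  | zero => rfl
  | succ a =>
    induction a using Fin.cases with
    | zero => rfl
    | succ a =>
      rw [succ_mem_ins, succ_mem_ins, Finset.mem_singleton] at ha'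
      subst ha'
      exact hf.label_eq_none ht

/-- The root ends at a vertex of valence at least four in the first tree and at a trivalent one in
the second. -/
theorem attach_relabel_ne_edgeRoot {t' : Sys m (e + 1)} {v' : Finset (Fin (e + 1))} (hv' : v' ∈ t'.internal)
    {t : Sys m e} (ht : t.IsUnrooted) {v w : Finset (Fin e)} {h : Fin e} (hf : t.IsFlag v w h)
    (σ : Equiv.Perm (Fin (e + 2))) : (t'.attach v').relabel σ ≠ t.edgeRoot v h := by
  intro hσ
  have hne : v.Nonempty := ⟨h, hf.mem_left⟩
  have h1 : σ 0 = Fin.succ 0 := by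
    refine edgeRoot_root ht hf ?_ ?_
    · rw [← hσ, Sys.singleton_mem_relabel]; exact Sys.singleton_zero_mem_attach
    · rw [← hσ, Sys.label_relabel]; rfl
  have h2 := (ins_ins_mem_edgeRoot (t := t) hne (h := h)).2 rfl
  rw [← hσ] at h2
  obtain ⟨y, hy, hyσ⟩ := Sys.mem_relabel.1 h2
  have h0y : 0 ∈ y := by
    have : σ 0 ∈ y.image σ := by rw [hyσ, h1]; exact succ_mem_ins.2 zero_mem_ins
    simpa using this
  have hc : y.card = 3 := by
    rw [← Finset.card_image_of_injective y σ.injective, hyσ]; simp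
  rcases eq_of_zero_mem_attach hy h0y with rfl | rfl
  · rw [card_ins] at hc
    have := (mem_internal.1 hv').2
    omega
  · simp at hc

/-! ### Splitting off the root edge -/

/-- The sum over attaching the root edge to the internal vertices beyond `h`. -/
noncomputable def farSum (t : Sys m e) (v : Finset (Fin e)) (h : Fin e) : ChainsBar m :=
  ∑ x ∈ t.far v h, if 3 ≤ x.card then clsBar (t.attach x) else 0

theorem farSum_relabel (t : Sys m e) (τ : Equiv.Perm (Fin e)) (v : Finset (Fin e)) (h : Fin e) :
    farSum (t.relabel τ) (v.image τ) (τ h) = (Equiv.Perm.sign τ : ℤ) • farSum t v h := by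
  rw [farSum, Sys.far_relabel, Finset.sum_image fun _ _ _ _ h => image_inj τ h, farSum,
    Finset.smul_sum]
  refine Finset.sum_congr rfl fun x _ => ?_
  rw [Finset.card_image_of_injective _ τ.injective, attach_relabel, clsBar_relabel, sign_upPerm]
  split_ifs
  · rfl
  · rw [smul_zero]

theorem sum_stars_attach {t : Sys m e} :
    (∑ x ∈ t.stars, if 3 ≤ x.card then clsBar (t.attach x) else 0)
      = ((-1 : ℤ) ^ t.degree) • attachRoot m (cls t) := by
  rw [attachRoot_cls, smul_smul, ← mul_pow, neg_one_mul, neg_neg, one_pow, one_smul, Sys.internal,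
    Finset.sum_filter]

theorem cls_mem_unrootedChains {k d : ℕ} {t : Sys m e} (ht : t.IsUnrooted)
    (hk : t.univalent.card = k) (hd : t.degree = d) : cls t ∈ unrootedChains m k d :=
  AddSubgroup.subset_closure ⟨e, t, ht, hk, hd, rfl⟩

/-- The quotient of the group of rooted trees by the image of the unrooted trees. -/
abbrev RootQuotient (m k d : ℕ) := ChainsBar m ⧸ (unrootedChains m k d).map (attachRoot m)

/-- The vertices beyond `h` seen from its two ends are complementary, so the two sums add up to η(t)
up to sign. This is why the target is the quotient by the image of η. -/
theorem mk_farSum_symm {k d : ℕ} {t : Sys m e} (ht : t.IsUnrooted) (hk : t.univalent.card = k)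
    (hd : t.degree = d) {v w : Finset (Fin e)} {h : Fin e} (hf : t.IsFlag v w h) :
    (QuotientAddGroup.mk (farSum t v h) : RootQuotient m k d)
      = - QuotientAddGroup.mk (farSum t w h) := by
  rw [eq_neg_iff_add_eq_zero, ← QuotientAddGroup.mk_add, QuotientAddGroup.eq_zero_iff, farSum, farSum,
    ht.toIsTree.sum_far_add_sum_far (mem_internal.1 hf.left).1 (mem_internal.1 hf.right).1 hf.ne
      hf.mem_left hf.mem_right, sum_stars_attach]
  exact zsmul_mem (AddSubgroup.mem_map_of_mem _ (cls_mem_unrootedChains ht hk hd)) _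

/-- The values of `splitRoot` on trees with a root edge attached to an edge. -/
inductive FlagRel (m k d : ℕ) : ∀ e, Sys m e → RootQuotient m k d → Prop
  | mk {e : ℕ} (t : Sys m e) (v w : Finset (Fin e)) (h : Fin e) (ht : t.IsUnrooted)
      (hk : t.univalent.card = k) (hd : t.degree = d) (hf : t.IsFlag v w h) :
      FlagRel m k d (e + 2) (t.edgeRoot v h) (QuotientAddGroup.mk (farSum t v h))

theorem neg_neg_one_mul_smul {A : Type*} [AddCommGroup A] (s : ℤˣ) (a : A) :
    -(((-1 * s : ℤˣ) : ℤ) • a) = (s : ℤ) • a := by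
  simp

/-- An isomorphism of two such trees either preserves the half-edge numbered `0` or exchanges the
halves of the subdivided edge. The second case is reduced to the first by composing with that
exchange. -/
theorem flagRel_relabel {k d : ℕ} (e : ℕ) (s : Sys m e) (σ : Equiv.Perm (Fin e))
    (a b : RootQuotient m k d) (ha : FlagRel m k d e s a) (hb : FlagRel m k d e (s.relabel σ) b) :
    b = (Equiv.Perm.sign σ : ℤ) • a := by
  obtain ⟨t, v, w, h, ht, hk, hd, hf⟩ := ha
  generalize hs : (t.edgeRoot v h).relabel σ = s₂ at hb
  obtain ⟨t₂, v₂, w₂, h₂, ht₂, hk₂, hd₂, hf₂⟩ := hb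
  have main : ∀ (v₂ w₂ : Finset _) (σ : Equiv.Perm _), t₂.IsFlag v₂ w₂ h₂ →
      (t.edgeRoot v h).relabel σ = t₂.edgeRoot v₂ h₂ → σ 0 = 0 →
      (QuotientAddGroup.mk (farSum t₂ v₂ h₂) : RootQuotient m k d)
        = (Equiv.Perm.sign σ : ℤ) • QuotientAddGroup.mk (farSum t v h) := by
    intro v₂ w₂ σ hf₂ hs h0
    obtain ⟨τ, rfl, rfl, rfl, rfl⟩ := edgeRoot_relabel_inj ht₂ hf hf₂ hs.symm h0
    rw [farSum_relabel, sign_upPerm, sign_upPerm, QuotientAddGroup.mk_zsmul]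
  by_cases h0 : σ 0 = 0
  · exact main v₂ w₂ σ hf₂ hs h0
  · have hne : v.Nonempty := ⟨h, hf.mem_left⟩
    have hne₂ : v₂.Nonempty := ⟨h₂, hf₂.mem_left⟩
    have h1 : σ (Fin.succ 0) = Fin.succ 0 := by
      refine edgeRoot_root ht₂ hf₂ ?_ ?_
      · rw [← hs, Sys.singleton_mem_relabel]; exact singleton_one_mem_edgeRoot hne
      · rw [← hs, Sys.label_relabel]; rfl
    -- The trivalent vertex at the root consists of the root and the two halves, and `σ` maps this
    -- vertex to its counterpart.
    have h2 : σ 0 = h₂.succ.succ := by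
      have h3 := (Sys.image_mem_relabel (σ := σ)).2
        ((ins_ins_mem_edgeRoot (t := t) hne (h := h)).2 rfl)
      rw [hs] at h3
      have h4 := eq_ins_ins_of_one_mem hne₂ h3
        (by rw [← h1]; exact Finset.mem_image_of_mem _ (succ_mem_ins.2 zero_mem_ins))
        (by rw [Finset.card_image_of_injective _ σ.injective]; simp)
      have h5 : σ 0 ∈ ins (ins {h₂}) := h4 ▸ Finset.mem_image_of_mem _ (by simp)
      simp only [ins, up, Finset.mem_insert, Finset.mem_singleton, Finset.image_insert,
        Finset.image_singleton] at h5
      rcases h5 with h5 | h5 | h5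
      · exact absurd h5 h0
      · exact absurd (σ.injective (h5.trans h1.symm)) (Fin.succ_ne_zero _).symm
      · exact h5
    -- Viewed from the other end `w₂`, the isomorphism preserves the number `0`. The sign of the
    -- transposition is matched by `mk_farSum_symm`.
    have h3 := main w₂ v₂ (Equiv.swap 0 h₂.succ.succ * σ) hf₂.symm (by
      rw [Sys.relabel_mul, hs, ← edgeRoot_other_end ht₂.toIsTree (mem_internal.1 hf₂.left).1
        (mem_internal.1 hf₂.right).1 hf₂.ne hf₂.mem_left hf₂.mem_right (hf₂.label_eq_none ht₂)])
      (by rw [Equiv.Perm.mul_apply, h2, Equiv.swap_apply_right])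
    rw [mk_farSum_symm ht₂ hk₂ hd₂ hf₂, h3, Equiv.Perm.sign_mul,
      Equiv.Perm.sign_swap (Fin.succ_ne_zero _).symm]
    exact neg_neg_one_mul_smul (A := RootQuotient m k d) _ _

/-- This is the map Φ. It descends to the quotient because no tree `edgeRoot` at an edge between
internal vertices has the form (i, J), and its values on the two kinds of rooted trees do not
interfere. -/
theorem exists_splitRoot (m k d : ℕ) : ∃ Φ : ChainsBar m →+ RootQuotient m k d,
    (∀ (e : ℕ) (t : Sys m e) (v w : Finset (Fin e)) (h : Fin e), t.IsUnrooted →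
      t.univalent.card = k → t.degree = d → t.IsFlag v w h →
      Φ (clsBar (t.edgeRoot v h)) = QuotientAddGroup.mk (farSum t v h)) ∧
    ∀ (e : ℕ) (t : Sys m e) (v : Finset (Fin e)), t.IsUnrooted → v ∈ t.internal →
      Φ (clsBar (t.attach v)) = 0 := by
  obtain ⟨f, hf, hf0⟩ := exists_lift (FlagRel m k d) flagRel_relabel
  refine ⟨QuotientAddGroup.lift (leafBrackets m) f ?_, ?_, ?_⟩
  · refine (AddSubgroup.closure_le f.ker).2 ?_
    rintro x ⟨e, s, hs, rfl⟩
    refine hf0 e s fun σ a ha => ?_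
    have hs' := Sys.isLeafBracket_relabel hs σ
    generalize s.relabel σ = s₂ at ha hs'
    obtain ⟨t, v, w, h, ht, hk, hd, hfl⟩ := ha
    exact not_isLeafBracket_edgeRoot ht hfl hs'
  · intro e t v w h ht hk hd hfl
    exact hf _ _ _ (FlagRel.mk t v w h ht hk hd hfl)
  · intro e t v ht hv
    refine hf0 _ _ fun σ a ha => ?_
    generalize hs : (t.attach v).relabel σ = s₂ at ha
    obtain ⟨e', he⟩ : ∃ e', e = e' + 1 := Nat.exists_eq_succ_of_ne_zero (by
      rintro rfl
      have := (mem_internal.1 hv).2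
      have h2 := Finset.card_le_univ v
      simp at h2
      simp [h2] at this)
    subst he
    obtain ⟨t', v', w', h', ht', hk', hd', hfl'⟩ := ha
    exact attach_relabel_ne_edgeRoot hv ht' hfl' σ hs

/-! ### The first homology of the rooted trees -/

/-- The span of the trees of degree `d` with the root edge at a vertex of valence at least
four. -/
def attachSpan (m k d : ℕ) : AddSubgroup (ChainsBar m) :=
  AddSubgroup.closure {x | ∃ (e : ℕ) (t : Sys m e) (v : Finset (Fin e)), t.IsUnrooted ∧
    t.univalent.card = k ∧ t.degree + 1 = d ∧ v ∈ t.internal ∧ x = clsBar (t.attach v)}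

theorem clsBar_attach_mem_attachSpan {k d : ℕ} {t : Sys m e} (ht : t.IsUnrooted)
    (hk : t.univalent.card = k) (hd : t.degree + 1 = d) {v : Finset (Fin e)}
    (hv : v ∈ t.internal) : clsBar (t.attach v) ∈ attachSpan m k d :=
  AddSubgroup.subset_closure ⟨e, t, v, ht, hk, hd, hv, rfl⟩

theorem attachSpan_le (m k d : ℕ) : attachSpan m k d ≤ rootedChainsBar m k d := by
  refine (AddSubgroup.closure_le _).2 ?_
  rintro _ ⟨e, t, v, ht, hk, rfl, hv, rfl⟩
  exact clsBar_attach_mem ht hk rfl hv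

theorem attachRoot_mem_attachSpan {k d : ℕ} {x : Chains m} (hx : x ∈ unrootedChains m k d) :
    attachRoot m x ∈ attachSpan m k (d + 1) := by
  refine mem_closure_induction_cls (p := fun x => attachRoot m x ∈ attachSpan m k (d + 1))
    ?_ (by rw [map_zero]; exact zero_mem _) (fun x y hx hy => by rw [map_add]; exact add_mem hx hy)
    (fun x hx => by rw [map_neg]; exact neg_mem hx) hx
  rintro _ ⟨e, t, ht, hk, rfl, rfl⟩
  rw [attachRoot_cls]
  exact zsmul_mem (sum_mem fun v hv => clsBar_attach_mem_attachSpan ht hk rfl hv) _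

/-- Modulo trees with the root at a vertex of valence at least four, the boundary moves the root
onto the edges at `v`. -/
theorem boundaryBar_attach {t : Sys m e} (ht : t.IsUnrooted) {v : Finset (Fin e)}
    (hv : v ∈ t.internal) : ∃ r ∈ attachSpan m t.univalent.card t.degree,
      boundaryBar m (clsBar (t.attach v)) = ∑ h ∈ v, clsBar (t.edgeRoot v h) - r := by
  obtain ⟨hvs, hc⟩ := mem_internal.1 hv
  refine ⟨∑ w ∈ t.stars.erase v, ∑ P ∈ partitions w, clsBar ((t.expand w P).attach (up v))
      + ∑ A ∈ halves v, clsBar ((t.expand v {A, v \ A}).attach (ins A)), add_mem ?_ ?_, ?_⟩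
  · refine sum_mem fun w hw => sum_mem fun P hP => ?_
    obtain ⟨hwv, hw⟩ := Finset.mem_erase.1 hw
    obtain ⟨A, hA, rfl⟩ := mem_partitions.1 hP
    refine clsBar_attach_mem_attachSpan ((Sys.isUnrooted_expand_iff hw hA).2 ht)
      (Sys.card_univalent_expand hw hA) (Sys.degree_expand hw hA) (mem_internal.2 ⟨?_, ?_⟩)
    · exact Sys.mem_repl.2 (.inl ⟨v, hvs, hwv.symm, rfl⟩)
    · rwa [card_up]
  · refine sum_mem fun A hA => ?_
    refine clsBar_attach_mem_attachSpan ((Sys.isUnrooted_expand_iff hvs hA).2 ht)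
      (Sys.card_univalent_expand hvs hA) (Sys.degree_expand hvs hA) (mem_internal.2 ⟨?_, ?_⟩)
    · exact Sys.mem_repl.2 (.inr (Finset.mem_image_of_mem _ (Finset.mem_insert_self _ _)))
    · have := mem_halves.1 hA
      rw [card_ins]; omega
  · rw [boundaryBar_clsBar, boundary_cls_attach t hc]
    simp only [map_sub, map_add, map_sum]
    rfl

theorem flag_or_leaf {t : Sys m e} (ht : t.IsUnrooted) {v : Finset (Fin e)} (hv : v ∈ t.internal)
    {h : Fin e} (hh : h ∈ v) :
    (∃ w, t.IsFlag v w h) ∨ ({h} ∈ t.stars ∧ {h} ≠ v) := by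
  obtain ⟨w, hw, hwv, hhw, -⟩ := ht.exists_other_end (mem_internal.1 hv).1 hh
  rcases ht.valence w hw with hc | hc
  · right
    obtain ⟨a, rfl⟩ := Finset.card_eq_one.1 hc
    rw [Finset.mem_singleton] at hhw
    subst hhw
    exact ⟨hw, hwv⟩
  · exact .inl ⟨w, hv, mem_internal.2 ⟨hw, hc⟩, hwv.symm, hh, hhw⟩

theorem clsBar_edgeRoot_leaf {t : Sys m e} (ht : t.IsUnrooted) {v : Finset (Fin e)}
    (hv : v ∈ t.internal) {h : Fin e} (hs : {h} ∈ t.stars) : clsBar (t.edgeRoot v h) = 0 :=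
  clsBar_eq_zero (isLeafBracket_edgeRoot (mem_internal.1 hv).2 hs ((ht.labeled h).2 hs))

theorem farSum_leaf {t : Sys m e} (ht : t.IsUnrooted) {v : Finset (Fin e)}
    (hv : v ∈ t.internal) {h : Fin e} (hh : h ∈ v) (hs : {h} ∈ t.stars) (hne : {h} ≠ v) :
    farSum t v h = 0 := by
  refine Finset.sum_eq_zero fun x hx => if_neg ?_
  rw [ht.toIsTree.far_eq_side (mem_internal.1 hv).1 hs hne.symm hh (by simp)] at hx
  have : x = {h} := Sys.side_induction (p := fun x => x = {h}) hs rfl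
    (fun a _ ha b _ i hi hia _ => absurd (by simpa [ha] using hia) hi) x hx
  rw [this]; simp

/-- Applied to the boundary of `t.attach v`, Φ sums over all branches at `v`, that is, over all
internal vertices but `v`. The full sum is η(t) up to sign and vanishes in the quotient, which
leaves minus the term of `v`. -/
theorem exists_splitRoot_boundaryBar (m k d : ℕ) : ∃ Φ : ChainsBar m →+ RootQuotient m k d,
    (∀ d', ∀ a ∈ attachSpan m k d', Φ a = 0) ∧
    ∀ a ∈ attachSpan m k (d + 1), Φ (boundaryBar m a) = - QuotientAddGroup.mk a := by
  obtain ⟨Φ, h1, h2⟩ := exists_splitRoot m k d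
  have h3 : ∀ d', ∀ a ∈ attachSpan m k d', Φ a = 0 := by
    intro d' a ha
    have : attachSpan m k d' ≤ Φ.ker := by
      refine (AddSubgroup.closure_le _).2 ?_
      rintro _ ⟨e, t, v, ht, hk, hd, hv, rfl⟩
      exact h2 e t v ht hv
    exact this ha
  refine ⟨Φ, h3, fun a ha => ?_⟩
  refine AddSubgroup.closure_induction (p := fun a _ => Φ (boundaryBar m a)
    = - (QuotientAddGroup.mk a : RootQuotient m k d)) ?_ (by simp)
    (fun x y _ _ hx hy => by 
      rw [map_add, map_add, hx, hy]; exact (neg_add (α := RootQuotient m k d) _ _).symm)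
    (fun x _ hx => by rw [map_neg, map_neg, hx]; rfl) ha
  rintro _ ⟨e, t, v, ht, hk, hd, hv, rfl⟩
  obtain ⟨r, hr, hb⟩ := boundaryBar_attach ht hv
  have hd' : t.degree = d := by omega
  rw [hk] at hr
  -- For a leaf edge both sides vanish: the tree is (i, J), and no internal vertex lies beyond the
  -- edge.
  have h4 : ∀ h ∈ v, Φ (clsBar (t.edgeRoot v h)) = QuotientAddGroup.mk' _ (farSum t v h) := by
    intro h hh
    rcases flag_or_leaf ht hv hh with ⟨w, hf⟩ | ⟨hs, hne⟩
    · exact h1 e t v w h ht hk hd' hf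
    · rw [clsBar_edgeRoot_leaf ht hv hs, farSum_leaf ht hv hh hs hne, map_zero, map_zero]
  rw [hb, map_sub, h3 _ r hr, sub_zero, map_sum, Finset.sum_congr rfl h4, ← map_sum]
  have h5 : ∑ h ∈ v, farSum t v h
      = ((-1 : ℤ) ^ t.degree) • attachRoot m (cls t) - clsBar (t.attach v) := by
    simp only [farSum]
    rw [ht.toIsTree.sum_far (mem_internal.1 hv).1, eq_sub_iff_add_eq, ← sum_stars_attach,
      ← Sys.sum_stars_erase (mem_internal.1 hv).1, if_pos (mem_internal.1 hv).2]
  have h6 : (QuotientAddGroup.mk' ((unrootedChains m k d).map (attachRoot m)))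
      (attachRoot m (cls t)) = 0 :=
    (QuotientAddGroup.eq_zero_iff _).2
      (AddSubgroup.mem_map_of_mem _ (cls_mem_unrootedChains ht hk hd'))
  rw [h5, map_sub, map_zsmul, h6, smul_zero, zero_sub]
  rfl

/-- Induction on the number of vertices beyond `h`: the boundary of `t.attach w` trades the root on
`h` for roots on the other edges at the far end `w`, whose branches are smaller. -/
theorem clsBar_edgeRoot_mem {t : Sys m e} (ht : t.IsUnrooted) (n : ℕ) :
    ∀ {v w : Finset (Fin e)} {h : Fin e}, t.IsFlag v w h → (t.far v h).card = n →
      clsBar (t.edgeRoot v h) ∈ (attachSpan m t.univalent.card (t.degree + 1)).map (boundaryBar m)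
        ⊔ attachSpan m t.univalent.card t.degree := by
  induction n using Nat.strong_induction_on with
  | _ n ih =>
    intro v w h hf hn
    set M := (attachSpan m t.univalent.card (t.degree + 1)).map (boundaryBar m)
        ⊔ attachSpan m t.univalent.card t.degree
    obtain ⟨hv, hcv⟩ := mem_internal.1 hf.left
    obtain ⟨hw, hcw⟩ := mem_internal.1 hf.right
    have h1 : clsBar (t.edgeRoot v h) = - clsBar (t.edgeRoot w h) := by
      rw [clsBar, cls_edgeRoot_other_end ht.toIsTree hw hv hf.ne.symm hf.mem_right hf.mem_left
        (hf.label_eq_none ht)]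
      rfl
    rw [h1]
    refine neg_mem ?_
    obtain ⟨r, hr, hb⟩ := boundaryBar_attach ht hf.right
    -- Solving the boundary formula at `w` for the sum over edges shows that this sum lies in `M`.
    -- All summands but the one for `h` are then removed by induction or because they belong to
    -- leaves.
    have h2 : ∑ h ∈ w, clsBar (t.edgeRoot w h) ∈ M := by
      rw [show ∑ h ∈ w, clsBar (t.edgeRoot w h) = boundaryBar m (clsBar (t.attach w)) + r by
        rw [hb, sub_add_cancel]]
      exact add_mem (AddSubgroup.mem_sup_left (AddSubgroup.mem_map_of_mem _
        (clsBar_attach_mem_attachSpan ht rfl rfl hf.right))) (AddSubgroup.mem_sup_right hr)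
    rw [← Finset.add_sum_erase w _ hf.mem_right] at h2
    refine (AddSubgroup.add_mem_cancel_right M (sum_mem fun h' hh' => ?_)).1 h2
    obtain ⟨hne, hh'⟩ := Finset.mem_erase.1 hh'
    rcases flag_or_leaf ht hf.right hh' with ⟨w', hf'⟩ | ⟨hs, -⟩
    · refine ih _ ?_ hf' rfl
      rw [← hn]
      exact Finset.card_lt_card
        (ht.toIsTree.far_ssubset_far hv hw hf.ne hf.mem_left hf.mem_right hh' hne)
    · rw [clsBar_edgeRoot_leaf ht hf.right hs]
      exact zero_mem _

theorem rootedChainsBar_le (m k d : ℕ) : rootedChainsBar m k d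
    ≤ (attachSpan m k (d + 1)).map (boundaryBar m) ⊔ attachSpan m k d := by
  rw [rootedChainsBar, AddSubgroup.map_le_iff_le_comap]
  refine (AddSubgroup.closure_le _).2 ?_
  rintro _ ⟨e, s, hs, hk, hd, rfl⟩
  change clsBar s ∈ (attachSpan m k (d + 1)).map (boundaryBar m) ⊔ attachSpan m k d
  rcases rooted_cases hs with h | ⟨e', t, v, c, ht, hv, hk', hd', h⟩ |
    ⟨e', t, v, w, h, c, ht, hv, hw, hvw, hhv, hhw, hk', hd', h'⟩
  · rw [h]; exact zero_mem _
  · rw [h]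
    exact zsmul_mem (AddSubgroup.mem_sup_right
      (clsBar_attach_mem_attachSpan ht (by omega) (by omega) hv)) _
  · rw [h']
    have := clsBar_edgeRoot_mem ht _ (v := v) (w := w) (h := h) ⟨hv, hw, hvw, hhv, hhw⟩ rfl
    rw [show t.univalent.card = k by omega, show t.degree = d by omega] at this
    exact zsmul_mem this _

/-- Every cycle of rooted trees is homologous to the image of a chain of unrooted trees. -/
theorem exists_attachRoot_of_cycle {k d : ℕ} {z : ChainsBar m}
    (hz : z ∈ cycles (boundaryBar m) (rootedChainsBar m k) (d + 1)) :
    ∃ x ∈ unrootedChains m k d,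
      z - attachRoot m x ∈ (rootedChainsBar m k (d + 2)).map (boundaryBar m) := by
  obtain ⟨hz, hz0⟩ := AddSubgroup.mem_inf.1 hz
  obtain ⟨_, ⟨a', ha', rfl⟩, a, ha, rfl⟩ := AddSubgroup.mem_sup.1 (rootedChainsBar_le m k _ hz)
  obtain ⟨Φ, -, hΦ⟩ := exists_splitRoot_boundaryBar m k d
  -- Subtracting the boundary of `a'` replaces the cycle by the homologous cycle `a`, all of whose
  -- trees have the root at a vertex of valence at least four.
  have h1 : boundaryBar m a = 0 := by
    have h2 : boundaryBar m (boundaryBar m a' + a) = 0 := hz0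
    rwa [map_add, boundaryBar_boundaryBar, zero_add] at h2
  have h2 := hΦ a ha
  rw [h1, map_zero, eq_comm, neg_eq_zero, QuotientAddGroup.eq_zero_iff] at h2
  obtain ⟨x, hx, rfl⟩ := h2
  exact ⟨x, hx, by
    rw [add_sub_cancel_right]
    exact AddSubgroup.mem_map_of_mem _ (attachSpan_le _ _ _ ha')⟩

/-- A chain of unrooted trees with bounding image differs from a boundary by a chain in the
kernel of the chain map. -/
theorem exists_boundary_of_attachRoot_mem {k d : ℕ} {x : Chains m}
    (hx : x ∈ unrootedChains m k d)
    (hb : attachRoot m x ∈ (rootedChainsBar m k (d + 2)).map (boundaryBar m)) :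
    ∃ x' ∈ unrootedChains m k (d + 1), attachRoot m (x - boundary m x') = 0 := by
  obtain ⟨y, hy, hyx⟩ := hb
  obtain ⟨_, ⟨a', -, rfl⟩, a, ha, rfl⟩ := AddSubgroup.mem_sup.1 (rootedChainsBar_le m k _ hy)
  obtain ⟨Φ, hΦ0, hΦ⟩ := exists_splitRoot_boundaryBar m k (d + 1)
  have h1 : boundaryBar m a = attachRoot m x := by
    rw [← hyx, map_add, boundaryBar_boundaryBar, zero_add]
  -- The image of η is spanned by trees `attach`, which Φ kills. So `-a` vanishes in the quotient,
  -- and `a` itself is in the image of η.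
  have h2 := hΦ a ha
  rw [h1, hΦ0 _ _ (attachRoot_mem_attachSpan hx), eq_comm, neg_eq_zero,
    QuotientAddGroup.eq_zero_iff] at h2
  obtain ⟨x', hx', rfl⟩ := h2
  exact ⟨x', hx', by rw [map_sub, ← boundaryBar_attachRoot hx', h1, sub_self]⟩

/-! ### Partitions of a set with four elements -/

theorem partitions_image_of_injective {e' : ℕ} {f : Fin e' → Fin e} (hf : Function.Injective f)
    (v : Finset (Fin e')) :
    partitions (v.image f) = (partitions v).image (fun P => P.image (fun A => A.image f)) := by
  rw [partitions_eq_image, partitions_eq_image, Finset.image_image]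
  have h : halves (v.image f) = (halves v).image (fun A => A.image f) := by
    ext A
    rw [mem_halves, Finset.mem_image]
    constructor
    · rintro ⟨h1, h2, h3⟩
      obtain ⟨B, hB, rfl⟩ := Finset.subset_image_iff.1 h1
      rw [← Finset.image_sdiff _ _ hf, Finset.card_image_of_injective _ hf] at h3
      rw [Finset.card_image_of_injective _ hf] at h2
      exact ⟨B, mem_halves.2 ⟨by exact_mod_cast hB, h2, h3⟩, rfl⟩
    · rintro ⟨B, hB, rfl⟩
      rw [mem_halves] at hB
      rw [← Finset.image_sdiff _ _ hf, Finset.card_image_of_injective _ hf,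
        Finset.card_image_of_injective _ hf]
      exact ⟨Finset.image_subset_image hB.1, hB.2⟩
  rw [h, Finset.image_image]
  refine Finset.image_congr fun A _ => ?_
  simp [Finset.image_insert, Finset.image_sdiff _ _ hf]

theorem partitions_fin_four : partitions (Finset.univ : Finset (Fin 4))
    = {{{0, 1}, {2, 3}}, {{0, 2}, {1, 3}}, {{0, 3}, {1, 2}}} := by decide

/-- The count is transported along an injection from `Fin 4`, where it can be decided. -/
theorem sum_partitions_four {M : Type*} [AddCommMonoid M] {a b c d : Fin e} (hab : a ≠ b)
    (hac : a ≠ c) (had : a ≠ d) (hbc : b ≠ c) (hbd : b ≠ d) (hcd : c ≠ d)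
    (F : Finset (Finset (Fin e)) → M) :
    ∑ P ∈ partitions {a, b, c, d}, F P
      = F {{a, b}, {c, d}} + (F {{a, c}, {b, d}} + F {{a, d}, {b, c}}) := by
  have hf : Function.Injective ![a, b, c, d] := by
    intro i j h
    fin_cases i <;> fin_cases j <;> simp_all
  have hv : ({a, b, c, d} : Finset (Fin e)) = Finset.univ.image ![a, b, c, d] := by
    ext x
    simp [Fin.exists_fin_succ, eq_comm]
  rw [hv, partitions_image_of_injective hf, Finset.sum_image
    (fun _ _ _ _ h => Finset.image_injective (Finset.image_injective hf) h), partitions_fin_four,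
    Finset.sum_insert (by decide), Finset.sum_pair (by decide)]
  simp [Finset.image_insert]

/-! ### Forgetting the root -/

theorem not_isLeafBracket_attach {t : Sys m e} (ht : t.IsUnrooted) {v : Finset (Fin e)}
    (hv : v ∈ t.internal) : ¬ (t.attach v).IsLeafBracket := by
  obtain ⟨hvs, hc⟩ := mem_internal.1 hv
  rintro ⟨r, a, b, hra, hrb, hab, h3, hr, hrl, -, -⟩
  obtain rfl := ((Sys.isRooted_attach_iff hvs hc).2 ht).root.unique ⟨hr, hrl⟩
    ⟨Sys.singleton_zero_mem_attach, rfl⟩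
  have h4 : ({0, a, b} : Finset (Fin (e + 1))).card = 3 :=
    Finset.card_eq_three.2 ⟨_, _, _, hra, hrb, hab, rfl⟩
  rcases eq_of_zero_mem_attach h3 (by simp) with h | h
  · rw [h, card_ins] at h4; omega
  · rw [h] at h4; simp at h4

/-- The values of the map that forgets the root. -/
inductive AttachRel (m : ℕ) : ∀ e, Sys m e → Chains m → Prop
  | mk {e : ℕ} (t : Sys m e) (v : Finset (Fin e)) (ht : t.IsUnrooted) (hv : v ∈ t.internal) :
      AttachRel m (e + 1) (t.attach v) (cls t)

/-- Forgetting the root is well defined on trees with the root at a vertex of valence at least four,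
by `attach_relabel_inj`. These trees are not of the form (i, J), so the map descends to the
quotient. -/
theorem exists_forgetRoot (m : ℕ) : ∃ ρ : ChainsBar m →+ Chains m,
    ∀ (e : ℕ) (t : Sys m e) (v : Finset (Fin e)), t.IsUnrooted → v ∈ t.internal →
      ρ (clsBar (t.attach v)) = cls t := by
  obtain ⟨f, hf, hf0⟩ := exists_lift (AttachRel m) (by
    intro e s σ a b ha hb
    obtain ⟨t, v, ht, hv⟩ := ha
    generalize hs : (t.attach v).relabel σ = s₂ at hb
    obtain ⟨t₂, v₂, ht₂, hv₂⟩ := hb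
    obtain ⟨τ, rfl, rfl, rfl⟩ := attach_relabel_inj ht₂ hv hv₂ hs.symm
    rw [cls_relabel, sign_upPerm])
  refine ⟨QuotientAddGroup.lift (leafBrackets m) f ?_, fun e t v ht hv =>
    hf _ _ _ (AttachRel.mk t v ht hv)⟩
  refine (AddSubgroup.closure_le f.ker).2 ?_
  rintro x ⟨e, s, hs, rfl⟩
  refine hf0 e s fun σ a ha => ?_
  have hs' := Sys.isLeafBracket_relabel hs σ
  generalize s.relabel σ = s₂ at ha hs'
  obtain ⟨t, v, ht, hv⟩ := ha
  exact not_isLeafBracket_attach ht hv hs'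

theorem Sys.IsTree.sum_card {t : Sys m e} (ht : t.IsTree) : ∑ v ∈ t.stars, v.card = 2 * e := by
  have h : ∀ v ∈ t.stars, v.card = ∑ i : Fin e, if i ∈ v then 1 else 0 := fun v _ => by
    rw [← Finset.card_filter]; simp
  rw [Finset.sum_congr rfl h, Finset.sum_comm]
  simp only [← Finset.card_filter, ht.two_ends]
  simp [mul_comm]

theorem card_of_degree_zero {t : Sys m e} (hd : t.degree = 0) {v : Finset (Fin e)}
    (hv : v ∈ t.internal) : v.card = 3 := by
  rw [Sys.degree, Finset.sum_eq_zero_iff] at hd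
  have := hd v hv
  have := (mem_internal.1 hv).2
  omega

/-- With `i` trivalent vertices, counting vertices gives `n + 2 + i = e + 1` and counting edge ends
gives `n + 2 + 3 * i = 2 * e`. -/
theorem Sys.IsTree.card_internal {t : Sys m e} (ht : t.IsTree) (hd : t.degree = 0) {n : ℕ}
    (hk : t.univalent.card = n + 2) : t.internal.card = n ∧ e = 2 * n + 1 := by
  have h1 := ht.sum_card
  have h2 := ht.card_stars
  have h3 : t.univalent = t.stars.filter (fun v => ¬ 3 ≤ v.card) := by
    rw [Sys.univalent]
    refine Finset.filter_congr fun v hv => ?_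
    rcases ht.valence v hv with h | h <;> omega
  have h4 := Finset.card_filter_add_card_filter_not (s := t.stars) (fun v => 3 ≤ v.card)
  have h5 := Finset.sum_filter_add_sum_filter_not t.stars (fun v => 3 ≤ v.card) (fun v => v.card)
  rw [← h3, ← Sys.internal] at h4 h5
  have h6 : ∑ v ∈ t.univalent, v.card = ∑ v ∈ t.univalent, 1 :=
    Finset.sum_congr rfl fun v hv => (Finset.mem_filter.1 hv).2
  rw [Finset.sum_congr rfl fun v hv => card_of_degree_zero hd hv, h6] at h5
  simp only [Finset.sum_const, smul_eq_mul] at h5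
  omega

/-- Each of the `n` trivalent vertices contributes the tree itself, so the kernel of η in degree
zero is killed by `n`. -/
theorem exists_forgetRoot_attachRoot (m n : ℕ) : ∃ ρ : ChainsBar m →+ Chains m,
    ∀ x ∈ unrootedChains m (n + 2) 0, ρ (attachRoot m x) = (n : ℤ) • x := by
  obtain ⟨ρ, hρ⟩ := exists_forgetRoot m
  refine ⟨ρ, fun x hx => ?_⟩
  refine mem_closure_induction_cls (p := fun x => ρ (attachRoot m x) = (n : ℤ) • x) ?_ (by simp)
    (fun x y hx hy => by rw [map_add, map_add, hx, hy, smul_add])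
    (fun x hx => by rw [map_neg, map_neg, hx, smul_neg]) hx
  rintro _ ⟨e, t, ht, hk, hd, rfl⟩
  rw [attachRoot_cls, hd, pow_zero, one_smul, map_sum,
    Finset.sum_congr rfl fun v hv => hρ e t v ht hv, Finset.sum_const,
    (ht.toIsTree.card_internal hd hk).1, natCast_zsmul]

/-! ### Torsion in the chain groups -/

/-- The tree has no automorphisms reversing the orientation. -/
def Sys.EvenAut (t : Sys m e) : Prop :=
  ∀ σ : Equiv.Perm (Fin e), t.relabel σ = t → Equiv.Perm.sign σ = 1

theorem Sys.EvenAut.of_relabel {t : Sys m e} {σ : Equiv.Perm (Fin e)}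
    (h : (t.relabel σ).EvenAut) : t.EvenAut := by
  intro τ hτ
  have := h (σ * τ * σ⁻¹) (by
    rw [Sys.relabel_mul, Sys.relabel_inv_relabel, Sys.relabel_mul, hτ])
  rwa [map_mul, map_mul, map_inv, Int.units_inv_eq_self, mul_right_comm, Int.units_mul_self,
    one_mul] at this

/-- The span of the unrooted trees with an orientation reversing automorphism. -/
def torsionSpan (m k d : ℕ) : AddSubgroup (Chains m) :=
  AddSubgroup.closure {x | ∃ (e : ℕ) (t : Sys m e), t.IsUnrooted ∧ t.univalent.card = k ∧
    t.degree = d ∧ ¬ t.EvenAut ∧ x = cls t}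

/-- An orientation reversing automorphism identifies the class of the tree with its negative. -/
theorem two_smul_torsionSpan {k d : ℕ} {x : Chains m} (hx : x ∈ torsionSpan m k d) :
    (2 : ℤ) • x = 0 := by
  refine mem_closure_induction_cls (p := fun x => (2 : ℤ) • x = 0) ?_ (by simp)
    (fun x y hx hy => by rw [smul_add, hx, hy, add_zero])
    (fun x hx => by rw [smul_neg, hx, neg_zero]) hx
  rintro _ ⟨e, t, -, -, -, h, rfl⟩
  simp only [Sys.EvenAut, not_forall] at h
  obtain ⟨σ, hσ, hs⟩ := h
  have h1 := cls_relabel t σ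
  rw [hσ, (Int.units_eq_one_or _).resolve_left hs] at h1
  rw [two_smul]
  nth_rewrite 1 [h1]
  simp

/-- Isomorphism of trees. -/
def isoSetoid (m : ℕ) : Setoid (Σ e, Sys m e) where
  r s t := ∃ σ : Equiv.Perm (Fin s.1), t = ⟨s.1, s.2.relabel σ⟩
  iseqv := by
    refine ⟨fun s => ⟨1, by rw [Sys.relabel_one]⟩, ?_, ?_⟩
    · rintro ⟨e, s⟩ _ ⟨σ, rfl⟩
      exact ⟨σ⁻¹, by rw [Sys.relabel_inv_relabel]⟩
    · rintro ⟨e, s⟩ _ _ ⟨σ, rfl⟩ ⟨τ, rfl⟩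
      exact ⟨τ * σ, by rw [Sys.relabel_mul]⟩

/-- Without reversing automorphisms, the sign of an isomorphism from `t` depends only on its target.
So the coefficient of `t` in a chain is a well-defined integer. -/
theorem exists_coefficient (t : Sys m e) (ht : t.EvenAut) : ∃ f : Chains m →+ ℤ,
    (∀ σ : Equiv.Perm (Fin e), f (cls (t.relabel σ)) = Equiv.Perm.sign σ) ∧
    ∀ (e' : ℕ) (s : Sys m e'), ¬ (isoSetoid m).r ⟨e, t⟩ ⟨e', s⟩ → f (cls s) = 0 := by
  obtain ⟨f, hf, hf0⟩ := exists_lift (A := ℤ) (fun e' s a =>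
    ∃ σ : Equiv.Perm (Fin e), (⟨e', s⟩ : Σ e, Sys m e) = ⟨e, t.relabel σ⟩ ∧
      a = Equiv.Perm.sign σ) (by
    rintro e' s σ a b ⟨σ₁, h1, rfl⟩ ⟨σ₂, h2, rfl⟩
    cases h1
    have h3 : (t.relabel σ₁).relabel σ = t.relabel σ₂ := by
      simpa using h2
    have h4 := ht (σ₂⁻¹ * (σ * σ₁)) (by
      rw [Sys.relabel_mul, Sys.relabel_mul, h3, Sys.relabel_inv_relabel])
    rw [map_mul, map_mul, map_inv, Int.units_inv_eq_self] at h4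
    rw [smul_eq_mul, ← Units.val_mul]
    congr 1
    rw [eq_comm, ← one_mul (Equiv.Perm.sign σ * Equiv.Perm.sign σ₁),
      ← Int.units_mul_self (Equiv.Perm.sign σ₂), mul_assoc, h4, mul_one])
  refine ⟨f, fun σ => hf _ _ _ ⟨σ, rfl, rfl⟩, fun e' s hs => hf0 _ _ ?_⟩
  rintro τ a ⟨σ, h1, -⟩
  refine hs ((isoSetoid m).trans (b := ⟨e', s.relabel τ⟩) ⟨σ, h1⟩ ?_)
  exact (isoSetoid m).symm ⟨τ, rfl⟩

/-- A torsion element is a combination of trees with orientation reversing automorphisms. -/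
theorem mem_torsionSpan {k d : ℕ} {x : Chains m} (hx : x ∈ unrootedChains m k d) {N : ℤ}
    (hN : N ≠ 0) (h0 : N • x = 0) : x ∈ torsionSpan m k d := by
  classical
  let S := isoSetoid m
  have hL : ∀ q : Quotient S, ∃ f : Chains m →+ ℤ,
      (q.out.2.EvenAut → ∀ σ, f (cls (q.out.2.relabel σ)) = Equiv.Perm.sign σ) ∧
      (¬ q.out.2.EvenAut → f = 0) ∧
      ∀ (e' : ℕ) (s : Sys m e'), (⟦⟨e', s⟩⟧ : Quotient S) ≠ q → f (cls s) = 0 := by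
    intro q
    by_cases hq : q.out.2.EvenAut
    · obtain ⟨f, hf, hf0⟩ := exists_coefficient _ hq
      refine ⟨f, fun _ => hf, fun h => absurd hq h, fun e' s hs => hf0 e' s fun hr => hs ?_⟩
      rw [← Quotient.out_eq q]
      exact (Quotient.sound hr).symm
    · exact ⟨0, fun h => absurd h hq, fun _ => rfl, fun _ _ _ => rfl⟩
  choose L hL1 hL2 hL3 using hL
  -- Modulo `torsionSpan`, a chain is recovered from its integer coefficients. Requiring this for
  -- all larger finite sets makes the property additive.
  have key : ∃ F : Finset (Quotient S), ∀ F', F ⊆ F' →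
      x - ∑ q ∈ F', L q x • cls q.out.2 ∈ torsionSpan m k d := by
    refine mem_closure_induction_cls (p := fun x => ∃ F : Finset (Quotient S), ∀ F', F ⊆ F' →
      x - ∑ q ∈ F', L q x • cls q.out.2 ∈ torsionSpan m k d) ?_ ?_ ?_ ?_ hx
    · rintro _ ⟨e, t, ht, hk, hd, rfl⟩
      set q₀ : Quotient S := ⟦⟨e, t⟩⟧ with hq₀
      refine ⟨{q₀}, fun F' hF' => ?_⟩
      rw [Finset.sum_eq_single_of_mem q₀ (hF' (by simp)) (fun q _ hq => by
        rw [hL3 q e t hq.symm, zero_smul])]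
      obtain ⟨σ, hσ⟩ : S.r q₀.out ⟨e, t⟩ := Quotient.exact (Quotient.out_eq q₀)
      have h1 := hL1 q₀
      have h2 := hL2 q₀
      revert σ h1 h2
      generalize L q₀ = f
      generalize q₀.out = s
      intro σ hσ h1 h2
      obtain ⟨e', s⟩ := s
      cases hσ
      by_cases hs : s.EvenAut
      · rw [h1 hs σ, cls_relabel, sub_self]
        exact zero_mem _
      · rw [h2 hs, AddMonoidHom.zero_apply, zero_smul, sub_zero]
        exact AddSubgroup.subset_closure ⟨_, _, ht, hk, hd, fun h => hs h.of_relabel, rfl⟩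
    · exact ⟨∅, fun F' _ => by simp [zero_mem]⟩
    · rintro x y ⟨F, hF⟩ ⟨G, hG⟩
      refine ⟨F ∪ G, fun F' hF' => ?_⟩
      have := add_mem (hF F' (Finset.union_subset_left hF')) (hG F' (Finset.union_subset_right hF'))
      simp only [map_add, add_smul, Finset.sum_add_distrib]
      rwa [add_sub_add_comm]
    · rintro x ⟨F, hF⟩
      refine ⟨F, fun F' hF' => ?_⟩
      have := neg_mem (hF F' hF')
      simp only [map_neg, neg_smul, Finset.sum_neg_distrib]
      rwa [neg_sub', ] at this
  obtain ⟨F, hF⟩ := key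
  have := hF F le_rfl
  rwa [Finset.sum_eq_zero, sub_zero] at this
  intro q _
  -- All coefficients vanish because ℤ is torsion free.
  have h1 : L q (N • x) = 0 := by rw [h0, map_zero]
  rw [map_zsmul, smul_eq_mul] at h1
  rw [(mul_eq_zero.1 h1).resolve_left hN, zero_smul]

/-! ### Automorphisms -/

theorem relabel_eq_self {t : Sys m e} {τ : Equiv.Perm (Fin e)}
    (hs : ∀ x ∈ t.stars, x.image τ ∈ t.stars) (hl : ∀ i, t.label (τ i) = t.label i) :
    t.relabel τ = t := by
  have h : t.stars.image (fun x => x.image τ) = t.stars :=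
    Finset.eq_of_subset_of_card_le (Finset.image_subset_iff.2 hs)
      (Finset.card_image_of_injective _ (image_inj τ)).ge
  refine (eq_relabel (fun x => ⟨fun hx => ?_, hs x⟩) hl).symm
  rw [← h] at hx
  obtain ⟨y, hy, hxy⟩ := Finset.mem_image.1 hx
  exact image_inj τ hxy ▸ hy

theorem image_mem_of_relabel_eq {t : Sys m e} {σ : Equiv.Perm (Fin e)} (h : t.relabel σ = t)
    {x : Finset (Fin e)} (hx : x ∈ t.stars) : x.image σ ∈ t.stars := by
  have := Sys.image_mem_relabel (σ := σ).2 hx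
  rwa [h] at this

theorem label_of_relabel_eq {t : Sys m e} {σ : Equiv.Perm (Fin e)} (h : t.relabel σ = t)
    (i : Fin e) : t.label (σ i) = t.label i := by
  have := t.label_relabel σ i
  rwa [h] at this

theorem relabel_pow_eq {t : Sys m e} {σ : Equiv.Perm (Fin e)} (h : t.relabel σ = t) (k : ℕ) :
    t.relabel (σ ^ k) = t := by
  induction k with
  | zero => exact t.relabel_one
  | succ k ih => rw [pow_succ, Sys.relabel_mul, h, ih]

namespace Sys

variable {t : Sys m e} {σ : Equiv.Perm (Fin e)} {h : Fin e} {u w x : Finset (Fin e)}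

/-- The edge `i` lies on the side of `u` of the edge `h`. -/
def EdgeSide (t : Sys m e) (h : Fin e) (u : Finset (Fin e)) (i : Fin e) : Prop :=
  i ≠ h ∧ ∃ x ∈ t.side h u, i ∈ x

theorem IsTree.mem_side_or (ht : t.IsTree) (hu : u ∈ t.stars) (hw : w ∈ t.stars) (huw : u ≠ w)
    (hhu : h ∈ u) (hhw : h ∈ w) (hx : x ∈ t.stars) : x ∈ t.side h u ∨ x ∈ t.side h w := by
  rw [ht.side_eq_sdiff hu hw huw hhu hhw, Finset.mem_sdiff]
  tauto

theorem IsTree.edgeSide_or (ht : t.IsTree) (hu : u ∈ t.stars) (hw : w ∈ t.stars) (huw : u ≠ w)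
    (hhu : h ∈ u) (hhw : h ∈ w) {i : Fin e} (hi : i ≠ h) :
    t.EdgeSide h u i ∨ t.EdgeSide h w i := by
  obtain ⟨x, -, -, hx, -, hix, -⟩ := ht.exists_ends i
  exact (ht.mem_side_or hu hw huw hhu hhw hx).imp (fun h => ⟨hi, x, h, hix⟩)
    (fun h => ⟨hi, x, h, hix⟩)

theorem IsTree.not_edgeSide (ht : t.IsTree) (hu : u ∈ t.stars) (hw : w ∈ t.stars) (huw : u ≠ w)
    (hhu : h ∈ u) (hhw : h ∈ w) {i : Fin e} (hi : t.EdgeSide h u i) : ¬ t.EdgeSide h w i := by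
  rintro ⟨-, y, hy, hiy⟩
  obtain ⟨hne, x, hx, hix⟩ := hi
  have hy' := hy
  rw [ht.side_eq_sdiff hu hw huw hhu hhw, Finset.mem_sdiff] at hy'
  exact hy'.2 (mem_side_of_adj hx hy'.1 hne hix hiy)

theorem edgeSide_apply (hσ : t.relabel σ = t) (hh : σ h = h) {i : Fin e}
    (hi : t.EdgeSide h u i) : t.EdgeSide h (u.image σ) (σ i) := by
  obtain ⟨hne, x, hx, hix⟩ := hi
  refine ⟨fun h' => hne (σ.injective (h'.trans hh.symm)), x.image σ, ?_,
    Finset.mem_image_of_mem _ hix⟩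
  have := side_relabel t σ h u
  rw [hσ, hh] at this
  rw [this]
  exact Finset.mem_image_of_mem _ hx

/-- An automorphism fixing an edge and its end points may be restricted to one side of it. -/
theorem IsTree.exists_restrict (ht : t.IsTree) (hσ : t.relabel σ = t) (hh : σ h = h)
    (hu : u ∈ t.stars) (hw : w ∈ t.stars) (huw : u ≠ w) (hhu : h ∈ u) (hhw : h ∈ w)
    (hσu : u.image σ = u) (hσw : w.image σ = w) :
    ∃ τ : Equiv.Perm (Fin e), t.relabel τ = t ∧ (∀ i, t.EdgeSide h u i → τ i = σ i) ∧
      ∀ i, ¬ t.EdgeSide h u i → τ i = i := by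
  classical
  -- As `σ` fixes both ends of `h`, it preserves each side, so it can be cut off there and continued
  -- by the identity.
  have hp : ∀ i, t.EdgeSide h u (σ i) ↔ t.EdgeSide h u i := by
    refine fun i => ⟨fun hi => ?_, fun hi => hσu ▸ edgeSide_apply hσ hh hi⟩
    have hne : i ≠ h := fun h' => hi.1 (h' ▸ hh)
    refine (ht.edgeSide_or hu hw huw hhu hhw hne).resolve_right fun hw' => ?_
    have := edgeSide_apply hσ hh hw'
    rw [hσw] at this
    exact ht.not_edgeSide hu hw huw hhu hhw hi this
  have h1 : ∀ i, t.EdgeSide h u i → Equiv.Perm.ofSubtype (σ.subtypePerm hp) i = σ i :=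
    fun i hi => Equiv.Perm.ofSubtype_apply_of_mem _ hi
  have h2 : ∀ i, ¬ t.EdgeSide h u i → Equiv.Perm.ofSubtype (σ.subtypePerm hp) i = i :=
    fun i hi => Equiv.Perm.ofSubtype_apply_of_not_mem _ hi
  have h3 : Equiv.Perm.ofSubtype (σ.subtypePerm hp) h = h := h2 h fun h' => h'.1 rfl
  refine ⟨_, relabel_eq_self (fun x hx => ?_) (fun i => ?_), h1, h2⟩
  · rcases ht.mem_side_or hu hw huw hhu hhw hx with hs | hs
    · rw [Finset.image_congr (g := σ)]
      · exact image_mem_of_relabel_eq hσ hx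
      · intro i hi
        by_cases hi' : i = h
        · rw [hi', h3, hh]
        · exact h1 i ⟨hi', x, hs, hi⟩
    · rw [Finset.image_congr (g := id)]
      · rwa [Finset.image_id]
      · intro i hi
        by_cases hi' : i = h
        · rw [hi', h3]; rfl
        · exact h2 i fun h' => ht.not_edgeSide hu hw huw hhu hhw h' ⟨hi', x, hs, hi⟩
  · by_cases hi : t.EdgeSide h u i
    · rw [h1 i hi, label_of_relabel_eq hσ]
    · rw [h2 i hi]

/-- An automorphism fixing an edge fixes its end points as soon as it fixes one of them. -/
theorem IsTree.image_eq_of_image_eq (ht : t.IsTree) (hσ : t.relabel σ = t) (hh : σ h = h)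
    (hu : u ∈ t.stars) (hw : w ∈ t.stars) (hhu : h ∈ u) (hhw : h ∈ w)
    (hσu : u.image σ = u) : w.image σ = w := by
  by_cases huw : u = w
  · exact huw ▸ hσu
  · refine (ht.ends hu hw huw hhu hhw _ (image_mem_of_relabel_eq hσ hw)
      (Finset.mem_image.2 ⟨h, hhw, hh⟩)).resolve_left fun h' => huw ?_
    exact image_inj σ (hσu.trans h'.symm)

end Sys

/-! ### Orientation reversing automorphisms with as many fixed edges as possible. -/

/-- The automorphism reverses the orientation and fixes as many edges as possible for such. -/
def Sys.IsMaximalOdd (t : Sys m e) (σ : Equiv.Perm (Fin e)) : Prop :=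
  t.relabel σ = t ∧ Equiv.Perm.sign σ = -1 ∧ ∀ τ : Equiv.Perm (Fin e), t.relabel τ = t →
    Equiv.Perm.sign τ = -1 → τ.support.card ≥ σ.support.card

/-- A reversing automorphism that fixes every edge fixed by `σ` has exactly the same fixed edges, by
minimality of the support. -/
theorem Sys.IsMaximalOdd.apply_of_apply {t : Sys m e} {σ τ : Equiv.Perm (Fin e)}
    (h : t.IsMaximalOdd σ) (hτ : t.relabel τ = t) (hs : Equiv.Perm.sign τ = -1)
    (hf : ∀ i, σ i = i → τ i = i) {i : Fin e} (hi : τ i = i) : σ i = i := by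
  have h1 : τ.support ⊆ σ.support := fun j hj =>
    Equiv.Perm.mem_support.2 fun h' => Equiv.Perm.mem_support.1 hj (hf j h')
  have h2 := Finset.eq_of_subset_of_card_le h1 (h.2.2 τ hτ hs)
  by_contra h'
  have h3 := Equiv.Perm.mem_support.2 h'
  rw [← h2, Equiv.Perm.mem_support] at h3
  exact h3 hi

/-- Raising an automorphism of minimal support to the odd part of its order keeps the sign, does not
enlarge the support and leaves an order that is a power of two. -/
theorem Sys.exists_isMaximalOdd {t : Sys m e} (h : ¬ t.EvenAut) :
    ∃ σ k, t.IsMaximalOdd σ ∧ σ ^ 2 ^ k = 1 := by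
  classical
  simp only [Sys.EvenAut, not_forall] at h
  obtain ⟨σ₀, hσ₀, hs₀⟩ := h
  obtain ⟨σ, hσ, hmin⟩ := Finset.exists_min_image
    ((Finset.univ : Finset (Equiv.Perm (Fin e))).filter
      (fun σ => t.relabel σ = t ∧ Equiv.Perm.sign σ = -1))
    (fun σ => σ.support.card)
    ⟨σ₀, by simpa using ⟨hσ₀, (Int.units_eq_one_or _).resolve_left hs₀⟩⟩
  simp only [Finset.mem_filter, Finset.mem_univ, true_and] at hσ hmin
  obtain ⟨k, b, hb, hk⟩ := Nat.exists_eq_two_pow_mul_odd (orderOf_pos σ).ne'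
  refine ⟨σ ^ b, k, ⟨relabel_pow_eq hσ.1 b, ?_, fun τ hτ hs => (hmin τ ⟨hτ, hs⟩).trans' ?_⟩, ?_⟩
  · rw [map_pow, hσ.2, hb.neg_one_pow]
  · exact Finset.card_le_card (Equiv.Perm.support_pow_le σ b)
  · rw [← pow_mul, mul_comm, ← hk, pow_orderOf_eq_one]

/-- The automorphism is the product of its restrictions to the two sides, and one of them is odd. By
maximality this one has no more fixed edges than the whole, so the other side is fixed. -/
theorem Sys.IsMaximalOdd.fixes_side {t : Sys m e} {σ : Equiv.Perm (Fin e)}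
    (hm : t.IsMaximalOdd σ) (ht : t.IsTree) {h : Fin e} {u w : Finset (Fin e)} (hh : σ h = h)
    (hu : u ∈ t.stars) (hw : w ∈ t.stars) (huw : u ≠ w) (hhu : h ∈ u) (hhw : h ∈ w)
    (hσu : u.image σ = u) : (∀ i, t.EdgeSide h u i → σ i = i) ∨
      ∀ i, t.EdgeSide h w i → σ i = i := by
  have hσw := ht.image_eq_of_image_eq hm.1 hh hu hw hhu hhw hσu
  obtain ⟨τ, hτ, hτ1, hτ2⟩ := ht.exists_restrict hm.1 hh hu hw huw hhu hhw hσu hσw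
  obtain ⟨ρ, hρ, hρ1, hρ2⟩ := ht.exists_restrict hm.1 hh hw hu huw.symm hhw hhu hσw hσu
  have hmul : σ = τ * ρ := by
    ext1 i
    rw [Equiv.Perm.mul_apply]
    by_cases hi : i = h
    · rw [hi, hρ2 h fun h' => h'.1 rfl, hτ2 h fun h' => h'.1 rfl, hh]
    · rcases ht.edgeSide_or hu hw huw hhu hhw hi with h1 | h1
      · rw [hρ2 i (ht.not_edgeSide hu hw huw hhu hhw h1), hτ1 i h1]
      · have := Sys.edgeSide_apply hm.1 hh h1
        rw [hσw] at this
        rw [hρ1 i h1, hτ2 _ (ht.not_edgeSide hw hu huw.symm hhw hhu this)]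
  have hτf : ∀ i, σ i = i → τ i = i := fun i hi => by
    by_cases h1 : t.EdgeSide h u i
    · rw [hτ1 i h1, hi]
    · exact hτ2 i h1
  have hρf : ∀ i, σ i = i → ρ i = i := fun i hi => by
    by_cases h1 : t.EdgeSide h w i
    · rw [hρ1 i h1, hi]
    · exact hρ2 i h1
  have hsign := hm.2.1
  rw [hmul, map_mul] at hsign
  rcases Int.units_eq_one_or (Equiv.Perm.sign τ) with h1 | h1
  · rw [h1, one_mul] at hsign
    exact Or.inl fun i hi => hm.apply_of_apply hρ hsign hρf
      (hρ2 i (ht.not_edgeSide hu hw huw hhu hhw hi))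
  · exact Or.inr fun i hi => hm.apply_of_apply hτ h1 hτf
      (hτ2 i (ht.not_edgeSide hw hu huw.symm hhw hhu hi))

/-- A fixed edge is not inverted. If `σ` exchanged the sides of `h`, it could be corrected by an
involution exchanging them, which is even because `n` is even, to an odd automorphism that is the
identity on one side; this contradicts maximality. -/
theorem Sys.IsMaximalOdd.image_eq {t : Sys m e} {σ : Equiv.Perm (Fin e)}
    (hm : t.IsMaximalOdd σ) (ht : t.IsTree) {n : ℕ} (he : e = 2 * n + 1) (hn : Even n) {h : Fin e}
    {u : Finset (Fin e)} (hh : σ h = h) (hu : u ∈ t.stars) (hhu : h ∈ u) : u.image σ = u := by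
  obtain ⟨w, hw, hwu, hhw, hends⟩ := ht.exists_other_end hu hhu
  by_contra hne
  have hσu : u.image σ = w := (hends _ (image_mem_of_relabel_eq hm.1 hu)
    (Finset.mem_image.2 ⟨h, hhu, hh⟩)).resolve_left hne
  have hσw : w.image σ = u := (hends _ (image_mem_of_relabel_eq hm.1 hw)
    (Finset.mem_image.2 ⟨h, hhw, hh⟩)).resolve_right fun h' => hwu.symm
      (image_inj σ (hσu.trans h'.symm))
  have hfix : ∀ i, σ i = i → i = h := by
    intro i hi
    by_contra hne
    rcases ht.edgeSide_or hu hw hwu.symm hhu hhw hne with h1 | h1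
    · have := Sys.edgeSide_apply hm.1 hh h1
      rw [hi, hσu] at this
      exact ht.not_edgeSide hu hw hwu.symm hhu hhw h1 this
    · have := Sys.edgeSide_apply hm.1 hh h1
      rw [hi, hσw] at this
      exact ht.not_edgeSide hu hw hwu.symm hhu hhw this h1
  -- Here `μ` is `σ ^ 2` on the side of `w` and the identity elsewhere. Then `ρ = μ * σ⁻¹` is `σ` on
  -- the side of `u` and `σ⁻¹` on the side of `w`, hence an involution.
  obtain ⟨μ, hμ, hμ1, hμ2⟩ := ht.exists_restrict (relabel_pow_eq hm.1 2) (h := h)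
    (by rw [pow_two, Equiv.Perm.mul_apply, hh, hh]) hw hu hwu hhw hhu
    (by rw [pow_two, Equiv.Perm.coe_mul, ← Finset.image_image, hσw, hσu])
    (by rw [pow_two, Equiv.Perm.coe_mul, ← Finset.image_image, hσu, hσw])
  have hμh : μ h = h := hμ2 h fun h' => h'.1 rfl
  -- `ρ` exchanges the two sides
  have hρ : ∀ i, i ≠ h → ∀ j, σ j = i → (t.EdgeSide h u i → μ j = σ i) ∧
      (t.EdgeSide h w i → μ j = j) := by
    rintro i hi j rfl
    have hj : j ≠ h := fun h' => hi (h' ▸ hh)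
    constructor
    · intro h1
      have : t.EdgeSide h w j := (ht.edgeSide_or hu hw hwu.symm hhu hhw hj).resolve_left
        fun h2 => ht.not_edgeSide hu hw hwu.symm hhu hhw h1
          (hσu ▸ Sys.edgeSide_apply hm.1 hh h2)
      rw [hμ1 j this]
      rfl
    · intro h1
      refine hμ2 j fun h2 => ht.not_edgeSide hu hw hwu.symm hhu hhw
        (hσw ▸ Sys.edgeSide_apply hm.1 hh h2) h1
  obtain ⟨ρ, hρdef⟩ : ∃ ρ : Equiv.Perm (Fin e), ρ = μ * σ⁻¹ := ⟨_, rfl⟩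
  have hρu' : ∀ i, t.EdgeSide h u i → ρ i = σ i := fun i hi => by
    rw [hρdef]; exact (hρ i hi.1 (σ⁻¹ i) (σ.apply_symm_apply i)).1 hi
  have hρw' : ∀ i, t.EdgeSide h w i → ρ i = σ⁻¹ i := fun i hi => by
    rw [hρdef]; exact (hρ i hi.1 (σ⁻¹ i) (σ.apply_symm_apply i)).2 hi
  have hρh : ρ h = h := by
    have : σ⁻¹ h = h := σ.symm_apply_eq.2 hh.symm
    rw [hρdef, Equiv.Perm.mul_apply, this, hμh]
  have hsq : ρ ^ 2 = 1 := by
    ext1 i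
    rw [pow_two, Equiv.Perm.mul_apply, Equiv.Perm.one_apply]
    by_cases hi : i = h
    · rw [hi, hρh, hρh]
    · rcases ht.edgeSide_or hu hw hwu.symm hhu hhw hi with h1 | h1
      · rw [hρu' i h1, hρw' _ (hσu ▸ Sys.edgeSide_apply hm.1 hh h1)]
        exact σ.symm_apply_apply i
      · have h2 : t.EdgeSide h u (σ⁻¹ i) := by
          have hj : σ⁻¹ i ≠ h := fun h' => hi (by rw [← hh, ← h']; exact (σ.apply_symm_apply i).symm)
          refine (ht.edgeSide_or hu hw hwu.symm hhu hhw hj).resolve_right fun h3 => ?_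
          have h4 : σ (σ⁻¹ i) = i := σ.apply_symm_apply i
          have := Sys.edgeSide_apply hm.1 hh h3
          rw [hσw, h4] at this
          exact ht.not_edgeSide hu hw hwu.symm hhu hhw this h1
        rw [hρw' i h1, hρu' _ h2]
        exact σ.apply_symm_apply i
  have hρfix : ∀ i, ρ i = i ↔ i = h := by
    refine fun i => ⟨fun hi => ?_, fun hi => hi ▸ hρh⟩
    by_contra hne
    rcases ht.edgeSide_or hu hw hwu.symm hhu hhw hne with h1 | h1
    · exact hne (hfix i ((hρu' i h1).symm.trans hi))
    · have h2 := (hρw' i h1).symm.trans hi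
      exact hne (hfix i (σ.symm_apply_eq.1 h2).symm)
  have hcard : Fintype.card (Function.fixedPoints ρ) = 1 :=
    Fintype.card_eq_one_iff.2 ⟨⟨h, hρh⟩, fun y => Subtype.ext ((hρfix y.1).1 y.2)⟩
  -- The involution fixes only `h` among the `2 * n + 1` edges, so it is a product of `n`
  -- transpositions.
  have hsρ : Equiv.Perm.sign ρ = 1 := by
    rw [Equiv.Perm.sign_of_pow_two_eq_one hsq, hcard, Fintype.card_fin, he,
      show (2 * n + 1 - 1) / 2 = n by omega, hn.neg_one_pow]
  have hsμ : Equiv.Perm.sign μ = -1 := by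
    have : μ = ρ * σ := by rw [hρdef, inv_mul_cancel_right]
    rw [this, map_mul, hsρ, one_mul, hm.2.1]
  -- By maximality `μ` fixes no edge but `h`, although it is the identity on the side of `u`. So
  -- that side has no edges, and neither has the other one.
  have hμid : ∀ i, μ i = i → i = h := fun i hi => hfix i
    (hm.apply_of_apply hμ hsμ (fun j hj => by rw [hfix j hj, hμh]) hi)
  have hside : ∀ i, i = h := by
    intro i
    by_contra hi
    rcases ht.edgeSide_or hu hw hwu.symm hhu hhw hi with h1 | h1
    · exact hi (hμid i (hμ2 i (ht.not_edgeSide hu hw hwu.symm hhu hhw h1)))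
    · have h2 := Sys.edgeSide_apply hm.1 hh h1
      rw [hσw] at h2
      exact h2.1 (hμid _ (hμ2 _ (ht.not_edgeSide hu hw hwu.symm hhu hhw h2)))
  have : σ = 1 := by
    ext1 i
    rw [Equiv.Perm.one_apply, hside (σ i), ← hside i]
  have h1 := hm.2.1
  rw [this, map_one] at h1
  exact absurd h1 (by decide)

/-- At a vertex with a fixed edge the other two edges are fixed or exchanged. If they were never
exchanged, fixedness would spread over the whole tree by connectedness, and `σ` would be the
identity. -/
theorem Sys.IsMaximalOdd.exists_swapped {t : Sys m e} {σ : Equiv.Perm (Fin e)}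
    (hm : t.IsMaximalOdd σ) (ht : t.IsTree) (hd : t.degree = 0) {n : ℕ} (he : e = 2 * n + 1)
    (hn : Even n) {h : Fin e} (hh : σ h = h) :
    ∃ p a b, p ≠ a ∧ p ≠ b ∧ a ≠ b ∧ {p, a, b} ∈ t.stars ∧ σ p = p ∧ σ a = b ∧ σ b = a := by
  by_contra hno
  have hstep : ∀ y ∈ t.stars, ∀ i ∈ y, σ i = i → ∀ j ∈ y, σ j = j := by
    intro y hy i hi hσi j hj
    have hσy := hm.image_eq ht he hn hσi hy hi
    rcases ht.valence y hy with hc | hc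
    · obtain ⟨k, rfl⟩ := Finset.card_eq_one.1 hc
      rw [Finset.mem_singleton] at hi hj
      rw [hj, ← hi, hσi]
    · have hc3 := card_of_degree_zero hd (mem_internal.2 ⟨hy, hc⟩)
      have hc2 : (y.erase i).card = 2 := by rw [Finset.card_erase_of_mem hi, hc3]
      obtain ⟨a, b, hab, hyab⟩ := Finset.card_eq_two.1 hc2
      have hy' : y = {i, a, b} := by rw [← Finset.insert_erase hi, hyab]
      have hia : i ≠ a := fun h' => by
        have : a ∈ y.erase i := by rw [hyab]; simp
        exact (Finset.mem_erase.1 this).1 h'.symm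
      have hib : i ≠ b := fun h' => by
        have : b ∈ y.erase i := by rw [hyab]; simp
        exact (Finset.mem_erase.1 this).1 h'.symm
      have hσ : ∀ k ∈ y, σ k ∈ y := fun k hk => by
        have := Finset.mem_image_of_mem σ hk
        rwa [hσy] at this
      have ha : σ a = a ∨ σ a = b := by
        have := hσ a (by rw [hy']; simp)
        rw [hy', Finset.mem_insert, Finset.mem_insert, Finset.mem_singleton] at this
        exact this.resolve_left fun h' => hia (σ.injective (hσi.trans h'.symm))
      have hb : σ b = a ∨ σ b = b := by
        have := hσ b (by rw [hy']; simp)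
        rw [hy', Finset.mem_insert, Finset.mem_insert, Finset.mem_singleton] at this
        exact this.resolve_left fun h' => hib (σ.injective (hσi.trans h'.symm))
      rcases ha with ha | ha
      · rw [hy', Finset.mem_insert, Finset.mem_insert, Finset.mem_singleton] at hj
        have hb' := hb.resolve_left fun h' => hab (σ.injective (ha.trans h'.symm))
        rcases hj with rfl | rfl | rfl <;> assumption
      · have hb' := hb.resolve_right fun h' => hab (σ.injective (ha.trans h'.symm))
        exact absurd ⟨i, a, b, hia, hib, hab, hy' ▸ hy, hσi, ha, hb'⟩ hno
  obtain ⟨u, -, -, hu, -, hhu, -⟩ := ht.exists_ends h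
  have hall := ht.conn (fun x => ∀ j ∈ x, σ j = j) ⟨u, hu, hstep u hu h hhu hh⟩
    (fun x _ hx y hy i hix hiy => hstep y hy i hiy (hx i hix))
  have : σ = 1 := by
    ext1 i
    obtain ⟨x, -, -, hx, -, hix, -⟩ := ht.exists_ends i
    exact hall x hx i hix
  have h1 := hm.2.1
  rw [this, map_one] at h1
  exact absurd h1 (by decide)

/-! ### Trees with one four-valent vertex, and trees with reversing automorphisms as boundaries. -/

theorem boundary_cls_of_degree_one {t : Sys m e} (hd : t.degree = 1) {a b c d : Fin e}
    (hab : a ≠ b) (hac : a ≠ c) (had : a ≠ d) (hbc : b ≠ c) (hbd : b ≠ d) (hcd : c ≠ d)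
    (hv : {a, b, c, d} ∈ t.stars) :
    boundary m (cls t) = cls (t.expand {a, b, c, d} {{a, b}, {c, d}})
      + (cls (t.expand {a, b, c, d} {{a, c}, {b, d}})
        + cls (t.expand {a, b, c, d} {{a, d}, {b, c}})) := by
  have hc : ({a, b, c, d} : Finset (Fin e)).card = 4 := by
    rw [Finset.card_eq_succ]
    refine ⟨a, {b, c, d}, by simp [hab, hac, had], rfl, ?_⟩
    exact Finset.card_eq_three.2 ⟨b, c, d, hbc, hbd, hcd, rfl⟩
  rw [boundary_cls, Finset.sum_eq_single_of_mem _ hv, sum_partitions_four hab hac had hbc hbd hcd]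
  intro w hw hne
  rw [partitions_eq_empty, Finset.sum_empty]
  rw [Sys.degree_eq_sum, ← Sys.sum_stars_erase hv, hc] at hd
  have := Finset.single_le_sum (f := fun w : Finset (Fin e) => w.card - 3)
    (fun _ _ => Nat.zero_le _) (Finset.mem_erase.2 ⟨hne, hw⟩)
  omega

/-- Away from the new edge the expansion still shows all vertices other than `v`. This makes an
automorphism of the expansion descend to the contracted tree. -/
theorem expand_injective {t t₂ : Sys m e} {v : Finset (Fin e)} {P : Finset (Finset (Fin e))}
    (hv : v ∈ t.stars) (hv₂ : v ∈ t₂.stars) (h : t.expand v P = t₂.expand v P) : t = t₂ := by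
  have key : ∀ (s : Sys m e), v ∈ s.stars → ∀ x, x ∈ s.stars ↔ x = v ∨
      up x ∈ (s.expand v P).stars := by
    intro s hs x
    rw [Sys.expand_eq_repl, Sys.mem_repl]
    constructor
    · intro hx
      by_cases hxv : x = v
      · exact Or.inl hxv
      · exact Or.inr (Or.inl ⟨x, hx, hxv, rfl⟩)
    · rintro (rfl | ⟨w, hw, -, hwx⟩ | hx)
      · exact hs
      · rw [up_inj] at hwx; exact hwx ▸ hw
      · exact absurd (zero_mem_of_mem_image_ins hx) zero_notMem_up
  ext1
  · ext x
    rw [key t hv, key t₂ hv₂, h]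
  · funext i
    have := congrArg (fun s => Sys.label s i.succ) h
    simpa [Sys.expand] using this

/-- A tree with an orientation reversing automorphism that exchanges two edges `a` and `b` at one
end of an edge and fixes the edges at its other end is a boundary. -/
theorem cls_mem_map_boundary_of_swapped {s : Sys m (e + 1)} (hs : s.IsUnrooted)
    {k : ℕ} (hk : s.univalent.card = k) (hd : s.degree = 0) {τ : Equiv.Perm (Fin e)}
    (hτ : s.relabel (upPerm τ) = s) (hsign : Equiv.Perm.sign τ = -1) {a b c d : Fin e}
    (hab : a ≠ b) (hcd : c ≠ d) (hA : ins {a, b} ∈ s.stars) (hB : ins {c, d} ∈ s.stars)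
    (hAB : ({a, b} : Finset (Fin e)) ≠ {c, d}) (hl : s.label 0 = none)
    (ha : τ a = b) (hb : τ b = a) (hc : τ c = c) (hd' : τ d = d) :
    cls s ∈ (unrootedChains m k 1).map (boundary m) := by
  obtain ⟨t, hv, hhalf, hdiff, rfl⟩ := exists_eq_expand hs.toIsTree hl hA hB hAB
    (Finset.card_pair hab).ge (Finset.card_pair hcd).ge
  have hdisj : Disjoint ({a, b} : Finset (Fin e)) {c, d} := by
    rw [← hdiff]; exact Finset.disjoint_sdiff
  simp only [Finset.disjoint_insert_left, Finset.disjoint_singleton_left, Finset.mem_insert,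
    Finset.mem_singleton, not_or] at hdisj
  obtain ⟨⟨hac, had⟩, hbc, hbd⟩ := hdisj
  have ht := (Sys.isUnrooted_expand_iff hv hhalf).1 hs
  have htd := Sys.degree_expand hv hhalf
  rw [hd, zero_add] at htd
  rw [Sys.card_univalent_expand hv hhalf] at hk
  have hvv : ({a, b} ∪ {c, d} : Finset (Fin e)) = {a, b, c, d} := by
    rw [Finset.insert_union, Finset.singleton_union]
  rw [hdiff] at hτ ⊢
  rw [hvv] at hτ hv ⊢
  have hva : ({a, b, c, d} : Finset (Fin e)).image τ = {a, b, c, d} := by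
    simp only [Finset.image_insert, Finset.image_singleton, ha, hb, hc, hd']
    rw [Finset.insert_comm]
  have htτ : t.relabel τ = t := by
    refine expand_injective (v := {a, b, c, d}) (P := {{a, b}, {c, d}}) ?_ hv ?_
    · rw [← hva]; exact Sys.image_mem_relabel.2 hv
    · have := expand_relabel t τ {a, b, c, d} {{a, b}, {c, d}}
      rw [hva, hτ] at this
      rw [← this]
      simp only [Finset.image_insert, Finset.image_singleton, ha, hb, hc, hd']
      rw [Finset.pair_comm b a]
  -- The automorphism `τ` exchanges `a` with `b` and fixes `c` and `d`, so it interchanges the other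
  -- two expansions; being odd, it makes their classes cancel.
  have hX : cls (t.expand {a, b, c, d} {{a, d}, {b, c}})
      = - cls (t.expand {a, b, c, d} {{a, c}, {b, d}}) := by
    have := expand_relabel t τ {a, b, c, d} {{a, c}, {b, d}}
    rw [hva, htτ] at this
    simp only [Finset.image_insert, Finset.image_singleton, ha, hb, hc, hd'] at this
    rw [Finset.pair_comm ({b, c} : Finset (Fin e)) {a, d}] at this
    rw [this, cls_relabel, sign_upPerm, hsign]
    simp
  refine ⟨cls t, cls_mem_unrootedChains ht hk htd.symm, ?_⟩
  rw [boundary_cls_of_degree_one htd.symm hab hac had hbc hbd hcd hv, hX, add_neg_cancel, add_zero]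

/-- If an automorphism exchanges two of the three edges at a vertex and the third edge is a leaf,
then the number of trivalent vertices is odd. -/
theorem odd_card_internal_of_swapped {t : Sys m e} (ht : t.IsTree) {σ : Equiv.Perm (Fin e)}
    (hσ : t.relabel σ = t) {p a b : Fin e} (hpa : p ≠ a) (hpb : p ≠ b) (hab : a ≠ b)
    (hu : {p, a, b} ∈ t.stars) (hp : σ p = p) (ha : σ a = b) (hb : σ b = a)
    (hw : {p} ∈ t.stars) : Odd t.internal.card := by
  have hc : ({p, a, b} : Finset (Fin e)).card = 3 :=
    Finset.card_eq_three.2 ⟨p, a, b, hpa, hpb, hab, rfl⟩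
  have hne : ({p, a, b} : Finset (Fin e)) ≠ {p} := fun h => by rw [h] at hc; simp at hc
  have h1 := ht.sum_far hu (fun x => if 3 ≤ x.card then 1 else 0)
  have h2 := Sys.sum_stars_erase hu (fun x : Finset (Fin e) => if 3 ≤ x.card then 1 else 0)
  have hσu : ({p, a, b} : Finset (Fin e)).image σ = {p, a, b} := by
    simp only [Finset.image_insert, Finset.image_singleton, ha, hb, hp]
    rw [Finset.pair_comm]
  have h3 := Sys.far_relabel t σ a {p, a, b}
  rw [hσ, hσu, ha] at h3
  have h4 : t.far {p, a, b} p = {{p}} := by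
    rw [ht.far_eq_side hu hw hne (by simp) (by simp)]
    refine Finset.eq_singleton_iff_unique_mem.2 ⟨Sys.self_mem_side hw, ?_⟩
    exact Sys.side_induction (p := fun x => x = {p}) hw rfl
      (fun x _ hx y _ i hi hix _ => absurd (by simpa [hx] using hix) hi)
  -- Beyond the leaf `p` there is no internal vertex, and the branches at `a` and `b` are
  -- interchanged by `σ`. With the vertex itself the count is one more than an even number.
  rw [Finset.sum_insert (by simp [hpa, hpb]), Finset.sum_pair hab, h3, h4,
    Finset.sum_image fun _ _ _ _ h => image_inj σ h] at h1
  simp only [Finset.card_image_of_injective _ σ.injective, Finset.sum_singleton,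
    Finset.card_singleton] at h1
  rw [hc, if_pos le_rfl] at h2
  rw [Sys.internal, Finset.card_filter, ← h2, ← h1]
  exact ⟨∑ x ∈ t.far {p, a, b} a, if 3 ≤ x.card then 1 else 0, by simp; ring⟩

/-- A maximal reversing automorphism exchanges `a` and `b` at one end of a fixed edge `p`, so it is
the identity beyond `p`. Evenness of `n` excludes that `p` is a leaf edge, and the tree obtained by
contracting `p` bounds. -/
theorem cls_mem_map_boundary_of_not_evenAut {t : Sys m e} (ht : t.IsUnrooted) {n : ℕ}
    (hk : t.univalent.card = n + 2) (hd : t.degree = 0) (hn : Even n) (hodd : ¬ t.EvenAut) :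
    cls t ∈ (unrootedChains m (n + 2) 1).map (boundary m) := by
  obtain ⟨hint, he⟩ := ht.toIsTree.card_internal hd hk
  obtain ⟨σ, r, hm, hpow⟩ := Sys.exists_isMaximalOdd hodd
  have : Fact (Nat.Prime 2) := ⟨Nat.prime_two⟩
  -- A permutation of 2-power order acting on the odd number `2 * n + 1` of edges has a fixed edge.
  obtain ⟨h, hh⟩ := Equiv.Perm.exists_fixed_point_of_prime (p := 2)
    (by rw [Fintype.card_fin, he]; omega) hpow
  obtain ⟨p, a, b, hpa, hpb, hab, hu, hp, ha, hb⟩ := hm.exists_swapped ht.toIsTree hd he hn hh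
  obtain ⟨w, hw, hwu, hpw, -⟩ := ht.toIsTree.exists_other_end hu (i := p) (by simp)
  have hσu := hm.image_eq ht.toIsTree he hn hp hu (by simp)
  have hfix := (hm.fixes_side ht.toIsTree hp hu hw hwu.symm (by simp) hpw hσu).resolve_left
    fun h' => hab ((h' a ⟨hpa.symm, _, Sys.self_mem_side hu, by simp⟩).symm.trans ha)
  rcases ht.valence w hw with hc | hc
  · obtain ⟨q, rfl⟩ := Finset.card_eq_one.1 hc
    rw [Finset.mem_singleton] at hpw
    subst hpw
    have := odd_card_internal_of_swapped ht.toIsTree hm.1 hpa hpb hab hu hp ha hb hw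
    rw [hint] at this
    exact absurd hn (Nat.not_even_iff_odd.2 this)
  · have hcu : ({p, a, b} : Finset (Fin e)).card = 3 :=
      Finset.card_eq_three.2 ⟨p, a, b, hpa, hpb, hab, rfl⟩
    have hl := ht.label_eq_none hu hw hwu.symm (by simp) hpw hcu.ge hc
    have hc2 : (w.erase p).card = 2 := by
      rw [Finset.card_erase_of_mem hpw, card_of_degree_zero hd (mem_internal.2 ⟨hw, hc⟩)]
    obtain ⟨c, d, hcd, hwcd⟩ := Finset.card_eq_two.1 hc2
    have hpc : c ≠ p := (Finset.mem_erase.1 (hwcd ▸ Finset.mem_insert_self c {d})).1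
    have hpd : d ≠ p := (Finset.mem_erase.1 (hwcd ▸ (by simp : d ∈ ({c, d} : Finset (Fin e))))).1
    have hw' : w = {p, c, d} := by rw [← Finset.insert_erase hpw, hwcd]
    subst hw'
    have hσc := hfix c ⟨hpc, _, Sys.self_mem_side hw, by simp⟩
    have hσd := hfix d ⟨hpd, _, Sys.self_mem_side hw, by simp⟩
    subst he
    -- The edge `p` to be contracted is renumbered `0`; the conjugate of `σ` by `π` fixes `0` and
    -- comes from a permutation `τ` of the other edges.
    obtain ⟨π, hπ⟩ : ∃ π : Equiv.Perm (Fin (2 * n + 1)), π p = 0 :=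
      ⟨Equiv.swap p 0, Equiv.swap_apply_left _ _⟩
    have hπi : ∀ i, i ≠ p → ∃ j : Fin (2 * n), π i = j.succ := fun i hi =>
      (Fin.exists_succ_eq.2 fun h' => hi (π.injective (h'.trans hπ.symm))).imp fun _ h => h.symm
    have hinv : ∀ i, π⁻¹ (π i) = i := π.symm_apply_apply
    obtain ⟨τ, hτ⟩ := exists_upPerm (σ := π * σ * π⁻¹) (by
      rw [← hπ, Equiv.Perm.mul_apply, Equiv.Perm.mul_apply, hinv, hp])
    have hconj : ∀ i j i' j', π i = Fin.succ i' → π j = Fin.succ j' → σ i = j → τ i' = j' := by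
      intro i j i' j' hi hj hij
      apply Fin.succ_injective
      rw [← upPerm_succ, ← hτ, ← hi, ← hj, Equiv.Perm.mul_apply, Equiv.Perm.mul_apply, hinv, hij]
    obtain ⟨a', ha'⟩ := hπi a hpa.symm
    obtain ⟨b', hb'⟩ := hπi b hpb.symm
    obtain ⟨c', hc'⟩ := hπi c hpc
    obtain ⟨d', hd'⟩ := hπi d hpd
    have hins : ∀ x y x' y', π x = Fin.succ x' → π y = Fin.succ y' →
        ins {x', y'} = ({p, x, y} : Finset (Fin (2 * n + 1))).image π := by
      intro x y x' y' hx hy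
      simp [Finset.image_insert, hπ, hx, hy, ins, up]
    have hnepair : ({p, a, b} : Finset (Fin (2 * n + 1))).image π ≠
        ({p, c, d} : Finset (Fin (2 * n + 1))).image π := fun h' => hwu.symm (image_inj π h')
    rw [← hins a b a' b' ha' hb', ← hins c d c' d' hc' hd'] at hnepair
    have key : cls (t.relabel π) ∈ (unrootedChains m (n + 2) 1).map (boundary m) := by
      refine cls_mem_map_boundary_of_swapped (Sys.isUnrooted_relabel ht π)
        ((Sys.card_univalent_relabel t π).trans hk) ((degree_relabel t π).trans hd) (τ := τ)
        (a := a') (b := b') (c := c') (d := d') ?_ ?_ ?_ ?_ ?_ ?_ (fun h' => hnepair (by rw [h'])) ?_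
        (hconj a b a' b' ha' hb' ha) (hconj b a b' a' hb' ha' hb)
        (hconj c c c' c' hc' hc' hσc) (hconj d d d' d' hd' hd' hσd)
      · rw [← hτ, ← Sys.relabel_mul, inv_mul_cancel_right, Sys.relabel_mul, hm.1]
      · rw [← sign_upPerm, ← hτ, map_mul, map_mul, map_inv, Int.units_inv_eq_self, mul_right_comm,
          Int.units_mul_self, one_mul, hm.2.1]
      · rintro rfl; exact hab (π.injective (ha'.trans hb'.symm))
      · rintro rfl; exact hcd (π.injective (hc'.trans hd'.symm))
      · rw [hins a b a' b' ha' hb']; exact Sys.image_mem_relabel.2 hu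
      · rw [hins c d c' d' hc' hd']; exact Sys.image_mem_relabel.2 hw
      · rw [← hπ, Sys.label_relabel, hl]
    rw [← sign_smul_sign_smul π (cls t), ← cls_relabel]
    exact AddSubgroup.zsmul_mem _ key _

/-- The kernel of attaching root edges to unitrivalent trees consists of boundaries. -/
theorem mem_map_boundary_of_attachRoot_eq_zero {n : ℕ} (hn : 1 ≤ n) {x : Chains m}
    (hx : x ∈ unrootedChains m (n + 2) 0) (h0 : attachRoot m x = 0) :
    x ∈ (unrootedChains m (n + 2) 1).map (boundary m) := by
  obtain ⟨ρ, hρ⟩ := exists_forgetRoot_attachRoot m n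
  have hnx : (n : ℤ) • x = 0 := by rw [← hρ x hx, h0, map_zero]
  have htor := mem_torsionSpan hx (by exact_mod_cast (by omega : n ≠ 0)) hnx
  rcases Nat.even_or_odd n with he | ho
  · refine (AddSubgroup.closure_le _).2 ?_ htor
    rintro _ ⟨e, t, ht, hk, hd, hodd, rfl⟩
    exact cls_mem_map_boundary_of_not_evenAut ht hk hd he hodd
  · have h2 := two_smul_torsionSpan htor
    obtain ⟨r, hr⟩ := ho
    -- Both `n = 2 * r + 1` and `2` annihilate `x`.
    have : x = 0 := by
      have h3 : (n : ℤ) • x = (r : ℤ) • (2 : ℤ) • x + x := by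
        rw [hr, smul_smul]; push_cast; rw [add_smul, one_smul, mul_comm]
      rwa [h2, smul_zero, zero_add, hnx, eq_comm] at h3
    rw [this]
    exact zero_mem _

/-! ### Cyclic orderings -/

section Cycles

variable {α β : Type*}

theorem cycle_three_eq_iff {a b c p q r : α} : (([a, b, c] : Cycle α) = ([p, q, r] : Cycle α)) ↔
    (a = p ∧ b = q ∧ c = r) ∨ (a = q ∧ b = r ∧ c = p) ∨ (a = r ∧ b = p ∧ c = q) := by
  rw [Cycle.coe_eq_coe, ← List.mem_cyclicPermutations_iff]
  simp [List.cyclicPermutations]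

theorem cycle_rotate (a b c : α) : ([a, b, c] : Cycle α) = ([b, c, a] : Cycle α) :=
  cycle_three_eq_iff.2 (Or.inr (Or.inr ⟨rfl, rfl, rfl⟩))

theorem exists_of_length_eq_three {c : Cycle α} (h : c.length = 3) :
    ∃ p q r : α, c = ([p, q, r] : Cycle α) := by
  induction c using Quotient.inductionOn' with
  | h l =>
    obtain ⟨p, q, r, rfl⟩ := List.length_eq_three.1 (show l.length = 3 from h)
    exact ⟨p, q, r, rfl⟩

theorem exists_of_length_eq_one {c : Cycle α} (h : c.length = 1) :
    ∃ p : α, c = ([p] : Cycle α) := by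
  induction c using Quotient.inductionOn' with
  | h l =>
    obtain ⟨p, rfl⟩ := List.length_eq_one_iff.1 (show l.length = 1 from h)
    exact ⟨p, rfl⟩

theorem nodup_cycle_three {a b c : α} :
    ([a, b, c] : Cycle α).Nodup ↔ a ≠ b ∧ a ≠ c ∧ b ≠ c := by
  rw [Cycle.nodup_coe_iff]
  simp [and_assoc]

theorem toFinset_cycle_three [DecidableEq α] (a b c : α) :
    ([a, b, c] : Cycle α).toFinset = {a, b, c} := by
  rw [Cycle.coe_toFinset]; simp

theorem reverse_cycle_three (a b c : α) :
    ([a, b, c] : Cycle α).reverse = ([a, c, b] : Cycle α) := by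
  rw [Cycle.reverse_coe]
  exact cycle_three_eq_iff.2 (Or.inr (Or.inl ⟨rfl, rfl, rfl⟩))

theorem cycle_map_map {γ : Type*} (f : α → β) (g : β → γ) (c : Cycle α) :
    (c.map f).map g = c.map (g ∘ f) := by
  induction c using Quotient.inductionOn' with
  | h l => exact congrArg _ (List.map_map ..)

theorem cycle_map_id (c : Cycle α) : c.map id = c := by
  induction c using Quotient.inductionOn' with
  | h l => exact congrArg _ (List.map_id l)

theorem cycle_map_injective (σ : Equiv.Perm α) : Function.Injective (Cycle.map σ) := by
  refine Function.LeftInverse.injective (g := Cycle.map σ.symm) fun c => ?_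
  rw [cycle_map_map, Equiv.symm_comp_self, cycle_map_id]

theorem length_cycle_map (f : α → β) (c : Cycle α) : (c.map f).length = c.length := by
  induction c using Quotient.inductionOn' with
  | h l => exact List.length_map ..

theorem nodup_cycle_map {f : α → β} (hf : Function.Injective f) {c : Cycle α} (hc : c.Nodup) :
    (c.map f).Nodup := by
  induction c using Quotient.inductionOn' with
  | h l => exact List.Nodup.map hf hc

theorem toFinset_cycle_map [DecidableEq α] [DecidableEq β] (f : α → β) (c : Cycle α) :
    (c.map f).toFinset = c.toFinset.image f := by
  induction c using Quotient.inductionOn' with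
  | h l =>
    refine Finset.ext fun i => ?_
    rw [show Cycle.map f (Quotient.mk'' l) = (l.map f : Cycle β) from rfl,
      show (Quotient.mk'' l : Cycle α) = (l : Cycle α) from rfl, Cycle.coe_toFinset,
      Cycle.coe_toFinset]
    simp

theorem reverse_cycle_map (f : α → β) (c : Cycle α) : (c.map f).reverse = c.reverse.map f := by
  induction c using Quotient.inductionOn' with
  | h l => exact congrArg (fun l : List β => (l : Cycle β)) (List.map_reverse ..).symm

theorem card_toFinset_cycle [DecidableEq α] {c : Cycle α} (hc : c.Nodup) :
    c.toFinset.card = c.length := by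
  induction c using Quotient.inductionOn' with
  | h l => exact List.toFinset_card_of_nodup hc

theorem toFinset_cycle_reverse [DecidableEq α] (c : Cycle α) :
    c.reverse.toFinset = c.toFinset := by
  induction c using Quotient.inductionOn' with
  | h l => exact List.toFinset_reverse

/-- A set of three elements has only two cyclic orderings. -/
theorem eq_or_eq_reverse [DecidableEq α] {c c' : Cycle α} (hc : c.Nodup) (hc' : c'.Nodup)
    (h3 : c.length = 3) (h : c.toFinset = c'.toFinset) : c' = c ∨ c' = c.reverse := by
  have h3' : c'.length = 3 := by
    rw [← card_toFinset_cycle hc', ← h, card_toFinset_cycle hc, h3]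
  obtain ⟨p, q, r, rfl⟩ := exists_of_length_eq_three h3
  obtain ⟨x, y, z, rfl⟩ := exists_of_length_eq_three h3'
  rw [nodup_cycle_three] at hc hc'
  rw [toFinset_cycle_three, toFinset_cycle_three, Finset.ext_iff] at h
  have hx := (h x).2 (by simp)
  have hy := (h y).2 (by simp)
  have hz := (h z).2 (by simp)
  simp only [Finset.mem_insert, Finset.mem_singleton] at hx hy hz
  rw [reverse_cycle_three, cycle_three_eq_iff, cycle_three_eq_iff]
  obtain ⟨h1, h2, h3⟩ := hc'
  rcases hx with rfl | rfl | rfl <;> rcases hy with rfl | rfl | rfl <;>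
    rcases hz with rfl | rfl | rfl <;> simp_all

end Cycles

/-! ### Renumbering trees with cyclic orderings -/

namespace CycSys

theorem relabel_one (t : CycSys m e) : t.relabel 1 = t := by
  ext1
  · change t.verts.image (Cycle.map id) = _
    rw [show (Cycle.map id : Cycle (Fin e) → Cycle (Fin e)) = id from funext cycle_map_id,
      Finset.image_id]
  · rfl

theorem relabel_mul (t : CycSys m e) (σ τ : Equiv.Perm (Fin e)) :
    t.relabel (τ * σ) = (t.relabel σ).relabel τ := by
  ext1
  · simp only [relabel, Finset.image_image]
    refine Finset.image_congr fun c _ => ?_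
    rw [Function.comp_apply, cycle_map_map, Equiv.Perm.coe_mul]
  · rfl

theorem toSys_relabel (t : CycSys m e) (σ : Equiv.Perm (Fin e)) :
    (t.relabel σ).toSys = t.toSys.relabel σ := by
  ext1
  · simp only [toSys, relabel, Sys.relabel, Finset.image_image]
    refine Finset.image_congr fun c _ => ?_
    exact toFinset_cycle_map σ c
  · rfl

theorem map_mem_relabel {t : CycSys m e} {σ : Equiv.Perm (Fin e)} {c : Cycle (Fin e)} :
    c.map σ ∈ (t.relabel σ).verts ↔ c ∈ t.verts := by
  simp [relabel, (cycle_map_injective σ).eq_iff]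

theorem mem_relabel {t : CycSys m e} {σ : Equiv.Perm (Fin e)} {c : Cycle (Fin e)} :
    c ∈ (t.relabel σ).verts ↔ ∃ c' ∈ t.verts, c'.map σ = c := Finset.mem_image

theorem toFinset_mem {t : CycSys m e} {c : Cycle (Fin e)} (hc : c ∈ t.verts) :
    c.toFinset ∈ t.toSys.stars := Finset.mem_image_of_mem _ hc

theorem mem_stars {t : CycSys m e} {x : Finset (Fin e)} :
    x ∈ t.toSys.stars ↔ ∃ c ∈ t.verts, c.toFinset = x := Finset.mem_image

theorem IsUnitrivalent.relabel {n : ℕ} {t : CycSys m e} (ht : t.IsUnitrivalent n)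
    (σ : Equiv.Perm (Fin e)) : (t.relabel σ).IsUnitrivalent n where
  nodup c hc := by
    obtain ⟨c, hc₀, rfl⟩ := mem_relabel.1 hc
    exact nodup_cycle_map σ.injective (ht.nodup c hc₀)
  injOn c hc c' hc' h := by
    obtain ⟨c, hc₀, rfl⟩ := mem_relabel.1 hc
    obtain ⟨c', hc₀', rfl⟩ := mem_relabel.1 hc'
    rw [toFinset_cycle_map, toFinset_cycle_map] at h
    rw [ht.injOn hc₀ hc₀' (image_inj σ h)]
  isUnrooted := by
    rw [toSys_relabel]
    exact Sys.isUnrooted_relabel ht.isUnrooted σ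
  valence c hc := by
    obtain ⟨c, hc₀, rfl⟩ := mem_relabel.1 hc
    rw [length_cycle_map]
    exact ht.valence c hc₀
  card_internal := by
    rw [← ht.card_internal]
    simp only [CycSys.relabel, Finset.filter_image, length_cycle_map]
    exact Finset.card_image_of_injective _ (cycle_map_injective σ)

/-- Two vertices with two common edges agree. -/
theorem IsUnitrivalent.eq_of_mem_mem {n : ℕ} {t : CycSys m e} (ht : t.IsUnitrivalent n)
    {c c' : Cycle (Fin e)} (hc : c ∈ t.verts) (hc' : c' ∈ t.verts) {i j : Fin e} (hij : i ≠ j)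
    (hi : i ∈ c.toFinset) (hj : j ∈ c.toFinset) (hi' : i ∈ c'.toFinset) (hj' : j ∈ c'.toFinset) :
    c = c' := by
  by_contra hne
  exact hij (ht.isUnrooted.toIsTree.eq_of_mem_mem (toFinset_mem hc) (toFinset_mem hc')
    (fun h => hne (ht.injOn hc hc' h)) hi hi' hj hj')

theorem IsUnitrivalent.degree {n : ℕ} {t : CycSys m e} (ht : t.IsUnitrivalent n) :
    t.toSys.degree = 0 := by
  refine Finset.sum_eq_zero fun x hx => ?_
  obtain ⟨c, hc, rfl⟩ := mem_stars.1 (mem_internal.1 hx).1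
  rw [card_toFinset_cycle (ht.nodup c hc)]
  rcases ht.valence c hc with h | h <;> omega

theorem IsUnitrivalent.card_univalent {n : ℕ} {t : CycSys m (2 * n + 1)}
    (ht : t.IsUnitrivalent n) : t.toSys.univalent.card = n + 2 := by
  have h1 := ht.isUnrooted.toIsTree.card_stars
  have h2 : t.toSys.internal.card = n := by
    refine Eq.trans ?_ ht.card_internal
    rw [← Finset.card_image_of_injOn (s := t.verts.filter _)
      (ht.injOn.mono (Finset.coe_subset.2 (Finset.filter_subset _ _)))]
    congr 1
    ext x
    simp only [mem_internal, mem_stars, Finset.mem_image, Finset.mem_filter]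
    constructor
    · rintro ⟨⟨c, hc, rfl⟩, h⟩
      rw [card_toFinset_cycle (ht.nodup c hc)] at h
      exact ⟨c, ⟨hc, (ht.valence c hc).resolve_left (by omega)⟩, rfl⟩
    · rintro ⟨c, ⟨hc, h⟩, rfl⟩
      exact ⟨⟨c, hc, rfl⟩, by rw [card_toFinset_cycle (ht.nodup c hc), h]⟩
  have h3 : t.toSys.univalent = t.toSys.stars.filter (fun v => ¬ 3 ≤ v.card) := by
    rw [Sys.univalent]
    refine Finset.filter_congr fun v hv => ?_
    rcases ht.isUnrooted.valence v hv with h | h <;> omega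
  have h4 := Finset.card_filter_add_card_filter_not (s := t.toSys.stars) (fun v => 3 ≤ v.card)
  rw [← h3, ← Sys.internal] at h4
  omega

/-- The underlying tree has `e + 1` vertices, so the bound on the number of cyclic orderings forces
one ordering per vertex. -/
theorem isUnitrivalent_of_card_le {n : ℕ} {t : CycSys m e} (hn : ∀ c ∈ t.verts, c.Nodup)
    (ht : t.toSys.IsUnrooted) (hd : t.toSys.degree = 0) (hk : t.toSys.univalent.card = n + 2)
    (hc : t.verts.card ≤ e + 1) : t.IsUnitrivalent n := by
  have hinj : Set.InjOn Cycle.toFinset (t.verts : Set (Cycle (Fin e))) := by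
    rw [← Finset.card_image_iff]
    refine le_antisymm Finset.card_image_le ?_
    rw [← ht.toIsTree.card_stars] at hc
    exact hc
  have hval : ∀ c ∈ t.verts, c.length = 1 ∨ c.length = 3 := by
    intro c hc
    have h1 := card_toFinset_cycle (hn c hc)
    rw [← h1]
    refine (ht.valence _ (toFinset_mem hc)).imp id fun h => ?_
    exact card_of_degree_zero hd (mem_internal.2 ⟨toFinset_mem hc, h⟩)
  refine ⟨hn, hinj, ht, hval, ?_⟩
  rw [← (ht.toIsTree.card_internal hd hk).1, ← Finset.card_image_of_injOn (s := t.verts.filter _)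
    (hinj.mono (Finset.coe_subset.2 (Finset.filter_subset _ _)))]
  congr 1
  ext x
  simp only [mem_internal, mem_stars, Finset.mem_image, Finset.mem_filter]
  constructor
  · rintro ⟨c, ⟨hc, h⟩, rfl⟩
    exact ⟨⟨c, hc, rfl⟩, by rw [card_toFinset_cycle (hn c hc), h]⟩
  · rintro ⟨⟨c, hc, rfl⟩, h⟩
    rw [card_toFinset_cycle (hn c hc)] at h
    exact ⟨c, ⟨hc, (hval c hc).resolve_left (by omega)⟩, rfl⟩

end CycSys

end TreeHomology

namespace TreeHomology
variable {m e n : ℕ}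

/-! ### Compatible numberings -/

/-- The first edge of the block `j`. -/
def edgeFst (j : Fin n) : Fin (2 * n + 1) := ⟨2 * j + 1, by omega⟩

/-- The second edge of the block `j`. -/
def edgeSnd (j : Fin n) : Fin (2 * n + 1) := ⟨2 * j + 2, by omega⟩

theorem edgeFst_inj {j k : Fin n} : edgeFst j = edgeFst k ↔ j = k := by
  simp only [edgeFst, Fin.ext_iff]; omega

theorem edgeSnd_inj {j k : Fin n} : edgeSnd j = edgeSnd k ↔ j = k := by
  simp only [edgeSnd, Fin.ext_iff]; omega

theorem edgeFst_ne_edgeSnd (j k : Fin n) : edgeFst j ≠ edgeSnd k := by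
  simp only [edgeFst, edgeSnd, ne_eq, Fin.ext_iff]; omega

theorem edgeFst_ne_zero (j : Fin n) : edgeFst j ≠ 0 := by
  simp [edgeFst, Fin.ext_iff]

theorem edgeSnd_ne_zero (j : Fin n) : edgeSnd j ≠ 0 := by
  simp [edgeSnd, Fin.ext_iff]

theorem edge_cases (i : Fin (2 * n + 1)) :
    i = 0 ∨ ∃ j : Fin n, i = edgeFst j ∨ i = edgeSnd j := by
  obtain ⟨i, hi⟩ := i
  simp only [edgeFst, edgeSnd, Fin.ext_iff, Fin.val_zero]
  rcases Nat.even_or_odd' i with ⟨k, rfl | rfl⟩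
  · rcases Nat.eq_zero_or_pos k with rfl | hk
    · exact Or.inl rfl
    · exact Or.inr ⟨⟨k - 1, by omega⟩, Or.inr (by simp only; omega)⟩
  · exact Or.inr ⟨⟨k, by omega⟩, Or.inl rfl⟩

/-- The numbers of the edges, grouped in blocks. -/
noncomputable def blockEquiv (n : ℕ) : Option (Fin n ⊕ Fin n) ≃ Fin (2 * n + 1) :=
  Equiv.ofBijective (fun x => x.elim 0 (Sum.elim edgeFst edgeSnd)) (by
    constructor
    · rintro (_ | j | j) (_ | k | k) h
      · rfl
      · exact absurd h.symm (edgeFst_ne_zero k)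
      · exact absurd h.symm (edgeSnd_ne_zero k)
      · exact absurd h (edgeFst_ne_zero j)
      · rw [edgeFst_inj.1 h]
      · exact absurd h (edgeFst_ne_edgeSnd j k)
      · exact absurd h (edgeSnd_ne_zero j)
      · exact absurd h.symm (edgeFst_ne_edgeSnd k j)
      · rw [edgeSnd_inj.1 h]
    · intro i
      rcases edge_cases i with rfl | ⟨j, rfl | rfl⟩
      · exact ⟨none, rfl⟩
      · exact ⟨some (Sum.inl j), rfl⟩
      · exact ⟨some (Sum.inr j), rfl⟩)

/-- A permutation of the blocks is an even permutation of the edges. -/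
theorem sign_eq_one_of_blocks {σ : Equiv.Perm (Fin (2 * n + 1))} (h0 : σ 0 = 0)
    (h : ∀ j : Fin n, ∃ k, σ (edgeFst j) = edgeFst k ∧ σ (edgeSnd j) = edgeSnd k) :
    Equiv.Perm.sign σ = 1 := by
  choose f hf using h
  have hinj : Function.Injective f := fun j k hjk =>
    edgeFst_inj.1 (σ.injective ((hf j).1.trans (hjk ▸ (hf k).1.symm)))
  obtain ⟨π, hπ⟩ : ∃ π : Equiv.Perm (Fin n), ∀ j, π j = f j :=
    ⟨Equiv.ofBijective f (Finite.injective_iff_bijective.1 hinj), fun _ => rfl⟩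
  -- Up to renaming, `σ` acts by the same permutation `π` on first and on second edges, so the sign
  -- of `π` occurs twice.
  have : σ = (blockEquiv n).symm.trans
      ((Equiv.optionCongr (Equiv.Perm.sumCongr π π)).trans (blockEquiv n)) := by
    ext1 i
    obtain ⟨x, rfl⟩ := (blockEquiv n).surjective i
    simp only [Equiv.trans_apply, Equiv.symm_apply_apply]
    rcases x with _ | j | j
    · exact h0
    · exact (hf j).1.trans (by rw [← hπ]; rfl)
    · exact (hf j).2.trans (by rw [← hπ]; rfl)
  rw [this, ← Equiv.trans_assoc, Equiv.Perm.sign_symm_trans_trans, Equiv.optionCongr_sign,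
    Equiv.Perm.sign_sumCongr, Int.units_mul_self]

namespace Sys

theorem EdgeSide.relabel {t : Sys m e} {h i : Fin e} {u : Finset (Fin e)}
    (hi : t.EdgeSide h u i) (σ : Equiv.Perm (Fin e)) :
    (t.relabel σ).EdgeSide (σ h) (u.image σ) (σ i) := by
  obtain ⟨hne, x, hx, hix⟩ := hi
  refine ⟨fun h' => hne (σ.injective h'), x.image σ, ?_, Finset.mem_image_of_mem _ hix⟩
  rw [side_relabel]
  exact Finset.mem_image_of_mem _ hx

/-- All edges at a vertex but one point away from a given edge `r`. -/
theorem IsTree.edgeSide_or_of_ne {t : Sys m e} (ht : t.IsTree) {x : Finset (Fin e)}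
    (hx : x ∈ t.stars) {h h' : Fin e} (hh : h ∈ x) (hh' : h' ∈ x) (hne : h ≠ h') (r : Fin e) :
    t.EdgeSide h x r ∨ t.EdgeSide h' x r := by
  by_cases hr : r = h'
  · exact Or.inl ⟨hr ▸ hne.symm, x, self_mem_side hx, hr ▸ hh'⟩
  by_cases hr' : r = h
  · exact Or.inr ⟨hr, x, self_mem_side hx, hr' ▸ hh⟩
  obtain ⟨w, hw, hwx, hhw, -⟩ := ht.exists_other_end hx hh
  refine (ht.edgeSide_or hx hw hwx.symm hh hhw hr').imp id ?_
  rintro ⟨-, y, hy, hry⟩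
  rw [← ht.far_eq_side hx hw hwx.symm hh hhw] at hy
  exact ⟨hr, y, ht.far_subset_side hx hh' hh hne hy, hry⟩

end Sys

namespace CycSys

/-- The numbering of the edges is compatible with the cyclic orderings. -/
def Compat (t : CycSys m (2 * n + 1)) : Prop :=
  ∀ c ∈ t.verts, c.length = 3 → ∃ (p : Fin (2 * n + 1)) (j : Fin n),
    c = ([p, edgeFst j, edgeSnd j] : Cycle _)

variable {t : CycSys m (2 * n + 1)}

theorem IsUnitrivalent.eq_of_block (ht : t.IsUnitrivalent n) {p p' : Fin (2 * n + 1)} {j : Fin n}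
    (h : ([p, edgeFst j, edgeSnd j] : Cycle _) ∈ t.verts)
    (h' : ([p', edgeFst j, edgeSnd j] : Cycle _) ∈ t.verts) :
    ([p, edgeFst j, edgeSnd j] : Cycle (Fin (2 * n + 1)))
      = ([p', edgeFst j, edgeSnd j] : Cycle (Fin (2 * n + 1))) := by
  refine ht.eq_of_mem_mem h h' (edgeFst_ne_edgeSnd j j) ?_ ?_ ?_ ?_ <;>
    simp

/-- A block determines its vertex, since two vertices share at most one edge. There are `n`
trivalent vertices and `n` blocks, so all blocks occur. -/
theorem Compat.exists_block (hc : t.Compat) (ht : t.IsUnitrivalent n) (j : Fin n) :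
    ∃ p, ([p, edgeFst j, edgeSnd j] : Cycle _) ∈ t.verts := by
  have h1 : ∀ c : t.verts.filter (fun c => c.length = 3), ∃ j : Fin n, ∃ p : Fin (2 * n + 1),
      c.1 = ([p, edgeFst j, edgeSnd j] : Cycle _) := fun c => by
    obtain ⟨p, j, h⟩ := hc c.1 (Finset.mem_filter.1 c.2).1 (Finset.mem_filter.1 c.2).2
    exact ⟨j, p, h⟩
  choose f g hfg using h1
  have hinj : Function.Injective f := fun c c' h => by
    have h2 := (Finset.mem_filter.1 c.2).1
    have h3 := (Finset.mem_filter.1 c'.2).1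
    apply Subtype.ext
    rw [hfg c] at h2
    rw [hfg c', ← h] at h3
    rw [hfg c, hfg c', ← h]
    exact ht.eq_of_block h2 h3
  have hbij := (Fintype.bijective_iff_injective_and_card f).2
    ⟨hinj, by rw [Fintype.card_coe, ht.card_internal, Fintype.card_fin]⟩
  obtain ⟨c, rfl⟩ := hbij.2 j
  exact ⟨g c, by rw [← hfg c]; exact (Finset.mem_filter.1 c.2).1⟩

theorem Compat.exists_child (hc : t.Compat) (ht : t.IsUnitrivalent n) {h : Fin (2 * n + 1)}
    (h0 : h ≠ 0) : ∃ p j, ([p, edgeFst j, edgeSnd j] : Cycle _) ∈ t.verts ∧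
      (h = edgeFst j ∨ h = edgeSnd j) := by
  obtain ⟨j, hj⟩ := (edge_cases h).resolve_left h0
  obtain ⟨p, hp⟩ := hc.exists_block ht j
  exact ⟨p, j, hp, hj⟩

/-- The two block edges of a vertex point away from the edge `0`. Otherwise `p` would point away
from `0`; as `p` is not `0`, it is a block edge of its other end, where by induction on the size of
the side it points the opposite way. -/
theorem Compat.edgeSide (hc : t.Compat) (ht : t.IsUnitrivalent n) {p h : Fin (2 * n + 1)}
    {j : Fin n} (hv : ([p, edgeFst j, edgeSnd j] : Cycle _) ∈ t.verts)
    (hh : h = edgeFst j ∨ h = edgeSnd j) :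
    t.toSys.EdgeSide h {p, edgeFst j, edgeSnd j} 0 := by
  induction hN : (t.toSys.side h {p, edgeFst j, edgeSnd j}).card using Nat.strong_induction_on
    generalizing p h j with
  | _ N ih =>
    subst hN
    have hT := ht.isUnrooted.toIsTree
    have hx := toFinset_mem hv
    rw [toFinset_cycle_three] at hx
    obtain ⟨hpf, hps, -⟩ := nodup_cycle_three.1 (ht.nodup _ hv)
    have hhx : h ∈ ({p, edgeFst j, edgeSnd j} : Finset (Fin (2 * n + 1))) := by
      rcases hh with rfl | rfl <;> simp
    have hph : p ≠ h := by rcases hh with rfl | rfl <;> assumption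
    have hh0 : h ≠ 0 := by
      rcases hh with rfl | rfl
      · exact edgeFst_ne_zero j
      · exact edgeSnd_ne_zero j
    refine (hT.edgeSide_or_of_ne hx (h := p) (by simp) hhx hph 0).resolve_left fun hside => ?_
    obtain ⟨q, k, hv', hk⟩ := hc.exists_child ht hside.1.symm
    have hy := toFinset_mem hv'
    rw [toFinset_cycle_three] at hy
    have hpy : p ∈ ({q, edgeFst k, edgeSnd k} : Finset (Fin (2 * n + 1))) := by
      rcases hk with rfl | rfl <;> simp
    have hjk : j ≠ k := by
      rintro rfl
      rcases hk with rfl | rfl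
      · exact hpf rfl
      · exact hps rfl
    have hxy : ({p, edgeFst j, edgeSnd j} : Finset (Fin (2 * n + 1)))
        ≠ {q, edgeFst k, edgeSnd k} := by
      intro hxy
      have h1 : ([p, edgeFst j, edgeSnd j] : Cycle (Fin (2 * n + 1)))
          = ([q, edgeFst k, edgeSnd k] : Cycle (Fin (2 * n + 1))) :=
        ht.injOn hv hv' (by rw [toFinset_cycle_three, toFinset_cycle_three, hxy])
      rcases cycle_three_eq_iff.1 h1 with ⟨-, h1, -⟩ | ⟨-, h1, -⟩ | ⟨-, -, h1⟩
      · exact hjk (edgeFst_inj.1 h1)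
      · exact edgeFst_ne_edgeSnd _ _ h1
      · exact edgeFst_ne_edgeSnd _ _ h1.symm
    refine hT.not_edgeSide hx hy hxy (by simp) hpy hside (ih _ ?_ hv' hk rfl)
    refine Finset.card_lt_card (Finset.ssubset_iff_subset_ne.2 ⟨?_, ?_⟩)
    · rw [← hT.far_eq_side hx hy hxy (by simp) hpy]
      exact hT.far_subset_side hx hhx (by simp) hph
    · intro heq
      have h1 := Sys.self_mem_side (h := h) hx
      rw [← heq] at h1
      exact hT.notMem_side hy hx hxy.symm hpy (by simp) h1

/-- The edge `p` leads towards `0`: it is `0` itself or a block edge of its other end, where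
`Compat.edgeSide` applies. -/
theorem Compat.not_edgeSide (hc : t.Compat) (ht : t.IsUnitrivalent n) {p : Fin (2 * n + 1)}
    {j : Fin n} (hv : ([p, edgeFst j, edgeSnd j] : Cycle _) ∈ t.verts) :
    ¬ t.toSys.EdgeSide p {p, edgeFst j, edgeSnd j} 0 := by
  intro hside
  have hT := ht.isUnrooted.toIsTree
  obtain ⟨hpf, hps, -⟩ := nodup_cycle_three.1 (ht.nodup _ hv)
  obtain ⟨q, k, hv', hk⟩ := hc.exists_child ht hside.1.symm
  have hside' := hc.edgeSide ht hv' hk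
  have hx := toFinset_mem hv
  have hy := toFinset_mem hv'
  rw [toFinset_cycle_three] at hx hy
  have hpy : p ∈ ({q, edgeFst k, edgeSnd k} : Finset (Fin (2 * n + 1))) := by
    rcases hk with rfl | rfl <;> simp
  refine hT.not_edgeSide hx hy (fun hxy => ?_) (by simp) hpy hside hside'
  have h1 : ([p, edgeFst j, edgeSnd j] : Cycle (Fin (2 * n + 1)))
      = ([q, edgeFst k, edgeSnd k] : Cycle (Fin (2 * n + 1))) :=
    ht.injOn hv hv' (by rw [toFinset_cycle_three, toFinset_cycle_three, hxy])
  rcases cycle_three_eq_iff.1 h1 with ⟨-, h1, -⟩ | ⟨-, h1, -⟩ | ⟨-, -, h1⟩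
  · rw [← edgeFst_inj.1 h1] at hk
    rcases hk with rfl | rfl
    · exact hpf rfl
    · exact hps rfl
  · exact edgeFst_ne_edgeSnd _ _ h1
  · exact edgeFst_ne_edgeSnd _ _ h1.symm

/-- Compatible numberings with the same first edge differ by an even permutation. -/
theorem Compat.sign_eq_one_of_zero (hc : t.Compat) (ht : t.IsUnitrivalent n)
    {σ : Equiv.Perm (Fin (2 * n + 1))} (hσ : (t.relabel σ).Compat) (h0 : σ 0 = 0) :
    Equiv.Perm.sign σ = 1 := by
  refine sign_eq_one_of_blocks h0 fun j => ?_
  obtain ⟨p, hv⟩ := hc.exists_block ht j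
  have hv' := map_mem_relabel (σ := σ).2 hv
  obtain ⟨q, k, hk⟩ := hσ _ hv' (by rw [length_cycle_map]; rfl)
  have hk' := hk
  have himg : ({p, edgeFst j, edgeSnd j} : Finset (Fin (2 * n + 1))).image σ
      = {q, edgeFst k, edgeSnd k} := by
    rw [← toFinset_cycle_three, ← toFinset_cycle_three, ← hk, toFinset_cycle_map]
  rw [hk] at hv'
  have hno := hσ.not_edgeSide (ht.relabel σ) hv'
  -- Since `σ` fixes `0`, it maps edges pointing away from `0` to such edges, so a block edge never
  -- becomes the edge towards `0`. This excludes the two nontrivial rotations below.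
  have hyes : ∀ h, h = edgeFst j ∨ h = edgeSnd j → q ≠ σ h := by
    rintro h hh rfl
    have := (hc.edgeSide ht hv hh).relabel σ
    rw [himg, h0, ← toSys_relabel] at this
    exact hno this
  rw [Cycle.map_coe] at hk'
  rcases cycle_three_eq_iff.1 hk' with ⟨-, h1, h2⟩ | ⟨-, -, h2⟩ | ⟨-, h1, -⟩
  · exact ⟨k, h1, h2⟩
  · exact absurd h2.symm (hyes _ (Or.inr rfl))
  · exact absurd h1.symm (hyes _ (Or.inl rfl))

end CycSys

end TreeHomology

namespace TreeHomology
variable {m e n : ℕ}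

/-! ### Existence of compatible numberings and independence of the first edge. -/

namespace CycSys

variable {t : CycSys m (2 * n + 1)}

theorem Compat.relabel_of {τ : Equiv.Perm (Fin (2 * n + 1))}
    (h : ∀ c ∈ t.verts, c.length = 3 → ∃ (q a b : Fin (2 * n + 1)) (k : Fin n),
      c = ([q, a, b] : Cycle (Fin (2 * n + 1))) ∧ τ a = edgeFst k ∧ τ b = edgeSnd k) :
    (t.relabel τ).Compat := by
  intro c hc h3
  obtain ⟨c, hc₀, rfl⟩ := mem_relabel.1 hc
  rw [length_cycle_map] at h3
  obtain ⟨q, a, b, k, rfl, ha, hb⟩ := h c hc₀ h3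
  exact ⟨τ q, k, by rw [Cycle.map_coe, ← ha, ← hb]; rfl⟩

theorem sign_swap_mul_swap {α : Type*} [DecidableEq α] [Fintype α] {a b c d : α} (hab : a ≠ b)
    (hcd : c ≠ d) : Equiv.Perm.sign (Equiv.swap a b * Equiv.swap c d) = 1 := by
  rw [map_mul, Equiv.Perm.sign_swap hab, Equiv.Perm.sign_swap hcd, Int.units_mul_self]

/-- The first edge may be replaced by an adjacent one. -/
theorem Compat.exists_move_adj (hc : t.Compat) (ht : t.IsUnitrivalent n)
    {x : Finset (Fin (2 * n + 1))} (hx : x ∈ t.toSys.stars) (h0 : 0 ∈ x) {r : Fin (2 * n + 1)}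
    (hr : r ∈ x) : ∃ τ, Equiv.Perm.sign τ = 1 ∧ (t.relabel τ).Compat ∧ τ r = 0 := by
  by_cases hr0 : r = 0
  · exact ⟨1, map_one _, by rwa [relabel_one], hr0⟩
  obtain ⟨c, hcv, rfl⟩ := mem_stars.1 hx
  have h3 : c.length = 3 := (ht.valence c hcv).resolve_left fun h1 => by
    obtain ⟨p, rfl⟩ := exists_of_length_eq_one h1
    simp only [Cycle.coe_toFinset, List.mem_toFinset, List.mem_singleton] at h0 hr
    exact hr0 (hr.trans h0.symm)
  obtain ⟨p, j, rfl⟩ := hc c hcv h3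
  rw [toFinset_cycle_three] at h0 hr
  simp only [Finset.mem_insert, Finset.mem_singleton, (edgeFst_ne_zero j).symm,
    (edgeSnd_ne_zero j).symm, or_false] at h0
  subst h0
  -- Only the vertex between `0` and `r` is affected; at all other trivalent vertices the numbers
  -- stay the same.
  have hother : ∀ c ∈ t.verts, c.length = 3 → c = ([0, edgeFst j, edgeSnd j] : Cycle _) ∨
      ∃ (q : Fin (2 * n + 1)) (k : Fin n), k ≠ j ∧ c = ([q, edgeFst k, edgeSnd k] : Cycle _) := by
    intro c hc' h3'
    obtain ⟨q, k, rfl⟩ := hc c hc' h3'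
    by_cases hk : k = j
    · subst hk; exact Or.inl (ht.eq_of_block hc' hcv)
    · exact Or.inr ⟨q, k, hk, rfl⟩
  have hA := edgeFst_ne_zero j
  have hB := edgeSnd_ne_zero j
  have hAB := edgeFst_ne_edgeSnd j j
  have hfix : ∀ k, k ≠ j → edgeFst k ≠ edgeFst j ∧ edgeFst k ≠ edgeSnd j ∧ edgeFst k ≠ 0 ∧
      edgeSnd k ≠ edgeFst j ∧ edgeSnd k ≠ edgeSnd j ∧ edgeSnd k ≠ 0 := fun k hk =>
    ⟨fun h => hk (edgeFst_inj.1 h), edgeFst_ne_edgeSnd k j, edgeFst_ne_zero k,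
      (edgeFst_ne_edgeSnd j k).symm, fun h => hk (edgeSnd_inj.1 h), edgeSnd_ne_zero k⟩
  simp only [Finset.mem_insert, Finset.mem_singleton] at hr
  rcases hr.resolve_left hr0 with rfl | rfl
  -- A cyclic permutation of the three edges at the vertex follows the rotation of its cyclic
  -- ordering that puts `r` first. Being a three-cycle, it is even.
  · refine ⟨Equiv.swap (edgeFst j) 0 * Equiv.swap 0 (edgeSnd j), sign_swap_mul_swap hA hB.symm,
      Compat.relabel_of fun c hc' h3' => ?_, ?_⟩
    · rcases hother c hc' h3' with rfl | ⟨q, k, hk, rfl⟩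
      · refine ⟨edgeFst j, edgeSnd j, 0, j, cycle_rotate _ _ _, ?_, ?_⟩
        · rw [Equiv.Perm.mul_apply, Equiv.swap_apply_right, Equiv.swap_apply_right]
        · rw [Equiv.Perm.mul_apply, Equiv.swap_apply_left,
            Equiv.swap_apply_of_ne_of_ne hAB.symm hB]
      · obtain ⟨h1, h2, h3, h4, h5, h6⟩ := hfix k hk
        refine ⟨q, edgeFst k, edgeSnd k, k, rfl, ?_, ?_⟩
        · rw [Equiv.Perm.mul_apply, Equiv.swap_apply_of_ne_of_ne h3 h2,
            Equiv.swap_apply_of_ne_of_ne h1 h3]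
        · rw [Equiv.Perm.mul_apply, Equiv.swap_apply_of_ne_of_ne h6 h5,
            Equiv.swap_apply_of_ne_of_ne h4 h6]
    · rw [Equiv.Perm.mul_apply, Equiv.swap_apply_of_ne_of_ne hA hAB, Equiv.swap_apply_left]
  · refine ⟨Equiv.swap (edgeSnd j) 0 * Equiv.swap 0 (edgeFst j), sign_swap_mul_swap hB hA.symm,
      Compat.relabel_of fun c hc' h3' => ?_, ?_⟩
    · rcases hother c hc' h3' with rfl | ⟨q, k, hk, rfl⟩
      · refine ⟨edgeSnd j, 0, edgeFst j, j, (cycle_rotate _ _ _).symm, ?_, ?_⟩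
        · rw [Equiv.Perm.mul_apply, Equiv.swap_apply_left,
            Equiv.swap_apply_of_ne_of_ne hAB hA]
        · rw [Equiv.Perm.mul_apply, Equiv.swap_apply_right, Equiv.swap_apply_right]
      · obtain ⟨h1, h2, h3, h4, h5, h6⟩ := hfix k hk
        refine ⟨q, edgeFst k, edgeSnd k, k, rfl, ?_, ?_⟩
        · rw [Equiv.Perm.mul_apply, Equiv.swap_apply_of_ne_of_ne h3 h1,
            Equiv.swap_apply_of_ne_of_ne h2 h3]
        · rw [Equiv.Perm.mul_apply, Equiv.swap_apply_of_ne_of_ne h6 h4,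
            Equiv.swap_apply_of_ne_of_ne h5 h6]
    · rw [Equiv.Perm.mul_apply, Equiv.swap_apply_of_ne_of_ne hB hAB.symm, Equiv.swap_apply_left]

/-- The first edge is moved step by step to adjacent edges; connectedness reaches every `r`. -/
theorem Compat.exists_move (hc : t.Compat) (ht : t.IsUnitrivalent n) (r : Fin (2 * n + 1)) :
    ∃ τ, Equiv.Perm.sign τ = 1 ∧ (t.relabel τ).Compat ∧ τ r = 0 := by
  have hT := ht.isUnrooted.toIsTree
  obtain ⟨u, -, -, hu, -, hu0, -⟩ := hT.exists_ends 0
  obtain ⟨x, -, -, hx, -, hrx, -⟩ := hT.exists_ends r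
  refine hT.conn (fun x => ∀ r ∈ x, ∃ τ, Equiv.Perm.sign τ = 1 ∧ (t.relabel τ).Compat ∧ τ r = 0)
    ⟨u, hu, fun r hr => hc.exists_move_adj ht hu hu0 hr⟩ ?_ x hx r hrx
  intro y _ hy z hz i hiy hiz r hr
  obtain ⟨τ, hs, hτ, hi⟩ := hy i hiy
  obtain ⟨ρ, hs', hρ, hr'⟩ := hτ.exists_move_adj (ht.relabel τ)
    (by rw [toSys_relabel]; exact Sys.image_mem_relabel.2 hz)
    (hi ▸ Finset.mem_image_of_mem τ hiz) (Finset.mem_image_of_mem τ hr)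
  exact ⟨ρ * τ, by rw [map_mul, hs, hs', one_mul], by rwa [relabel_mul], hr'⟩

/-- Compatible numberings differ by an even permutation. -/
theorem Compat.sign_eq_one (hc : t.Compat) (ht : t.IsUnitrivalent n)
    {σ : Equiv.Perm (Fin (2 * n + 1))} (hσ : (t.relabel σ).Compat) : Equiv.Perm.sign σ = 1 := by
  -- First the edge that `σ` numbers `0` is made the first edge by an even permutation; the rest is
  -- a comparison with the same first edge.
  obtain ⟨τ, hs, hτ, hr⟩ := hc.exists_move ht (σ.symm 0)
  have h1 : (t.relabel τ).relabel (σ * τ⁻¹) = t.relabel σ := by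
    rw [← relabel_mul, inv_mul_cancel_right]
  have h2 : τ⁻¹ 0 = σ.symm 0 := τ.symm_apply_eq.2 hr.symm
  have h3 := hτ.sign_eq_one_of_zero (ht.relabel τ) (σ := σ * τ⁻¹) (by rwa [h1])
    (by rw [Equiv.Perm.mul_apply, h2, Equiv.apply_symm_apply])
  rwa [map_mul, map_inv, hs, inv_one, mul_one] at h3

/-- At each trivalent vertex at least two edges point away from the edge `0`, and an edge points
away from `0` at no more than one of its ends. Listing these pairs vertex by vertex, after `0`, uses
each of the `2 * n + 1` edges once by counting. -/
theorem IsUnitrivalent.exists_compat (ht : t.IsUnitrivalent n) :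
    ∃ σ, (t.relabel σ).Compat := by
  have hT := ht.isUnrooted.toIsTree
  -- The cyclic ordering is rotated so that two edges pointing away from `0` come last.
  have hex : ∀ c ∈ t.verts, c.length = 3 → ∃ p a b : Fin (2 * n + 1),
      c = ([p, a, b] : Cycle (Fin (2 * n + 1))) ∧
      t.toSys.EdgeSide a c.toFinset 0 ∧ t.toSys.EdgeSide b c.toFinset 0 := by
    intro c hc h3
    obtain ⟨p, a, b, rfl⟩ := exists_of_length_eq_three h3
    have hx := toFinset_mem hc
    obtain ⟨hpa, hpb, hab⟩ := nodup_cycle_three.1 (ht.nodup _ hc)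
    have h1 := hT.edgeSide_or_of_ne hx (h := p) (h' := a) (by simp) (by simp) hpa 0
    have h2 := hT.edgeSide_or_of_ne hx (h := p) (h' := b) (by simp) (by simp) hpb 0
    have h3 := hT.edgeSide_or_of_ne hx (h := a) (h' := b) (by simp) (by simp) hab 0
    by_cases hp : t.toSys.EdgeSide p ([p, a, b] : Cycle (Fin (2 * n + 1))).toFinset 0
    · rcases h3 with ha | hb
      · exact ⟨b, p, a, (cycle_rotate _ _ _).symm, hp, ha⟩
      · exact ⟨a, b, p, cycle_rotate _ _ _, hb, hp⟩
    · exact ⟨p, a, b, rfl, h1.resolve_left hp, h2.resolve_left hp⟩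
  let E := (Finset.equivFinOfCardEq ht.card_internal).symm
  have hE : ∀ j, (E j).1 ∈ t.verts ∧ (E j).1.length = 3 := fun j => Finset.mem_filter.1 (E j).2
  choose p a b hv ha hb using fun j => hex (E j).1 (hE j).1 (hE j).2
  have hmem : ∀ j, a j ∈ (E j).1.toFinset ∧ b j ∈ (E j).1.toFinset := fun j => by
    rw [hv j, toFinset_cycle_three]; simp
  have huniq : ∀ j k h, h ∈ (E j).1.toFinset → h ∈ (E k).1.toFinset →
      t.toSys.EdgeSide h (E j).1.toFinset 0 → t.toSys.EdgeSide h (E k).1.toFinset 0 → j = k := by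
    intro j k h hj hk hsj hsk
    by_contra hne
    refine hT.not_edgeSide (toFinset_mem (hE j).1) (toFinset_mem (hE k).1) (fun h' => hne ?_)
      hj hk hsj hsk
    exact E.injective (Subtype.ext (ht.injOn (hE j).1 (hE k).1 h'))
  have hab : ∀ j, a j ≠ b j := fun j => by
    have := ht.nodup _ (hE j).1
    rw [hv j] at this
    exact (nodup_cycle_three.1 this).2.2
  have hinj : Function.Injective
      (fun x : Option (Fin n ⊕ Fin n) => x.elim (0 : Fin (2 * n + 1)) (Sum.elim a b)) := by
    rintro (_ | j | j) (_ | k | k) h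
    · rfl
    · exact absurd h (ha k).1
    · exact absurd h (hb k).1
    · exact absurd h.symm (ha j).1
    · have h' : a j = a k := h
      rw [huniq j k (a j) (hmem j).1 (h' ▸ (hmem k).1) (ha j) (h' ▸ ha k)]
    · have h' : a j = b k := h
      have := huniq j k (a j) (hmem j).1 (h' ▸ (hmem k).2) (ha j) (h' ▸ hb k)
      exact absurd h' (this ▸ hab j)
    · exact absurd h.symm (hb j).1
    · have h' : b j = a k := h
      have := huniq j k (b j) (hmem j).2 (h' ▸ (hmem k).1) (hb j) (h' ▸ ha k)
      exact absurd h'.symm (this ▸ hab j)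
    · have h' : b j = b k := h
      rw [huniq j k (b j) (hmem j).2 (h' ▸ (hmem k).2) (hb j) (h' ▸ hb k)]
  have hbij := (Fintype.bijective_iff_injective_and_card _).2
    ⟨hinj, Fintype.card_congr (blockEquiv n)⟩
  obtain ⟨σ, hσ⟩ : ∃ σ : Equiv.Perm (Fin (2 * n + 1)), ∀ x : Option (Fin n ⊕ Fin n),
      σ (x.elim 0 (Sum.elim a b)) = blockEquiv n x :=
    ⟨(Equiv.ofBijective _ hbij).symm.trans (blockEquiv n), fun x => by
      rw [Equiv.trans_apply]
      exact congrArg _ ((Equiv.ofBijective _ hbij).symm_apply_apply x)⟩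
  refine ⟨σ, Compat.relabel_of fun c hc h3 => ?_⟩
  obtain ⟨j, hj⟩ := E.surjective ⟨c, Finset.mem_filter.2 ⟨hc, h3⟩⟩
  have hc' : (E j).1 = c := congrArg Subtype.val hj
  exact ⟨p j, a j, b j, j, by rw [← hc', ← hv j], hσ (some (Sum.inl j)), hσ (some (Sum.inr j))⟩

end CycSys

end TreeHomology

namespace TreeHomology
variable {m e n : ℕ}

/-! ### The orientation of a tree with cyclic orderings -/

/-- Renumbering the edges of a unitrivalent tree. -/
def UTree.renumber (σ : Equiv.Perm (Fin (2 * n + 1))) (t : UTree m n) : UTree m n :=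
  ⟨t.1.relabel σ, t.2.relabel σ⟩

/-- The sign that compares the numbering of the edges with the orientation determined by the
cyclic orderings. -/
noncomputable def orientSign (t : UTree m n) : ℤˣ :=
  Equiv.Perm.sign (t.2.exists_compat.choose)

/-- The sign does not depend on the chosen compatible numbering, because two such numberings differ
by an even permutation. -/
theorem orientSign_eq {t : UTree m n} {σ : Equiv.Perm (Fin (2 * n + 1))}
    (hσ : (t.1.relabel σ).Compat) : orientSign t = Equiv.Perm.sign σ := by
  have hτ := t.2.exists_compat.choose_spec
  rw [orientSign]
  generalize t.2.exists_compat.choose = τ at hτ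
  have h1 : (t.1.relabel σ).relabel (τ * σ⁻¹) = t.1.relabel τ := by
    rw [← CycSys.relabel_mul, inv_mul_cancel_right]
  have h2 := hσ.sign_eq_one (t.2.relabel σ) (σ := τ * σ⁻¹) (by rwa [h1])
  rw [map_mul, map_inv, Int.units_inv_eq_self] at h2
  rw [← mul_one (Equiv.Perm.sign τ), ← Int.units_mul_self (Equiv.Perm.sign σ), ← mul_assoc, h2,
    one_mul]

theorem orientSign_of_compat {t : UTree m n} (h : t.1.Compat) : orientSign t = 1 := by
  rw [orientSign_eq (σ := 1) (by rwa [CycSys.relabel_one]), map_one]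

theorem orientSign_renumber (t : UTree m n) (ρ : Equiv.Perm (Fin (2 * n + 1))) :
    orientSign (UTree.renumber ρ t) = Equiv.Perm.sign ρ * orientSign t := by
  obtain ⟨σ, hσ⟩ := t.2.exists_compat
  have h : ((UTree.renumber ρ t).1.relabel (σ * ρ⁻¹)).Compat := by
    change ((t.1.relabel ρ).relabel (σ * ρ⁻¹)).Compat
    rwa [← CycSys.relabel_mul, inv_mul_cancel_right]
  rw [orientSign_eq h, orientSign_eq hσ, map_mul, map_inv, Int.units_inv_eq_self, mul_comm]

theorem treeClass_eq_of_mem {x : FreeAbelianGroup (UTree m n)}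
    (h : x ∈ isoRel m n ∪ asRel m n ∪ ihxRel m n) :
    (QuotientAddGroup.mk x : TreeGroup m n) = 0 :=
  (QuotientAddGroup.eq_zero_iff x).2 (AddSubgroup.subset_closure h)

theorem treeClass_renumber (t : UTree m n) (σ : Equiv.Perm (Fin (2 * n + 1))) :
    treeClass (UTree.renumber σ t) = treeClass t := by
  have := treeClass_eq_of_mem (m := m) (n := n) (Or.inl (Or.inl ⟨t, UTree.renumber σ t, ⟨σ, rfl⟩, rfl⟩))
  rw [QuotientAddGroup.mk_sub, sub_eq_zero] at this
  exact this

theorem treeClass_reverse {t t' : UTree m n} {c : Cycle (Fin (2 * n + 1))} (hc : c ∈ t.1.verts)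
    (h3 : c.length = 3) (hv : t'.1.verts = insert c.reverse (t.1.verts.erase c))
    (hl : t'.1.label = t.1.label) : treeClass t' = - treeClass t := by
  have := treeClass_eq_of_mem (m := m) (n := n)
    (Or.inl (Or.inr ⟨t, t', ⟨c, hc, h3, hv, hl⟩, rfl⟩))
  rw [QuotientAddGroup.mk_add, add_eq_zero_iff_eq_neg] at this
  exact this

/-- Exchanging the two numbers in the block of the reversed vertex restores compatibility, at the
cost of one transposition. -/
theorem orientSign_reverse {t t' : UTree m n} {c : Cycle (Fin (2 * n + 1))} (hc : c ∈ t.1.verts)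
    (h3 : c.length = 3) (hv : t'.1.verts = insert c.reverse (t.1.verts.erase c)) :
    orientSign t' = - orientSign t := by
  obtain ⟨σ, hσ⟩ := t.2.exists_compat
  have hcσ := CycSys.map_mem_relabel (σ := σ).2 hc
  obtain ⟨p, j, hj⟩ := hσ _ hcσ (by rwa [length_cycle_map])
  have h : (t'.1.relabel (Equiv.swap (edgeFst j) (edgeSnd j) * σ)).Compat := by
    rw [CycSys.relabel_mul]
    refine CycSys.Compat.relabel_of fun c' hc' h3' => ?_
    obtain ⟨c'', hc'', rfl⟩ := CycSys.mem_relabel.1 hc'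
    rw [hv, Finset.mem_insert] at hc''
    rcases hc'' with rfl | hc''
    · refine ⟨p, edgeSnd j, edgeFst j, j, ?_, Equiv.swap_apply_right _ _,
        Equiv.swap_apply_left _ _⟩
      rw [← reverse_cycle_map, hj, reverse_cycle_three]
    · obtain ⟨hne, hc''⟩ := Finset.mem_erase.1 hc''
      have hcσ'' := CycSys.map_mem_relabel (σ := σ).2 hc''
      obtain ⟨q, k, hk⟩ := hσ _ hcσ'' h3'
      have hkj : k ≠ j := by
        rintro rfl
        rw [hk] at hcσ''
        rw [hj] at hcσ
        have := (t.2.relabel σ).eq_of_block hcσ'' hcσ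
        rw [← hk, ← hj] at this
        exact hne (cycle_map_injective σ this)
      refine ⟨q, edgeFst k, edgeSnd k, k, hk, ?_, ?_⟩
      · exact Equiv.swap_apply_of_ne_of_ne (fun h => hkj (edgeFst_inj.1 h))
          (edgeFst_ne_edgeSnd k j)
      · exact Equiv.swap_apply_of_ne_of_ne (edgeFst_ne_edgeSnd j k).symm
          (fun h => hkj (edgeSnd_inj.1 h))
  rw [orientSign_eq h, orientSign_eq hσ, map_mul, Equiv.Perm.sign_swap (edgeFst_ne_edgeSnd j j),
    neg_one_mul]

/-- The class of a tree with the orientation given by the numbering of its edges does not depend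
on the cyclic orderings. -/
theorem orientSign_smul_treeClass {t t' : UTree m n} (h : t.1.toSys = t'.1.toSys) :
    (orientSign t : ℤ) • treeClass t = (orientSign t' : ℤ) • treeClass t' := by
  -- Induction on the number of vertices at which the cyclic orderings differ. A trivalent vertex
  -- has only two orderings, so reversing one such vertex removes one difference.
  induction hN : (t.1.verts \ t'.1.verts).card using Nat.strong_induction_on generalizing t with
  | _ N ih =>
    subst hN
    by_cases hD : t.1.verts ⊆ t'.1.verts
    · have hv : t.1.verts = t'.1.verts := by
        refine Finset.Subset.antisymm hD fun c' hc' => ?_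
        have h1 := CycSys.toFinset_mem hc'
        rw [← h] at h1
        obtain ⟨c, hc, hcc⟩ := CycSys.mem_stars.1 h1
        rwa [← t'.2.injOn (hD hc) hc' hcc]
      have : t = t' := Subtype.ext (CycSys.ext hv (congrArg Sys.label h))
      rw [this]
    · obtain ⟨c, hc, hc'⟩ := Finset.not_subset.1 hD
      have h1 := CycSys.toFinset_mem hc
      rw [h] at h1
      obtain ⟨c', hcv', hcc⟩ := CycSys.mem_stars.1 h1
      have hlen : c'.length = c.length := by
        rw [← card_toFinset_cycle (t.2.nodup c hc), ← hcc,
          card_toFinset_cycle (t'.2.nodup c' hcv')]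
      have h3 : c.length = 3 := (t.2.valence c hc).resolve_left fun h1 => hc' (by
        rw [h1] at hlen
        obtain ⟨p, rfl⟩ := exists_of_length_eq_one h1
        obtain ⟨q, rfl⟩ := exists_of_length_eq_one hlen
        simp only [Cycle.coe_toFinset, List.toFinset_cons, List.toFinset_nil,
          insert_empty_eq, Finset.singleton_inj] at hcc
        rwa [← hcc])
      have hrev : c' = c.reverse := (eq_or_eq_reverse (t.2.nodup c hc) (t'.2.nodup c' hcv') h3
        hcc.symm).resolve_left fun h' => hc' (h' ▸ hcv')
      -- The tree `s` is `t` with the ordering at `c` reversed; both the orientation sign and the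
      -- class in 𝒯_n change sign.
      obtain ⟨s, hs⟩ : ∃ s : CycSys m (2 * n + 1),
          s = ⟨insert c.reverse (t.1.verts.erase c), t.1.label⟩ := ⟨_, rfl⟩
      have hsS : s.toSys = t.1.toSys := by
        ext1
        · rw [hs]
          change Finset.image _ (insert _ _) = Finset.image _ _
          rw [Finset.image_insert, toFinset_cycle_reverse, ← Finset.image_insert,
            Finset.insert_erase hc]
        · rw [hs]; rfl
      have hsU : s.IsUnitrivalent n := by
        refine CycSys.isUnitrivalent_of_card_le ?_ (hsS ▸ t.2.isUnrooted) (hsS ▸ t.2.degree)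
          (hsS ▸ t.2.card_univalent) ?_
        · intro d hd
          rw [hs] at hd
          rcases Finset.mem_insert.1 hd with rfl | hd
          · exact Cycle.nodup_reverse_iff.2 (t.2.nodup c hc)
          · exact t.2.nodup d (Finset.mem_of_mem_erase hd)
        · have h4 : t.1.verts.card = 2 * n + 1 + 1 := by
            rw [← t.2.isUnrooted.toIsTree.card_stars]
            exact (Finset.card_image_of_injOn t.2.injOn).symm
          rw [hs, ← h4]
          refine (Finset.card_insert_le _ _).trans ?_
          rw [Finset.card_erase_add_one hc]
      have hsv : s.verts = insert c.reverse (t.1.verts.erase c) := by rw [hs]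
      have hsl : s.label = t.1.label := by rw [hs]
      have key := ih _ (Finset.card_lt_card (Finset.ssubset_iff_subset_ne.2 ⟨?_, ?_⟩))
        (t := ⟨s, hsU⟩) (hsS.trans h) rfl
      · rw [treeClass_reverse (t' := ⟨s, hsU⟩) hc h3 hsv hsl,
          orientSign_reverse (t' := ⟨s, hsU⟩) hc h3 hsv, Units.val_neg, neg_smul, smul_neg,
          neg_neg] at key
        exact key
      · intro d hd
        obtain ⟨hd, hd'⟩ := Finset.mem_sdiff.1 hd
        change d ∈ s.verts at hd
        rw [hsv] at hd
        rcases Finset.mem_insert.1 hd with rfl | hd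
        · exact absurd (hrev ▸ hcv') hd'
        · exact Finset.mem_sdiff.2 ⟨Finset.mem_of_mem_erase hd, hd'⟩
      · intro heq
        have h5 : c ∈ s.verts \ t'.1.verts := by
          rw [heq]; exact Finset.mem_sdiff.2 ⟨hc, hc'⟩
        have h6 := (Finset.mem_sdiff.1 h5).1
        rw [hsv] at h6
        rcases Finset.mem_insert.1 h6 with h6 | h6
        · rw [← hrev] at h6
          exact hc' (h6 ▸ hcv')
        · exact (Finset.mem_erase.1 h6).1 rfl

end TreeHomology

namespace TreeHomology
variable {m e n : ℕ}

/-! ### The IHX relation -/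

/-- The three trees agree except at the two ends of the edge `x`, as in the relation IHX. -/
structure IsIHX (tI tH tX : CycSys m e) (W : Finset (Cycle (Fin e))) (x a b c d : Fin e) :
    Prop where
  vertsI : tI.verts = W ∪ {([x, b, a] : Cycle (Fin e)), ([x, c, d] : Cycle (Fin e))}
  vertsH : tH.verts = W ∪ {([x, a, c] : Cycle (Fin e)), ([x, d, b] : Cycle (Fin e))}
  vertsX : tX.verts = W ∪ {([x, b, c] : Cycle (Fin e)), ([x, d, a] : Cycle (Fin e))}
  labelH : tH.label = tI.label
  labelX : tX.label = tI.label

namespace IsIHX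

variable {W : Finset (Cycle (Fin e))} {x a b c d : Fin e} {tI tH tX : CycSys m e}

theorem relabel (h : IsIHX tI tH tX W x a b c d) (σ : Equiv.Perm (Fin e)) :
    IsIHX (tI.relabel σ) (tH.relabel σ) (tX.relabel σ) (W.image (Cycle.map σ))
      (σ x) (σ a) (σ b) (σ c) (σ d) where
  vertsI := by rw [CycSys.relabel, h.vertsI, Finset.image_union]; simp [Finset.image_insert]
  vertsH := by rw [CycSys.relabel, h.vertsH, Finset.image_union]; simp [Finset.image_insert]
  vertsX := by rw [CycSys.relabel, h.vertsX, Finset.image_union]; simp [Finset.image_insert]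
  labelH := by simp only [CycSys.relabel, h.labelH]
  labelX := by simp only [CycSys.relabel, h.labelX]

theorem mem_left {W : Finset (Cycle (Fin e))} {u v w : Cycle (Fin e)} (hw : w ∈ W) :
    w ∈ W ∪ {u, v} := Finset.mem_union_left _ hw

theorem distinct (h : IsIHX tI tH tX W x a b c d) (hI : tI.IsUnitrivalent n)
    (hH : tH.IsUnitrivalent n) (hX : tX.IsUnitrivalent n) :
    (x ≠ a ∧ x ≠ b ∧ x ≠ c ∧ x ≠ d) ∧ a ≠ b ∧ a ≠ c ∧ a ≠ d ∧ b ≠ c ∧ b ≠ d ∧ c ≠ d := by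
  have h1 := nodup_cycle_three.1 (hI.nodup ([x, b, a] : Cycle (Fin e)) (by rw [h.vertsI]; simp))
  have h2 := nodup_cycle_three.1 (hI.nodup ([x, c, d] : Cycle (Fin e)) (by rw [h.vertsI]; simp))
  have h3 := nodup_cycle_three.1 (hH.nodup ([x, a, c] : Cycle (Fin e)) (by rw [h.vertsH]; simp))
  have h4 := nodup_cycle_three.1 (hH.nodup ([x, d, b] : Cycle (Fin e)) (by rw [h.vertsH]; simp))
  have h5 := nodup_cycle_three.1 (hX.nodup ([x, b, c] : Cycle (Fin e)) (by rw [h.vertsX]; simp))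
  have h6 := nodup_cycle_three.1 (hX.nodup ([x, d, a] : Cycle (Fin e)) (by rw [h.vertsX]; simp))
  exact ⟨⟨h1.2.1, h1.1, h2.1, h2.2.1⟩, h1.2.2.symm, h3.2.2, h6.2.2.symm, h5.2.2, h4.2.2.symm,
    h2.2.2⟩

/-- The common vertices do not meet the edge `x`. -/
theorem notMem (h : IsIHX tI tH tX W x a b c d) (hI : tI.IsUnitrivalent n)
    (hH : tH.IsUnitrivalent n) (hX : tX.IsUnitrivalent n) {w : Cycle (Fin e)} (hw : w ∈ W) :
    x ∉ w.toFinset := by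
  intro hxw
  obtain ⟨⟨hxa, hxb, hxc, hxd⟩, hab, hac, had, hbc, hbd, hcd⟩ := h.distinct hI hH hX
  have key : ∀ (t : CycSys m e) (p q r s : Fin e), t.IsUnitrivalent n →
      t.verts = W ∪ {([x, p, q] : Cycle (Fin e)), ([x, r, s] : Cycle (Fin e))} →
      p ≠ x → p ≠ r → p ≠ s → w.toFinset = {x, p, q} ∨ w.toFinset = {x, r, s} := by
    intro t p q r s ht hv hpx hpr hps
    have hT := ht.isUnrooted.toIsTree
    have h1 := CycSys.toFinset_mem (t := t) (c := ([x, p, q] : Cycle (Fin e))) (by rw [hv]; simp)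
    have h2 := CycSys.toFinset_mem (t := t) (c := ([x, r, s] : Cycle (Fin e))) (by rw [hv]; simp)
    have h3 := CycSys.toFinset_mem (t := t) (c := w) (by rw [hv]; exact mem_left hw)
    rw [toFinset_cycle_three] at h1 h2
    refine hT.ends h1 h2 (fun heq => ?_) (h := x) (by simp) (by simp) _ h3 hxw
    have : p ∈ ({x, r, s} : Finset (Fin e)) := by rw [← heq]; simp
    simp [hpx, hpr, hps] at this
  -- If `w` contained `x`, it would be an end of `x` both in I and in H. The ends of `x` in these
  -- two trees have different edge sets.
  have h1 := key tI b a c d hI h.vertsI hxb.symm hbc hbd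
  have h2 := key tH a c d b hH h.vertsH hxa.symm had hab
  have hne : ∀ p q r s : Fin e, p ≠ x → p ≠ r → p ≠ s → w.toFinset = {x, p, q} →
      w.toFinset ≠ {x, r, s} := by
    intro p q r s hpx hpr hps hw1 hw2
    have : p ∈ w.toFinset := by rw [hw1]; simp
    rw [hw2] at this
    simp [hpx, hpr, hps] at this
  rcases h1 with h1 | h1 <;> rcases h2 with h2 | h2
  · exact hne b a a c hxb.symm hab.symm hbc h1 h2
  · rw [Finset.pair_comm] at h1
    exact hne a b d b hxa.symm had hab h1 h2
  · rw [Finset.pair_comm] at h1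
    exact hne d c a c hxd.symm had.symm hcd.symm h1 h2
  · exact hne c d d b hxc.symm hcd hbc.symm h1 h2

end IsIHX

/-- With `a` numbered `0`, the blocks at the two ends of `x` are (x, b), (c, d) in I. In H they are
(c, x), (d, b), which is an odd permutation, and in X they are (x, d), (b, c), an even one. All
other blocks agree. -/
theorem IsIHX.orientSign_eq_of_compat {tI tH tX : UTree m n}
    {W : Finset (Cycle (Fin (2 * n + 1)))} {x b c d : Fin (2 * n + 1)}
    (h : IsIHX tI.1 tH.1 tX.1 W x 0 b c d) (hI : tI.1.Compat) :
    orientSign tH = -1 ∧ orientSign tX = 1 := by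
  obtain ⟨⟨hx0, hxb, hxc, hxd⟩, h0b, h0c, h0d, hbc, hbd, hcd⟩ := h.distinct tI.2 tH.2 tX.2
  have hv1 : ([x, b, 0] : Cycle (Fin (2 * n + 1))) ∈ tI.1.verts := by rw [h.vertsI]; simp
  have hv2 : ([x, c, d] : Cycle (Fin (2 * n + 1))) ∈ tI.1.verts := by rw [h.vertsI]; simp
  obtain ⟨p, j, hj⟩ := hI _ hv1 rfl
  obtain ⟨rfl, rfl⟩ : x = edgeFst j ∧ b = edgeSnd j := by
    rcases cycle_three_eq_iff.1 hj with ⟨-, -, h1⟩ | ⟨h1, h2, -⟩ | ⟨-, -, h1⟩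
    · exact absurd h1.symm (edgeSnd_ne_zero j)
    · exact ⟨h1, h2⟩
    · exact absurd h1.symm (edgeFst_ne_zero j)
  obtain ⟨q, k, hk⟩ := hI _ hv2 rfl
  have hjk : k ≠ j := by
    rintro rfl
    rcases cycle_three_eq_iff.1 hk with ⟨-, h1, -⟩ | ⟨-, h1, -⟩ | ⟨-, -, h1⟩
    · exact hxc h1.symm
    · exact hbc h1.symm
    · exact hxd h1.symm
  obtain ⟨rfl, rfl⟩ : c = edgeFst k ∧ d = edgeSnd k := by
    rcases cycle_three_eq_iff.1 hk with ⟨-, h1, h2⟩ | ⟨h1, -, -⟩ | ⟨h1, -, -⟩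
    · exact ⟨h1, h2⟩
    · exact absurd (edgeFst_inj.1 h1).symm hjk
    · exact absurd h1 (edgeFst_ne_edgeSnd j k)
  have hW : ∀ w ∈ W, w.length = 3 → ∃ (q : Fin (2 * n + 1)) (l : Fin n), l ≠ j ∧ l ≠ k ∧
      w = ([q, edgeFst l, edgeSnd l] : Cycle (Fin (2 * n + 1))) := by
    intro w hw h3
    have hx := h.notMem tI.2 tH.2 tX.2 hw
    have hwv : w ∈ tI.1.verts := by rw [h.vertsI]; exact IsIHX.mem_left hw
    obtain ⟨q', l, rfl⟩ := hI w hwv h3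
    refine ⟨q', l, ?_, ?_, rfl⟩
    · rintro rfl; exact hx (by simp)
    · rintro rfl
      rw [hk] at hv2
      have := tI.2.eq_of_block hwv hv2
      rw [this, ← hk] at hx
      exact hx (by simp)
  have hfix : ∀ l, l ≠ j → l ≠ k → (edgeFst l ≠ edgeFst j ∧ edgeFst l ≠ edgeSnd j ∧
      edgeFst l ≠ edgeFst k ∧ edgeFst l ≠ edgeSnd k) ∧ edgeSnd l ≠ edgeFst j ∧
      edgeSnd l ≠ edgeSnd j ∧ edgeSnd l ≠ edgeFst k ∧ edgeSnd l ≠ edgeSnd k := by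
    intro l hj hk
    exact ⟨⟨fun h => hj (edgeFst_inj.1 h), edgeFst_ne_edgeSnd l j,
      fun h => hk (edgeFst_inj.1 h), edgeFst_ne_edgeSnd l k⟩, (edgeFst_ne_edgeSnd j l).symm,
      fun h => hj (edgeSnd_inj.1 h), (edgeFst_ne_edgeSnd k l).symm,
      fun h => hk (edgeSnd_inj.1 h)⟩
  have hsw : ∀ p q r : Fin (2 * n + 1), r ≠ p → r ≠ q → Equiv.swap p q r = r :=
    fun p q r h1 h2 => Equiv.swap_apply_of_ne_of_ne h1 h2
  constructor
  · have hcomp : (tH.1.relabel (Equiv.swap (edgeFst j) (edgeSnd j) *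
        (Equiv.swap (edgeSnd j) (edgeSnd k) * Equiv.swap (edgeSnd k) (edgeFst k)))).Compat := by
      refine CycSys.Compat.relabel_of fun v hv h3 => ?_
      rw [h.vertsH, Finset.mem_union, Finset.mem_insert, Finset.mem_singleton] at hv
      rcases hv with hv | rfl | rfl
      · obtain ⟨q', l, hl, hl', rfl⟩ := hW v hv h3
        obtain ⟨⟨h1, h2, h3, h4⟩, h5, h6, h7, h8⟩ := hfix l hl hl'
        refine ⟨q', edgeFst l, edgeSnd l, l, rfl, ?_, ?_⟩
        · rw [Equiv.Perm.mul_apply, Equiv.Perm.mul_apply, hsw _ _ _ h4 h3, hsw _ _ _ h2 h4,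
            hsw _ _ _ h1 h2]
        · rw [Equiv.Perm.mul_apply, Equiv.Perm.mul_apply, hsw _ _ _ h8 h7, hsw _ _ _ h6 h8,
            hsw _ _ _ h5 h6]
      · refine ⟨0, edgeFst k, edgeFst j, j, cycle_rotate _ _ _, ?_, ?_⟩
        · rw [Equiv.Perm.mul_apply, Equiv.Perm.mul_apply, Equiv.swap_apply_right,
            Equiv.swap_apply_right, Equiv.swap_apply_right]
        · rw [Equiv.Perm.mul_apply, Equiv.Perm.mul_apply, hsw _ _ _ hxd hxc, hsw _ _ _ hxb hxd,
            Equiv.swap_apply_left]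
      · refine ⟨edgeFst j, edgeSnd k, edgeSnd j, k, rfl, ?_, ?_⟩
        · rw [Equiv.Perm.mul_apply, Equiv.Perm.mul_apply, Equiv.swap_apply_left,
            hsw _ _ _ hbc.symm hcd, hsw _ _ _ hxc.symm hbc.symm]
        · rw [Equiv.Perm.mul_apply, Equiv.Perm.mul_apply, hsw _ _ _ hbd hbc,
            Equiv.swap_apply_left, hsw _ _ _ hxd.symm hbd.symm]
    rw [orientSign_eq hcomp, map_mul, Equiv.Perm.sign_swap hxb,
      CycSys.sign_swap_mul_swap hbd hcd.symm, mul_one]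
  · have hcomp : (tX.1.relabel (Equiv.swap (edgeSnd k) (edgeSnd j) *
        Equiv.swap (edgeSnd j) (edgeFst k))).Compat := by
      refine CycSys.Compat.relabel_of fun v hv h3 => ?_
      rw [h.vertsX, Finset.mem_union, Finset.mem_insert, Finset.mem_singleton] at hv
      rcases hv with hv | rfl | rfl
      · obtain ⟨q', l, hl, hl', rfl⟩ := hW v hv h3
        obtain ⟨⟨h1, h2, h3, h4⟩, h5, h6, h7, h8⟩ := hfix l hl hl'
        refine ⟨q', edgeFst l, edgeSnd l, l, rfl, ?_, ?_⟩
        · rw [Equiv.Perm.mul_apply, hsw _ _ _ h2 h3, hsw _ _ _ h4 h2]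
        · rw [Equiv.Perm.mul_apply, hsw _ _ _ h6 h7, hsw _ _ _ h8 h6]
      · refine ⟨edgeFst j, edgeSnd j, edgeFst k, k, rfl, ?_, ?_⟩
        · rw [Equiv.Perm.mul_apply, Equiv.swap_apply_left, hsw _ _ _ hcd hbc.symm]
        · rw [Equiv.Perm.mul_apply, Equiv.swap_apply_right, Equiv.swap_apply_right]
      · refine ⟨0, edgeFst j, edgeSnd k, j, (cycle_rotate _ _ _).symm, ?_, ?_⟩
        · rw [Equiv.Perm.mul_apply, hsw _ _ _ hxb hxc, hsw _ _ _ hxd hxb]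
        · rw [Equiv.Perm.mul_apply, hsw _ _ _ hbd.symm hcd.symm, Equiv.swap_apply_left]
    rw [orientSign_eq hcomp, CycSys.sign_swap_mul_swap hbd.symm hbc]

/-- The signs of the trees in the relation IHX. -/
theorem IsIHX.orientSign_eq {tI tH tX : UTree m n} {W : Finset (Cycle (Fin (2 * n + 1)))}
    {x a b c d : Fin (2 * n + 1)} (h : IsIHX tI.1 tH.1 tX.1 W x a b c d) :
    orientSign tH = - orientSign tI ∧ orientSign tX = orientSign tI := by
  obtain ⟨σ, hσ⟩ := tI.2.exists_compat
  -- The relation is invariant under renumbering, so `a` may be taken as the first edge of a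
  -- compatible numbering of I.
  obtain ⟨τ, -, hτ, ha⟩ := hσ.exists_move (tI.2.relabel σ) (σ a)
  rw [← CycSys.relabel_mul] at hτ
  have h' := h.relabel (τ * σ)
  rw [Equiv.Perm.mul_apply τ σ a, ha] at h'
  obtain ⟨h1, h2⟩ := IsIHX.orientSign_eq_of_compat (tI := UTree.renumber (τ * σ) tI)
    (tH := UTree.renumber (τ * σ) tH) (tX := UTree.renumber (τ * σ) tX) h' hτ
  have h0 := orientSign_of_compat (t := UTree.renumber (τ * σ) tI) hτ
  rw [orientSign_renumber] at h0 h1 h2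
  constructor
  · apply mul_left_cancel (a := Equiv.Perm.sign (τ * σ))
    rw [h1, mul_neg, h0]
  · apply mul_left_cancel (a := Equiv.Perm.sign (τ * σ))
    rw [h2, h0]

end TreeHomology

namespace TreeHomology
-- IHX triples as boundaries of trees with a four-valent vertex.
variable {m e n : ℕ}

theorem ins_pair (a b : Fin e) : ins {a, b} = {0, a.succ, b.succ} := by simp [ins, up]

theorem toFinset_zero_succ_succ (a b : Fin e) :
    ([0, a.succ, b.succ] : Cycle (Fin (e + 1))).toFinset = ins {a, b} := by
  rw [toFinset_cycle_three, ins_pair]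

theorem disjoint_pairs {α : Type*} [DecidableEq α] {p q r u : α} (hpr : p ≠ r) (hpu : p ≠ u)
    (hqr : q ≠ r) (hqu : q ≠ u) : Disjoint ({p, q} : Finset α) {r, u} := by
  simp [hpr.symm, hpu.symm, hqr.symm, hqu.symm]

/-- If the edge `x` is numbered first, the trees in the relation IHX are the expansions of a tree
with a vertex of valence four. -/
theorem IsIHX.cls_add_mem_of_zero {tI tH tX : UTree m n} {W : Finset (Cycle (Fin (2 * n + 1)))}
    {a b c d : Fin (2 * n)}
    (h : IsIHX tI.1 tH.1 tX.1 W 0 a.succ b.succ c.succ d.succ) :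
    cls tI.1.toSys + (cls tH.1.toSys + cls tX.1.toSys) ∈
      (unrootedChains m (n + 2) 1).map (boundary m) := by
  obtain ⟨-, hab, hac, had, hbc, hbd, hcd⟩ := h.distinct tI.2 tH.2 tX.2
  rw [ne_eq, Fin.succ_inj] at hab hac had hbc hbd hcd
  have hT := tI.2.isUnrooted.toIsTree
  have hA := CycSys.toFinset_mem (t := tI.1) (c := ([0, b.succ, a.succ] : Cycle _))
    (by rw [h.vertsI]; simp)
  have hB := CycSys.toFinset_mem (t := tI.1) (c := ([0, c.succ, d.succ] : Cycle _))
    (by rw [h.vertsI]; simp)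
  rw [toFinset_zero_succ_succ] at hA hB
  rw [Finset.pair_comm] at hA
  have hAB : ({a, b} : Finset (Fin (2 * n))) ≠ {c, d} := fun heq => by
    have : a ∈ ({c, d} : Finset (Fin (2 * n))) := by rw [← heq]; simp
    simp [hac, had] at this
  have hcA : ({a, b} : Finset (Fin (2 * n))).card = 2 := Finset.card_pair hab
  have hcB : ({c, d} : Finset (Fin (2 * n))).card = 2 := Finset.card_pair hcd
  have hl : tI.1.toSys.label 0 = none := by
    refine tI.2.isUnrooted.label_eq_none hA hB (fun h' => hAB (ins_injective h')) zero_mem_ins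
      zero_mem_ins ?_ ?_
    · rw [card_ins, hcA]
    · rw [card_ins, hcB]
  obtain ⟨t, hv, hhalf, hdiff, hI⟩ := exists_eq_expand hT hl hA hB hAB hcA.ge hcB.ge
  have ht := tI.2.isUnrooted
  have hd := tI.2.degree
  have hk := tI.2.card_univalent
  rw [hI] at ht hd hk
  replace ht := (Sys.isUnrooted_expand_iff hv hhalf).1 ht
  have htd := Sys.degree_expand hv hhalf
  rw [hd, zero_add] at htd
  rw [Sys.card_univalent_expand hv hhalf] at hk
  have hvv : ({a, b} ∪ {c, d} : Finset (Fin (2 * n))) = {a, b, c, d} := by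
    rw [Finset.insert_union, Finset.singleton_union]
  rw [hdiff] at hI
  rw [hvv] at hI hv
  -- The common vertices of the triple are those away from the edge `x = 0`, that is, all vertices
  -- of the contracted tree except the four-valent one.
  have hW : W.image Cycle.toFinset = (t.stars.erase {a, b, c, d}).image up := by
    have h1 : ∀ y, y ∈ W.image Cycle.toFinset ↔ y ∈ tI.1.toSys.stars ∧ 0 ∉ y := by
      intro y
      change _ ↔ y ∈ tI.1.verts.image Cycle.toFinset ∧ _
      rw [h.vertsI, Finset.image_union, Finset.mem_union]
      constructor
      · intro hy
        refine ⟨Or.inl hy, ?_⟩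
        obtain ⟨w, hw, rfl⟩ := Finset.mem_image.1 hy
        exact h.notMem tI.2 tH.2 tX.2 hw
      · rintro ⟨hy | hy, h0⟩
        · exact hy
        · rw [Finset.image_insert, Finset.image_singleton, toFinset_zero_succ_succ,
            toFinset_zero_succ_succ, Finset.mem_insert, Finset.mem_singleton] at hy
          rcases hy with rfl | rfl <;> exact absurd zero_mem_ins h0
    ext y
    rw [h1, hI, Sys.expand_eq_repl, Sys.mem_repl]
    constructor
    · rintro ⟨⟨w, hw, hne, rfl⟩ | hy, h0⟩
      · exact Finset.mem_image.2 ⟨w, Finset.mem_erase.2 ⟨hne, hw⟩, rfl⟩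
      · exact absurd (zero_mem_of_mem_image_ins hy) h0
    · intro hy
      obtain ⟨w, hw, rfl⟩ := Finset.mem_image.1 hy
      exact ⟨Or.inl ⟨w, Finset.mem_of_mem_erase hw, (Finset.mem_erase.1 hw).1, rfl⟩,
        zero_notMem_up⟩
  have hlab : tI.1.label = Fin.cons none t.label := congrArg Sys.label hI
  have hexp : ∀ (s : CycSys m (2 * n + 1)) (p q r u : Fin (2 * n)),
      s.verts = W ∪ {([0, p.succ, q.succ] : Cycle _), ([0, r.succ, u.succ] : Cycle _)} →
      s.label = tI.1.label →
      s.toSys = t.expand {a, b, c, d} {{p, q}, {r, u}} := by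
    intro s p q r u hs hsl
    ext1
    · change s.verts.image Cycle.toFinset = _ ∪ Finset.image ins _
      rw [hs, Finset.image_union, hW, Finset.image_insert, Finset.image_singleton,
        toFinset_zero_succ_succ, toFinset_zero_succ_succ, Finset.image_insert,
        Finset.image_singleton]
    · exact hsl.trans hlab
  refine ⟨cls t, cls_mem_unrootedChains ht hk htd.symm, ?_⟩
  rw [boundary_cls_of_degree_one htd.symm hab hac had hbc hbd hcd hv, ← hI,
    hexp tH.1 a c d b h.vertsH h.labelH, hexp tX.1 b c d a h.vertsX h.labelX,
    Finset.pair_comm d b, Finset.pair_comm d a,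
    Finset.pair_comm ({b, c} : Finset (Fin (2 * n))) {a, d}]

theorem cls_renumber (t : UTree m n) (σ : Equiv.Perm (Fin (2 * n + 1))) :
    cls (UTree.renumber σ t).1.toSys = (Equiv.Perm.sign σ : ℤ) • cls t.1.toSys := by
  change cls (t.1.relabel σ).toSys = _
  rw [CycSys.toSys_relabel, cls_relabel]

theorem IsIHX.cls_add_mem {tI tH tX : UTree m n} {W : Finset (Cycle (Fin (2 * n + 1)))}
    {x a b c d : Fin (2 * n + 1)} (h : IsIHX tI.1 tH.1 tX.1 W x a b c d) :
    cls tI.1.toSys + (cls tH.1.toSys + cls tX.1.toSys) ∈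
      (unrootedChains m (n + 2) 1).map (boundary m) := by
  obtain ⟨⟨hxa, hxb, hxc, hxd⟩, -⟩ := h.distinct tI.2 tH.2 tX.2
  obtain ⟨π, hπ⟩ : ∃ π : Equiv.Perm (Fin (2 * n + 1)), π x = 0 :=
    ⟨Equiv.swap x 0, Equiv.swap_apply_left _ _⟩
  have hπi : ∀ i, x ≠ i → ∃ j : Fin (2 * n), π i = j.succ := fun i hi =>
    (Fin.exists_succ_eq.2 fun h' => hi (π.injective (hπ.trans h'.symm))).imp fun _ h => h.symm
  obtain ⟨a', ha⟩ := hπi a hxa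
  obtain ⟨b', hb⟩ := hπi b hxb
  obtain ⟨c', hc⟩ := hπi c hxc
  obtain ⟨d', hd⟩ := hπi d hxd
  have h' := h.relabel π
  rw [hπ, ha, hb, hc, hd] at h'
  have key := IsIHX.cls_add_mem_of_zero (tI := UTree.renumber π tI) (tH := UTree.renumber π tH)
    (tX := UTree.renumber π tX) h'
  rw [cls_renumber, cls_renumber, cls_renumber, ← smul_add, ← smul_add] at key
  rw [← sign_smul_sign_smul π (cls tI.1.toSys + (cls tH.1.toSys + cls tX.1.toSys))]
  exact AddSubgroup.zsmul_mem _ key _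

/-- Some cyclic ordering of a finite set. -/
noncomputable def someCycle {α : Type*} (s : Finset α) : Cycle α := (s.toList : Cycle α)

theorem nodup_someCycle {α : Type*} (s : Finset α) : (someCycle s).Nodup := s.nodup_toList

theorem toFinset_someCycle {α : Type*} [DecidableEq α] (s : Finset α) :
    (someCycle s).toFinset = s := by
  rw [someCycle, Cycle.coe_toFinset, Finset.toList_toFinset]

/-- Any cyclic ordering at the vertices will do. The equality is one of pairs because `e` is only
known to equal `2 * n + 1` by counting. -/
theorem exists_utree {t : Sys m e} (ht : t.IsUnrooted) (hk : t.univalent.card = n + 2)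
    (hd : t.degree = 0) : ∃ s : UTree m n, (⟨e, t⟩ : Σ e, Sys m e) = ⟨2 * n + 1, s.1.toSys⟩ := by
  obtain ⟨-, rfl⟩ := ht.toIsTree.card_internal hd hk
  obtain ⟨s, hs⟩ : ∃ s : CycSys m (2 * n + 1), s = ⟨t.stars.image someCycle, t.label⟩ := ⟨_, rfl⟩
  have hst : s.toSys = t := by
    ext1
    · rw [hs]
      change (t.stars.image someCycle).image Cycle.toFinset = _
      rw [Finset.image_image]
      exact (Finset.image_congr fun x _ => toFinset_someCycle x).trans Finset.image_id
    · rw [hs]; rfl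
  refine ⟨⟨s, CycSys.isUnitrivalent_of_card_le ?_ ?_ ?_ ?_ ?_⟩, by rw [hst]⟩
  · intro c hc
    rw [hs] at hc
    obtain ⟨x, -, rfl⟩ := Finset.mem_image.1 hc
    exact nodup_someCycle x
  · rwa [hst]
  · rwa [hst]
  · rwa [hst]
  · rw [hs, ← ht.toIsTree.card_stars]
    exact Finset.card_image_le

theorem exists_card_eq_four {t : Sys m e} (hd : t.degree = 1) :
    ∃ a b c d : Fin e, (a ≠ b ∧ a ≠ c ∧ a ≠ d ∧ b ≠ c ∧ b ≠ d ∧ c ≠ d) ∧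
      {a, b, c, d} ∈ t.stars := by
  rw [Sys.degree_eq_sum] at hd
  obtain ⟨v, hv, hne⟩ := Finset.exists_ne_zero_of_sum_ne_zero (by rw [hd]; exact one_ne_zero)
  have hle := Finset.single_le_sum (f := fun w : Finset (Fin e) => w.card - 3)
    (fun _ _ => Nat.zero_le _) hv
  rw [hd] at hle
  have h4 : v.card = 3 + 1 := by omega
  obtain ⟨a, s, ha, rfl, hs⟩ := Finset.card_eq_succ.1 h4
  obtain ⟨b, c, d, hbc, hbd, hcd, rfl⟩ := Finset.card_eq_three.1 hs
  simp only [Finset.mem_insert, Finset.mem_singleton, not_or] at ha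
  exact ⟨a, b, c, d, ⟨ha.1, ha.2.1, ha.2.2, hbc, hbd, hcd⟩, hv⟩

/-- Arbitrary cyclic orderings at the old vertices and prescribed ones at the ends of the new edge
turn an expansion into a vertex-oriented tree. The old choices do not depend on the partition, so
the three expansions share them. -/
theorem isUnitrivalent_expand {t : Sys m (2 * n)} (ht : t.IsUnrooted)
    (hk : t.univalent.card = n + 2) (hd : t.degree = 1) {v : Finset (Fin (2 * n))}
    (hv : v ∈ t.stars) {p q r u : Fin (2 * n)} (hpq : p ≠ q) (hru : r ≠ u)
    (hP : {p, q} ∪ {r, u} = v) (hD : Disjoint ({p, q} : Finset (Fin (2 * n))) {r, u})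
    {s : CycSys m (2 * n + 1)} (hsv : s.verts = (t.stars.erase v).image (fun w => someCycle (up w)) ∪
      {([0, p.succ, q.succ] : Cycle _), ([0, r.succ, u.succ] : Cycle _)})
    (hsl : s.label = Fin.cons none t.label) :
    s.toSys = t.expand v {{p, q}, {r, u}} ∧ s.IsUnitrivalent n := by
  have hs : s.toSys = t.expand v {{p, q}, {r, u}} := by
    ext1
    · change s.verts.image Cycle.toFinset = _ ∪ Finset.image ins _
      rw [hsv, Finset.image_union, Finset.image_insert, Finset.image_singleton,
        toFinset_zero_succ_succ, toFinset_zero_succ_succ, Finset.image_insert,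
        Finset.image_singleton, Finset.image_image]
      congr 1
      exact Finset.image_congr fun w _ => toFinset_someCycle _
    · exact hsl
  have hdiff : v \ {p, q} = {r, u} := by
    rw [← hP, Finset.union_sdiff_left, Finset.sdiff_eq_self_of_disjoint hD.symm]
  have hhalf : {p, q} ∈ halves v := by
    refine mem_halves.2 ⟨hP ▸ Finset.subset_union_left, (Finset.card_pair hpq).ge, ?_⟩
    rw [hdiff]; exact (Finset.card_pair hru).ge
  have hs' := hs
  rw [← hdiff] at hs'
  refine ⟨hs, CycSys.isUnitrivalent_of_card_le ?_ ?_ ?_ ?_ ?_⟩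
  · intro c hc
    rw [hsv, Finset.mem_union, Finset.mem_insert, Finset.mem_singleton] at hc
    rcases hc with hc | rfl | rfl
    · obtain ⟨x, -, rfl⟩ := Finset.mem_image.1 hc
      exact nodup_someCycle _
    · exact nodup_cycle_three.2 ⟨(Fin.succ_ne_zero p).symm, (Fin.succ_ne_zero q).symm,
        fun h => hpq (Fin.succ_injective _ h)⟩
    · exact nodup_cycle_three.2 ⟨(Fin.succ_ne_zero r).symm, (Fin.succ_ne_zero u).symm,
        fun h => hru (Fin.succ_injective _ h)⟩
  · rw [hs']; exact (Sys.isUnrooted_expand_iff hv hhalf).2 ht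
  · have := Sys.degree_expand hv hhalf
    rw [hs']; omega
  · rw [hs', Sys.card_univalent_expand hv hhalf, hk]
  · have h1 := ht.toIsTree.card_stars
    have h2 := Finset.card_erase_add_one hv
    have h3 := Finset.card_image_le (s := t.stars.erase v) (f := fun w => someCycle (up w))
    have h4 := Finset.card_union_le ((t.stars.erase v).image (fun w => someCycle (up w)))
      {([0, p.succ, q.succ] : Cycle (Fin (2 * n + 1))), ([0, r.succ, u.succ] : Cycle _)}
    have h5 := Finset.card_le_two (a := ([0, p.succ, q.succ] : Cycle (Fin (2 * n + 1))))
      (b := ([0, r.succ, u.succ] : Cycle _))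
    rw [hsv]
    omega

/-- The boundary of a tree of degree one is a sum of three trees as in the relation IHX. -/
theorem exists_isIHX_boundary {t : Sys m e} (ht : t.IsUnrooted) (hk : t.univalent.card = n + 2)
    (hd : t.degree = 1) : ∃ (tI tH tX : UTree m n) (W : Finset (Cycle (Fin (2 * n + 1))))
      (x a b c d : Fin (2 * n + 1)), IsIHX tI.1 tH.1 tX.1 W x a b c d ∧
      boundary m (cls t) = cls tI.1.toSys + (cls tH.1.toSys + cls tX.1.toSys) := by
  obtain ⟨a, b, c, d, ⟨hab, hac, had, hbc, hbd, hcd⟩, hv⟩ := exists_card_eq_four hd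
  -- Any expansion is a trivalent tree with `e + 1` edges, and such a tree has `2 * n + 1` edges.
  have he : e = 2 * n := by
    have hP : ({a, b} : Finset (Fin e)) ∪ {c, d} = {a, b, c, d} := by
      rw [Finset.insert_union, Finset.singleton_union]
    have hD : Disjoint ({c, d} : Finset (Fin e)) {a, b} :=
      disjoint_pairs hac.symm hbc.symm had.symm hbd.symm
    have hdiff : ({a, b, c, d} : Finset (Fin e)) \ {a, b} = {c, d} := by
      rw [← hP, Finset.union_sdiff_left, Finset.sdiff_eq_self_of_disjoint hD]
    have hhalf : ({a, b} : Finset (Fin e)) ∈ halves {a, b, c, d} := by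
      refine mem_halves.2 ⟨hP ▸ Finset.subset_union_left, (Finset.card_pair hab).ge, ?_⟩
      rw [hdiff]; exact (Finset.card_pair hcd).ge
    have h1 := (Sys.isUnrooted_expand_iff hv hhalf).2 ht
    have h2 := Sys.degree_expand hv hhalf
    have h3 := Sys.card_univalent_expand hv hhalf
    have := (h1.toIsTree.card_internal (by omega) (h3.trans hk)).2
    omega
  subst he
  have hI := isUnitrivalent_expand ht hk hd hv (p := b) (q := a) (r := c) (u := d) hab.symm hcd
    (by ext; simp; tauto) (disjoint_pairs hbc hbd hac had)
    (s := ⟨_, _⟩) rfl rfl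
  have hH := isUnitrivalent_expand ht hk hd hv (p := a) (q := c) (r := d) (u := b) hac hbd.symm
    (by ext; simp; tauto) (disjoint_pairs had hab hcd hbc.symm)
    (s := ⟨_, _⟩) rfl rfl
  have hX := isUnitrivalent_expand ht hk hd hv (p := b) (q := c) (r := d) (u := a) hbc had.symm
    (by ext; simp; tauto) (disjoint_pairs hbd hab.symm hcd hac.symm)
    (s := ⟨_, _⟩) rfl rfl
  refine ⟨⟨_, hI.2⟩, ⟨_, hH.2⟩, ⟨_, hX.2⟩, _, 0, a.succ, b.succ, c.succ, d.succ,
    ⟨rfl, rfl, rfl, rfl, rfl⟩, ?_⟩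
  rw [hI.1, hH.1, hX.1, boundary_cls_of_degree_one hd hab hac had hbc hbd hcd hv,
    Finset.pair_comm d b, Finset.pair_comm d a, Finset.pair_comm b a,
    Finset.pair_comm ({b, c} : Finset (Fin (2 * n))) {a, d}]

end TreeHomology

namespace TreeHomology
variable {m e n : ℕ}

/-! ### The group of trees as a homology group -/

theorem boundary_mem {k d : ℕ} {x : Chains m} (hx : x ∈ unrootedChains m k (d + 1)) :
    boundary m x ∈ unrootedChains m k d := by
  refine mem_closure_induction_cls (p := fun x => boundary m x ∈ unrootedChains m k d) ?_
    (by rw [map_zero]; exact zero_mem _) (fun x y hx hy => by rw [map_add]; exact add_mem hx hy)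
    (fun x hx => by rw [map_neg]; exact neg_mem hx) hx
  rintro _ ⟨e, t, ht, hk, hd, rfl⟩
  rw [boundary_cls]
  refine sum_mem fun v hv => sum_mem fun P hP => ?_
  obtain ⟨A, hA, rfl⟩ := mem_partitions.1 hP
  have := Sys.degree_expand hv hA
  exact cls_mem_unrootedChains ((Sys.isUnrooted_expand_iff hv hA).2 ht)
    ((Sys.card_univalent_expand hv hA).trans hk) (by omega)

theorem boundary_eq_zero {k : ℕ} {x : Chains m} (hx : x ∈ unrootedChains m k 0) :
    boundary m x = 0 := by
  refine mem_closure_induction_cls (p := fun x => boundary m x = 0) ?_ (map_zero _)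
    (fun x y hx hy => by rw [map_add, hx, hy, add_zero])
    (fun x hx => by rw [map_neg, hx, neg_zero]) hx
  rintro _ ⟨e, t, ht, -, hd, rfl⟩
  rw [boundary_cls]
  refine Finset.sum_eq_zero fun v hv => ?_
  rw [partitions_eq_empty, Finset.sum_empty]
  rcases ht.valence v hv with h | h
  · omega
  · rw [card_of_degree_zero hd (mem_internal.2 ⟨hv, h⟩)]; omega

theorem mem_cycles_zero {k : ℕ} {x : Chains m} (hx : x ∈ unrootedChains m k 0) :
    x ∈ cycles (boundary m) (unrootedChains m k) 0 :=
  AddSubgroup.mem_inf.2 ⟨hx, boundary_eq_zero hx⟩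

theorem homologyClass_eq_zero {A : Type*} [AddCommGroup A] {δ : A →+ A} {G : ℕ → AddSubgroup A}
    {d : ℕ} {x : A} {hx : x ∈ cycles δ G d} :
    homologyClass δ G d x hx = 0 ↔ x ∈ (G (d + 1)).map δ := by
  rw [homologyClass, QuotientAddGroup.eq_zero_iff, AddSubgroup.mem_addSubgroupOf]

theorem homologyClass_surjective {A : Type*} [AddCommGroup A] {δ : A →+ A}
    {G : ℕ → AddSubgroup A} {d : ℕ} (y : Homology δ G d) :
    ∃ x hx, homologyClass δ G d x hx = y := by
  obtain ⟨x, rfl⟩ := QuotientAddGroup.mk_surjective y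
  exact ⟨x.1, x.2, rfl⟩

theorem cls_utree_mem (t : UTree m n) : cls t.1.toSys ∈ unrootedChains m (n + 2) 0 :=
  cls_mem_unrootedChains t.2.isUnrooted t.2.card_univalent t.2.degree

theorem exists_isIHX_of_mem {y : FreeAbelianGroup (UTree m n)} (hy : y ∈ ihxRel m n) :
    ∃ (tI tH tX : UTree m n) (W : Finset (Cycle (Fin (2 * n + 1))))
      (x a b c d : Fin (2 * n + 1)), IsIHX tI.1 tH.1 tX.1 W x a b c d ∧
      y = FreeAbelianGroup.of tI - (FreeAbelianGroup.of tH - FreeAbelianGroup.of tX) := by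
  obtain ⟨tI, tH, tX, W, x, a, b, c, d, h1, h2, h3, h4, h5, h6⟩ := hy
  exact ⟨tI, tH, tX, W, x, a, b, c, d, ⟨h1, h2, h3, h4, h5⟩, h6⟩

theorem IsIHX.treeClass_eq {tI tH tX : UTree m n} {W : Finset (Cycle (Fin (2 * n + 1)))}
    {x a b c d : Fin (2 * n + 1)} (h : IsIHX tI.1 tH.1 tX.1 W x a b c d) :
    treeClass tI - (treeClass tH - treeClass tX) = 0 := by
  have := treeClass_eq_of_mem (m := m) (n := n) (Or.inr
    ⟨tI, tH, tX, W, x, a, b, c, d, h.vertsI, h.vertsH, h.vertsX, h.labelH, h.labelX, rfl⟩)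
  rwa [QuotientAddGroup.mk_sub, QuotientAddGroup.mk_sub] at this

/-- A unitrivalent tree with the orientation determined by its cyclic orderings. -/
noncomputable def orientedCycle (t : UTree m n) :
    cycles (boundary m) (unrootedChains m (n + 2)) 0 :=
  ⟨(orientSign t : ℤ) • cls t.1.toSys,
    mem_cycles_zero (AddSubgroup.zsmul_mem _ (cls_utree_mem t) _)⟩

/-- The sign `orientSign` makes isomorphic trees agree and gives antisymmetry. By the signs of an
IHX triple, I - H + X becomes plus or minus the sum of three expansions, a boundary. -/
theorem exists_treeHom (m n : ℕ) :
    ∃ f : TreeGroup m n →+ Homology (boundary m) (unrootedChains m (n + 2)) 0,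
      ∀ t, f (treeClass t) = QuotientAddGroup.mk (orientedCycle t) := by
  refine ⟨QuotientAddGroup.lift _ (FreeAbelianGroup.lift fun t : UTree m n =>
    (QuotientAddGroup.mk (orientedCycle t) :
      Homology (boundary m) (unrootedChains m (n + 2)) 0)) ?_, fun t => ?_⟩
  · refine (AddSubgroup.closure_le _).2 ?_
    rintro y ((⟨t, t', ⟨σ, hσ⟩, rfl⟩ | ⟨t, t', ⟨c, hc, h3, hv, hl⟩, rfl⟩) | hy)
    · obtain rfl : t' = UTree.renumber σ t := Subtype.ext hσ
      have : orientedCycle (UTree.renumber σ t) = orientedCycle t := by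
        apply Subtype.ext
        change ((orientSign (UTree.renumber σ t) : ℤˣ) : ℤ) • cls (UTree.renumber σ t).1.toSys
          = (orientSign t : ℤ) • cls t.1.toSys
        rw [orientSign_renumber, cls_renumber, Units.val_mul, mul_smul,
          smul_comm (orientSign t : ℤ), sign_smul_sign_smul]
      change FreeAbelianGroup.lift _ _ = _
      rw [map_sub, FreeAbelianGroup.lift_apply_of, FreeAbelianGroup.lift_apply_of, this, sub_self]
    · have : orientedCycle t' = - orientedCycle t := by
        apply Subtype.ext
        change ((orientSign t' : ℤˣ) : ℤ) • cls t'.1.toSys = - ((orientSign t : ℤ) • cls t.1.toSys)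
        have hS : t'.1.toSys = t.1.toSys := by
          ext1
          · change t'.1.verts.image _ = t.1.verts.image _
            rw [hv, Finset.image_insert, toFinset_cycle_reverse, ← Finset.image_insert,
              Finset.insert_erase hc]
          · exact hl
        rw [orientSign_reverse hc h3 hv, hS, Units.val_neg, neg_smul]
      change FreeAbelianGroup.lift _ _ = _
      rw [map_add, FreeAbelianGroup.lift_apply_of, FreeAbelianGroup.lift_apply_of, this,
        QuotientAddGroup.mk_neg, neg_add_cancel]
    · obtain ⟨tI, tH, tX, W, x, a, b, c, d, h, rfl⟩ := exists_isIHX_of_mem hy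
      change FreeAbelianGroup.lift _ _ = _
      rw [map_sub, map_sub, FreeAbelianGroup.lift_apply_of, FreeAbelianGroup.lift_apply_of,
        FreeAbelianGroup.lift_apply_of, ← QuotientAddGroup.mk_sub, ← QuotientAddGroup.mk_sub,
        QuotientAddGroup.eq_zero_iff, AddSubgroup.mem_addSubgroupOf]
      change (orientSign tI : ℤ) • cls tI.1.toSys - ((orientSign tH : ℤ) • cls tH.1.toSys
        - (orientSign tX : ℤ) • cls tX.1.toSys) ∈ _
      obtain ⟨h1, h2⟩ := h.orientSign_eq
      have := AddSubgroup.zsmul_mem _ h.cls_add_mem (orientSign tI : ℤ)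
      rw [smul_add, smul_add] at this
      rw [h1, h2, Units.val_neg, neg_smul]
      convert this using 1
      abel
  · change FreeAbelianGroup.lift _ _ = _
    rw [FreeAbelianGroup.lift_apply_of]

/-- The inverse of the map from trees with cyclic orderings to oriented trees. -/
theorem exists_chainHom (m n : ℕ) : ∃ κ : Chains m →+ TreeGroup m n,
    (∀ t : UTree m n, κ (cls t.1.toSys) = (orientSign t : ℤ) • treeClass t) ∧
    ∀ x ∈ (unrootedChains m (n + 2) 1).map (boundary m), κ x = 0 := by
  -- The value on a tree is computed with any cyclic orderings; the choice is irrelevant by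
  -- `orientSign_smul_treeClass`.
  obtain ⟨κ, hκ, -⟩ := exists_lift (m := m) (A := TreeGroup m n)
    (fun e t a => ∃ s : UTree m n, (⟨e, t⟩ : Σ e, Sys m e) = ⟨2 * n + 1, s.1.toSys⟩ ∧
      a = (orientSign s : ℤ) • treeClass s) (by
    rintro e t σ a b ⟨s, hs, rfl⟩ ⟨s', hs', rfl⟩
    obtain rfl : e = 2 * n + 1 := congrArg Sigma.fst hs
    obtain rfl : t = s.1.toSys := eq_of_heq (Sigma.mk.inj hs).2
    have h : s'.1.toSys = (UTree.renumber σ s).1.toSys :=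
      (eq_of_heq (Sigma.mk.inj hs').2).symm.trans (CycSys.toSys_relabel s.1 σ).symm
    rw [orientSign_smul_treeClass h, orientSign_renumber, treeClass_renumber, Units.val_mul,
      mul_smul])
  have hκ' : ∀ t : UTree m n, κ (cls t.1.toSys) = (orientSign t : ℤ) • treeClass t :=
    fun t => hκ _ _ _ ⟨t, rfl, rfl⟩
  refine ⟨κ, hκ', ?_⟩
  rintro _ ⟨x, hx, rfl⟩
  refine mem_closure_induction_cls (p := fun x => κ (boundary m x) = 0) ?_
    (by rw [map_zero, map_zero]) (fun x y hx hy => by rw [map_add, map_add, hx, hy, add_zero])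
    (fun x hx => by rw [map_neg, map_neg, hx, neg_zero]) hx
  rintro _ ⟨e, t, ht, hk, hd, rfl⟩
  -- A generating boundary is the sum of an IHX triple, and the signs turn its value into a multiple
  -- of the IHX relation.
  obtain ⟨tI, tH, tX, W, x, a, b, c, d, h, hb⟩ := exists_isIHX_boundary ht hk hd
  obtain ⟨h1, h2⟩ := h.orientSign_eq
  have h3 := congrArg (fun y => (orientSign tI : ℤ) • y) h.treeClass_eq
  rw [hb, map_add, map_add, hκ', hκ', hκ', h1, h2, Units.val_neg, neg_smul]
  simp only [smul_sub, smul_zero] at h3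
  rw [← h3]
  abel

/-- The group of unitrivalent trees is the homology in degree zero. -/
theorem exists_treeEquiv (m n : ℕ) :
    ∃ ι : TreeGroup m n ≃+ Homology (boundary m) (unrootedChains m (n + 2)) 0,
      ∀ t, ι (treeClass t) = QuotientAddGroup.mk (orientedCycle t) := by
  obtain ⟨f, hf⟩ := exists_treeHom m n
  obtain ⟨κ, hκ, hκ0⟩ := exists_chainHom m n
  obtain ⟨g, hg⟩ : ∃ g : Homology (boundary m) (unrootedChains m (n + 2)) 0 →+ TreeGroup m n,
      ∀ x : cycles (boundary m) (unrootedChains m (n + 2)) 0,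
        g (QuotientAddGroup.mk x) = κ x.1 :=
    ⟨QuotientAddGroup.lift _ (κ.comp (AddSubgroup.subtype _)) fun x hx =>
      hκ0 _ (AddSubgroup.mem_addSubgroupOf.1 hx), fun x => rfl⟩
  have hsq : ∀ (u : ℤˣ) {A : Type} [AddCommGroup A] (a : A), (u : ℤ) • (u : ℤ) • a = a := by
    intro u A _ a
    rw [smul_smul, ← Units.val_mul, Int.units_mul_self, Units.val_one, one_smul]
  have hgf : ∀ y, g (f y) = y := by
    intro y
    obtain ⟨y, rfl⟩ := QuotientAddGroup.mk_surjective y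
    induction y using FreeAbelianGroup.induction_on with
    | zero => rw [QuotientAddGroup.mk_zero, map_zero, map_zero]
    | of t =>
      change g (f (treeClass t)) = treeClass t
      rw [hf, hg]
      change κ ((orientSign t : ℤ) • cls t.1.toSys) = _
      rw [map_zsmul, hκ, hsq]
    | neg t h => rw [QuotientAddGroup.mk_neg, map_neg, map_neg, h]
    | add x y hx hy => rw [QuotientAddGroup.mk_add, map_add, map_add, hx, hy]
  have hfg : ∀ x, f (g x) = x := by
    have key : ∀ x ∈ unrootedChains m (n + 2) 0, ∃ hx, f (κ x) = QuotientAddGroup.mk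
        (⟨x, hx⟩ : cycles (boundary m) (unrootedChains m (n + 2)) 0) := by
      intro x hx
      refine mem_closure_induction_cls (p := fun x => ∃ hx, f (κ x) = QuotientAddGroup.mk
        (⟨x, hx⟩ : cycles (boundary m) (unrootedChains m (n + 2)) 0)) ?_
        ⟨zero_mem _, by rw [map_zero, map_zero]; rfl⟩ ?_ ?_ hx
      · rintro _ ⟨e, t, ht, hk, hd, rfl⟩
        refine ⟨mem_cycles_zero (cls_mem_unrootedChains ht hk hd), ?_⟩
        obtain ⟨s, hs⟩ := exists_utree ht hk hd
        obtain rfl : e = 2 * n + 1 := congrArg Sigma.fst hs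
        obtain rfl : t = s.1.toSys := eq_of_heq (Sigma.mk.inj hs).2
        rw [hκ, map_zsmul, hf, ← QuotientAddGroup.mk_zsmul]
        exact congrArg _ (Subtype.ext (hsq _ _))
      · rintro x y ⟨hx, hx'⟩ ⟨hy, hy'⟩
        exact ⟨add_mem hx hy, by rw [map_add, map_add, hx', hy']; rfl⟩
      · rintro x ⟨hx, hx'⟩
        exact ⟨neg_mem hx, by rw [map_neg, map_neg, hx']; rfl⟩
    intro x
    obtain ⟨x, rfl⟩ := QuotientAddGroup.mk_surjective x
    obtain ⟨_, h⟩ := key x.1 (AddSubgroup.mem_inf.1 x.2).1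
    rw [hg, h]
  exact ⟨{ f with invFun := g, left_inv := hgf, right_inv := hfg }, hf⟩

/-! ### The isomorphism induced by the chain map -/

theorem attachRoot_mem_cycles {k : ℕ} {x : Chains m}
    (hx : x ∈ cycles (boundary m) (unrootedChains m k) 0) :
    attachRoot m x ∈ cycles (boundaryBar m) (rootedChainsBar m k) 1 := by
  obtain ⟨hx, -⟩ := AddSubgroup.mem_inf.1 hx
  refine AddSubgroup.mem_inf.2 ⟨attachRoot_mem hx, ?_⟩
  rw [AddMonoidHom.mem_ker, boundaryBar_attachRoot hx, boundary_eq_zero hx, map_zero]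

/-- Surjectivity is `exists_attachRoot_of_cycle`. For injectivity, a class with bounding image is
first changed by a boundary into the kernel of η, and in degree zero this kernel consists of
boundaries; the latter needs `n ≠ 0`. -/
theorem exists_homologyEquiv (m : ℕ) (hn : 1 ≤ n) :
    ∃ φ : Homology (boundary m) (unrootedChains m (n + 2)) 0 ≃+
        Homology (boundaryBar m) (rootedChainsBar m (n + 2)) 1,
      ∀ x hx, φ (homologyClass _ _ 0 x hx)
        = homologyClass _ _ 1 (attachRoot m x) (attachRoot_mem_cycles hx) := by
  obtain ⟨f, hf⟩ : ∃ f : Homology (boundary m) (unrootedChains m (n + 2)) 0 →+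
        Homology (boundaryBar m) (rootedChainsBar m (n + 2)) 1,
      ∀ x hx, f (homologyClass _ _ 0 x hx)
        = homologyClass _ _ 1 (attachRoot m x) (attachRoot_mem_cycles hx) := by
    refine ⟨QuotientAddGroup.map _ _ (((attachRoot m).comp (AddSubgroup.subtype _)).codRestrict _
      fun x => attachRoot_mem_cycles x.2) ?_, fun x hx => rfl⟩
    intro x hx
    obtain ⟨y, hy, hyx⟩ := AddSubgroup.mem_addSubgroupOf.1 hx
    have h : attachRoot m x.1 ∈ (rootedChainsBar m (n + 2) 2).map (boundaryBar m) :=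
      ⟨attachRoot m y, attachRoot_mem hy, by rw [boundaryBar_attachRoot hy, hyx]⟩
    exact h
  refine ⟨AddEquiv.ofBijective f ⟨(injective_iff_map_eq_zero f).2 fun y hy => ?_, fun z => ?_⟩, hf⟩
  · obtain ⟨x, hx, rfl⟩ := homologyClass_surjective y
    rw [hf, homologyClass_eq_zero] at hy
    have hx0 := (AddSubgroup.mem_inf.1 hx).1
    obtain ⟨x', hx', h0⟩ := exists_boundary_of_attachRoot_mem hx0 hy
    have h1 := mem_map_boundary_of_attachRoot_eq_zero hn (sub_mem hx0 (boundary_mem hx')) h0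
    rw [homologyClass_eq_zero]
    have := add_mem h1 (AddSubgroup.mem_map_of_mem (boundary m) hx')
    rwa [sub_add_cancel] at this
  · obtain ⟨z, hz, rfl⟩ := homologyClass_surjective z
    obtain ⟨x, hx, h⟩ := exists_attachRoot_of_cycle hz
    refine ⟨homologyClass _ _ 0 x (mem_cycles_zero hx), ?_⟩
    rw [hf, ← sub_eq_zero, ← neg_eq_zero, neg_sub]
    exact homologyClass_eq_zero (hx := sub_mem hz (attachRoot_mem_cycles (mem_cycles_zero hx))).2 h

end TreeHomology

open TreeHomology in
theorem theorem4 (m n : ℕ) (hn : 1 ≤ n) :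
    -- attaching root edges is a chain map `𝕋_{•,n+2} → 𝕃̄_{•+1,n+2}`
    (∀ d, ∀ x ∈ unrootedChains m (n + 2) d,
      attachRoot m x ∈ rootedChainsBar m (n + 2) (d + 1) ∧
      boundaryBar m (attachRoot m x) = attachRoot m (boundary m x)) ∧
    -- `ι` identifies `𝒯_n` with `H_0(𝕋_{•,n+2})`, and the chain map induces the isomorphism `η`
    ∃ (ι : TreeGroup m n ≃+ Homology (boundary m) (unrootedChains m (n + 2)) 0)
      (η : TreeGroup m n ≃+ Homology (boundaryBar m) (rootedChainsBar m (n + 2)) 1),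
      (∀ t : UTree m n, Compatible t →
        ∃ h : cls t.1.toSys ∈ cycles (boundary m) (unrootedChains m (n + 2)) 0,
          ι (treeClass t)
            = homologyClass (boundary m) (unrootedChains m (n + 2)) 0 (cls t.1.toSys) h) ∧
      ∀ (x : Chains m) (hx : x ∈ cycles (boundary m) (unrootedChains m (n + 2)) 0),
        ∃ h : attachRoot m x ∈ cycles (boundaryBar m) (rootedChainsBar m (n + 2)) 1,
          η (ι.symm (homologyClass (boundary m) (unrootedChains m (n + 2)) 0 x hx))
            = homologyClass (boundaryBar m) (rootedChainsBar m (n + 2)) 1 (attachRoot m x) h := by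
  refine ⟨fun d x hx => ⟨attachRoot_mem hx, boundaryBar_attachRoot hx⟩, ?_⟩
  obtain ⟨ι, hι⟩ := exists_treeEquiv m n
  obtain ⟨φ, hφ⟩ := exists_homologyEquiv m hn
  refine ⟨ι, ι.trans φ, fun t ht => ⟨mem_cycles_zero (cls_utree_mem t), ?_⟩,
    fun x hx => ⟨attachRoot_mem_cycles hx, ?_⟩⟩
  · rw [hι]
    refine congrArg QuotientAddGroup.mk (Subtype.ext ?_)
    change (orientSign t : ℤ) • cls t.1.toSys = cls t.1.toSys
    rw [orientSign_of_compat ht, Units.val_one, one_smul]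
  · rw [AddEquiv.trans_apply, AddEquiv.apply_symm_apply, hφ]
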